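/- \textbf{Setting.} Let $\Omega\subset\mathbb R^N$ be open and let $J\subset\mathbb R$ be an open set of parameters. Consider a family, smooth in $\xi\in J$, of Lagrangian systems with masses $m_i(\xi)>0$, period $T(\xi)>0$, potential $U_\xi\in C^\infty(\Omega)$ (jointly smooth in $(\xi,q)$) and action $$S_\xi[q]=\int_0^{T}\Big(\tfrac12\sum_{i=1}^N m_i\dot q_i^2+U_\xi(q)\Big)\,dt$$ on smooth $T$-periodic functions $q$ with values in $\Omega$. Using the normalized time $t/T(\xi)$, all periodic functions are regarded as elements of one and the same space of smooth $1$-periodic functions $\mathbb R\to\mathbb R^N$. Let $q_o=q_o(\xi)$, $\xi\in J$, be a smooth family of stationary points of $S_\xi$, and let $$\mathcal H_{ij}=-\delta_{ij}m_i\frac{d^2}{dt^2}+\frac{\partial^2U_\xi}{\partial q_i\partial q_j}(q_o)$$ be the Hessian operator. Let $Z_\xi$ be the space of the functions $\big(m_i^{-1}\,\partial I_\xi/\partial \dot q_i\big)_i$ evaluated along $q_o(\xi)$, where $I_\xi(q,\dot q)$ runs over the families of first integrals of the equations of motion that are jointly smooth on $J\times\Omega\times\mathbb R^N$ (for example $dq_o/dt$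 from the energy). These are zero modes of $\mathcal H$ for every $\xi$ and are excluded from its eigenfunctions. For a function $\kappa:J\to\mathbb R$ let $$E_\xi=\{u:\ \mathcal H u=\kappa(\xi)u,\ u\perp Z_\xi\}$$ ($\perp$ in $L^2$). Let $G$ be a finite group acting on the periodic functions by linear $L^2$-isometries that preserve the set of functions with values in $\Omega$; it is a symmetry group for $q_o$ and $S$, that is, $g\,q_o(\xi)=q_o(\xi)$ and $S_\xi[gq]=S_\xi[q]$ for all $g\in G$, $\xi\in J$ and all periodic $q$ with values in $\Omega$. Put $\mathcal P_G=\frac1{|G|}\sum_{g\in G}g$. \textbf{Statement.} Suppose that for every $\xi\in J$ the space $\{u\in E_\xi:\ \mathcal P_G u=u\}$ is one-dimensional, spanned by $\phi_\xi$, and that $\kappa$ crosses zero at $\xi_0\in J$: it is continuous at $\xi_0$, $\kappa(\xi_0)=0$, and near $\xi_0$ it is negative on one side of $\xi_0$ and positive on the other. Put $\phi=\phi_{\xi_0}$. Then a bifurcation occurs at $\xi_0$ in the direction $\phi$, and the bifurcated solutions are $\mathcal P_G$-invariant. Precisely: (a) For every sufficiently small $r\ne0$ there are a parameter $\xi(r)\in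 J$ and a stationary point $q_b=q_b(r)\neq q_o(\xi(r))$ of $S_{\xi(r)}$ with $\mathcal P_Gq_b=q_b$, such that, as $r\to0$, $\xi(r)\to\xi_0$ and $q_b(r)=q_o(\xi(r))+r\phi+o(r)$, uniformly in time together with the first time derivative. (b) At $\xi=\xi_0$ the Lyapunov--Schmidt reduction in the subspace $\mathcal P_G=1$ exists: for all small $r$ there is $w(r)=O(r^2)$ (in $C^1$) with $\mathcal P_Gw(r)=w(r)$ and $w(r)\perp\phi,Z_{\xi_0}$, such that the first variation of $S_{\xi_0}$ at $q_o+r\phi+w(r)$ vanishes on all $v$ with $\mathcal P_Gv=v$ and $v\perp\phi,Z_{\xi_0}$. Let $S_{LS}(r)=S_{\xi_0}[q_o+r\phi+w(r)]-S_{\xi_0}[q_o]$ be the reduced action. If not all of its Taylor coefficients vanish, that is, if $S_{LS}(r)=\frac{A_n}{n!}r^n+o(r^n)$ with $n\ge3$ and $A_n\ne0$, then for each sign $\sigma=\pm1$ and for every $\xi$ sufficiently close to $\xi_0$ with $\sigma^nA_n\kappa(\xi)<0$ there is a stationary point $q_b(\xi)\ne q_o(\xi)$ of $S_\xi$ with $\mathcal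 P_Gq_b=q_b$ and $q_b(\xi)=q_o(\xi)+r_b\phi+o(r_b)$ (uniformly in time together with the first time derivative), where $\sigma r_b(\xi)>0$ and $r_b(\xi)\to0$ as $\xi\to\xi_0$. (So for odd $n$ there is a bifurcated solution on each side of $\xi_0$, and for even $n$ there are two of them on the side where $\kappa/A_n<0$.) -/

import Mathlib

open Filter Topology Asymptotics
open scoped ContDiff

noncomputable section

/-- Configuration space: `N` generalized coordinates. -/
abbrev Config (N : ℕ) : Type := EuclideanSpace ℝ (Fin N)

/-- Smooth periodic functions with values in the configuration space, written in the normalized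
time `s = t / T`, so that the period is `1`. -/
def loopSpace (N : ℕ) : Submodule ℝ (ℝ → Config N) where
  carrier := {q | ContDiff ℝ ∞ q ∧ Function.Periodic q 1}
  zero_mem' := ⟨contDiff_const, fun _ => rfl⟩
  add_mem' := fun ha hb => ⟨ha.1.add hb.1, ha.2.add hb.2⟩
  smul_mem' := fun c _ ha => ⟨contDiff_const.smul ha.1, fun s => congrArg (c • ·) (ha.2 s)⟩

/-- The function space of the problem. -/
abbrev Loop (N : ℕ) : Type := loopSpace N

/-- The `L²` inner product of two periodic functions. -/
def loopInner {N : ℕ} (u v : ℝ → Config N) : ℝ := ∫ s in (0 : ℝ)..1, inner ℝ (u s) (v s)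

/-- `u` and its time derivative are bounded by `b`, uniformly in time. -/
def C1Le {N : ℕ} (u : Loop N) (b : ℝ) : Prop :=
  ∀ s : ℝ, ‖u.1 s‖ ≤ b ∧ ‖deriv u.1 s‖ ≤ b

/-- A family of Lagrangians `½ ∑ mᵢ (dqᵢ/dt)² + U(q)` depending smoothly on a real parameter `ξ`.
The masses, the potential and the period may all depend on the parameter. The potential is smooth
on an open set of configurations (for instance the collision-free ones). -/
structure LagrangianFamily (N : ℕ) where
  /-- the range of the parameter -/
  param : Set ℝ
  /-- the admissible configurations -/
  dom : Set (Config N)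
  /-- the masses -/
  mass : ℝ → Fin N → ℝ
  /-- the period -/
  period : ℝ → ℝ
  /-- the potential (with the sign opposite to that of the potential energy) -/
  pot : ℝ → Config N → ℝ
  isOpen_param : IsOpen param
  isOpen_dom : IsOpen dom
  mass_pos : ∀ ξ ∈ param, ∀ i, 0 < mass ξ i
  period_pos : ∀ ξ ∈ param, 0 < period ξ
  contDiffOn_mass : ∀ i, ContDiffOn ℝ ∞ (fun ξ => mass ξ i) param
  contDiffOn_period : ContDiffOn ℝ ∞ period param
  contDiffOn_pot : ContDiffOn ℝ ∞ (fun p : ℝ × Config N => pot p.1 p.2) (param ×ˢ dom)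

namespace LagrangianFamily

variable {N : ℕ} (L : LagrangianFamily N)

/-- The periodic function `q` takes only admissible values. -/
def Inside (q : Loop N) : Prop := ∀ s, q.1 s ∈ L.dom

/-- The action `∫₀ᵀ (½ ∑ mᵢ (dqᵢ/dt)² + U(q)) dt`, after the substitution `t = T s`. -/
def action (ξ : ℝ) (q : Loop N) : ℝ :=
  ∫ s in (0 : ℝ)..1, L.period ξ *
    ((1 / 2) * ∑ i, L.mass ξ i * (deriv q.1 s i / L.period ξ) ^ 2 + L.pot ξ (q.1 s))

/-- `q` is a stationary point of the action: the first variation vanishes in every direction. -/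
def IsStationary (ξ : ℝ) (q : Loop N) : Prop :=
  L.Inside q ∧ ∀ v : Loop N, HasDerivAt (fun ε : ℝ => L.action ξ (q + ε • v)) 0 0

/-- The Hessian operator `(H u)ᵢ = - mᵢ d²uᵢ/dt² + ∑ⱼ (∂²U/∂qᵢ∂qⱼ)(q) uⱼ` of the action at `q`,
with `d/dt = T⁻¹ d/ds`. -/
def hessian (ξ : ℝ) (q u : Loop N) (s : ℝ) : Config N :=
  WithLp.toLp 2 fun i =>
    - L.mass ξ i * (iteratedDeriv 2 u.1 s i / L.period ξ ^ 2)
      + fderiv ℝ (gradient (L.pot ξ)) (q.1 s) (u.1 s) i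

/-- The acceleration `mᵢ⁻¹ ∂U/∂qᵢ` given by the equations of motion. -/
def accel (ξ : ℝ) (x : Config N) : Config N :=
  WithLp.toLp 2 fun i => gradient (L.pot ξ) x i / L.mass ξ i

/-- A conservation law of the family: a smooth function `I ξ x v` of the parameter, the position
and the velocity that is, for every value of the parameter, a first integral of the equations of
motion. -/
structure IsConserved (I : ℝ → Config N → Config N → ℝ) : Prop where
  contDiffOn : ContDiffOn ℝ ∞ (fun p : ℝ × Config N × Config N => I p.1 p.2.1 p.2.2)
    (L.param ×ˢ L.dom ×ˢ Set.univ)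
  conserved : ∀ ξ ∈ L.param, ∀ x ∈ L.dom, ∀ v : Config N,
    fderiv ℝ (fun y => I ξ y v) x v + fderiv ℝ (fun w => I ξ x w) v (L.accel ξ x) = 0

/-- The variation of `q` connected to a conservation law (Noether), `mᵢ⁻¹ ∂I/∂vᵢ` along `q`: `dq/dt`
for the energy, a constant vector for a momentum, an infinitesimal rotation of `q` for an angular
momentum. At a stationary point it belongs to the eigenvalue `0` of the Hessian. -/
def noetherMode (I : ℝ → Config N → Config N → ℝ) (ξ : ℝ) (q : Loop N) (s : ℝ) : Config N :=
  WithLp.toLp 2 fun i =>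
    gradient (fun w => I ξ (q.1 s) w) ((L.period ξ)⁻¹ • deriv q.1 s) i / L.mass ξ i

/-- `u` is orthogonal to all the variations of `q` connected to conservation laws. -/
def OrthNoether (ξ : ℝ) (q u : Loop N) : Prop :=
  ∀ I, L.IsConserved I → loopInner (L.noetherMode I ξ q) u.1 = 0

/-- The eigenspace of the Hessian at `q` for the eigenvalue `κ`, where the eigenfunctions that are
connected to conservation laws are excluded. -/
def eigenfunctions (ξ : ℝ) (q : Loop N) (κ : ℝ) : Set (Loop N) :=
  {u | (∀ s, L.hessian ξ q u s = κ • u.1 s) ∧ L.OrthNoether ξ q u}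

end LagrangianFamily

/-- The projection operator `P_G = |G|⁻¹ ∑ g`. -/
def groupProj {N : ℕ} {G : Type*} [Group G] [Fintype G] (ρ : Representation ℝ G (Loop N)) :
    Loop N →ₗ[ℝ] Loop N :=
  (Fintype.card G : ℝ)⁻¹ • ∑ g : G, ρ g

namespace LagrangianFamily

variable {N : ℕ} (L : LagrangianFamily N)

/-- `G`, acting by linear `L²`-isometries on the periodic functions, is a symmetry group for the
solutions `qo ξ` and for the action: `g qo = qo`, and `S[g q] = S[q]` for all `q`. -/
structure IsSymmetryGroup {G : Type*} [Group G] (ρ : Representation ℝ G (Loop N))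
    (qo : ℝ → Loop N) : Prop where
  isometry : ∀ g u v, loopInner (ρ g u).1 (ρ g v).1 = loopInner u.1 v.1
  inside : ∀ g q, L.Inside q → L.Inside (ρ g q)
  action_eq : ∀ ξ ∈ L.param, ∀ g q, L.Inside q → L.action ξ (ρ g q) = L.action ξ q
  fixed : ∀ ξ ∈ L.param, ∀ g, ρ g (qo ξ) = qo ξ

/-- A smooth family of stationary points, one for each value of the parameter. -/
structure IsSolutionFamily (qo : ℝ → Loop N) : Prop where
  contDiffOn : ContDiffOn ℝ ∞ (fun p : ℝ × ℝ => (qo p.1).1 p.2) (L.param ×ˢ Set.univ)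
  stationary : ∀ ξ ∈ L.param, L.IsStationary ξ (qo ξ)

/-- Along the filter `l`, the stationary points `qb a` at the parameters `ξ a` bifurcate at `ξ₀` from
the family `qo` in the direction `φ`, with amplitude `r a`, and are invariant under `P`:
`qb = qo + r φ + o(r)` with `ξ → ξ₀` and `0 ≠ r → 0`. -/
structure IsBifurcatingBranch {ι : Type*} (qo : ℝ → Loop N) (P : Loop N →ₗ[ℝ] Loop N)
    (ξ₀ : ℝ) (φ : Loop N) (l : Filter ι) (ξ r : ι → ℝ) (qb : ι → Loop N) : Prop where
  tendsto_param : Tendsto ξ l (𝓝 ξ₀)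
  tendsto_amplitude : Tendsto r l (𝓝[≠] 0)
  mem_param : ∀ᶠ a in l, ξ a ∈ L.param
  stationary : ∀ᶠ a in l, L.IsStationary (ξ a) (qb a)
  ne : ∀ᶠ a in l, qb a ≠ qo (ξ a)
  invariant : ∀ᶠ a in l, P (qb a) = qb a
  direction : ∀ ε > 0, ∀ᶠ a in l, C1Le (qb a - qo (ξ a) - r a • φ) (ε * |r a|)

/-- `w` solves the complementary equations of the Lyapunov-Schmidt reduction at the stationary
point `q` in the subspace `P = 1`: `w r` is the `O(r²)` correction, orthogonal to `φ`, for which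
`q + r φ + w r` is stationary with respect to all variations in this subspace orthogonal to `φ`
(throughout modulo the variations connected to conservation laws). -/
structure IsReduction (ξ : ℝ) (q : Loop N) (P : Loop N →ₗ[ℝ] Loop N) (φ : Loop N)
    (w : ℝ → Loop N) : Prop where
  small : ∃ C : ℝ, ∀ᶠ r in 𝓝 (0 : ℝ), C1Le (w r) (C * r ^ 2)
  mem : ∀ᶠ r in 𝓝 (0 : ℝ), P (w r) = w r ∧ loopInner φ.1 (w r).1 = 0 ∧ L.OrthNoether ξ q (w r)
  stationary : ∀ᶠ r in 𝓝 (0 : ℝ), ∀ v : Loop N,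
    P v = v → loopInner φ.1 v.1 = 0 → L.OrthNoether ξ q v →
      HasDerivAt (fun ε : ℝ => L.action ξ (q + r • φ + w r + ε • v)) 0 0

/-- The reduced action `S_LS(r) = S[q + r φ + w r] - S[q]`. -/
def reducedAction (ξ : ℝ) (q φ : Loop N) (w : ℝ → Loop N) (r : ℝ) : ℝ :=
  L.action ξ (q + r • φ + w r) - L.action ξ q

end LagrangianFamily

/-- `κ` is continuous at `ξ₀`, vanishes there, and has opposite signs on the two sides of `ξ₀`. -/
def CrossesZero (κ : ℝ → ℝ) (ξ₀ : ℝ) : Prop :=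
  ContinuousAt κ ξ₀ ∧ κ ξ₀ = 0 ∧
    (((∀ᶠ ξ in 𝓝[<] ξ₀, κ ξ < 0) ∧ ∀ᶠ ξ in 𝓝[>] ξ₀, 0 < κ ξ) ∨
      ((∀ᶠ ξ in 𝓝[<] ξ₀, 0 < κ ξ) ∧ ∀ᶠ ξ in 𝓝[>] ξ₀, κ ξ < 0))

end

noncomputable section

/-! The proof is a Lyapunov–Schmidt reduction in which the conservation laws and the group enter
only after the projected equation has been solved.

Let K be the kernel of the Hessian at ξ₀, P the L² projector on K, and γ the L² gradient of the
action, divided by the period, at `qo ξ + v`. The projected problem asks for γ ∈ K and P v = r φ.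
Both conditions are contained in the single equation γ - P γ + P v = r φ (`isReducedSol_iff`). A
Green operator for the second derivative turns it into an equation for continuous functions whose
linearization is the identity minus a compact operator. Self-adjointness of the Hessian makes this
linearization injective, so near (ξ₀, 0) there is a unique small solution u(ξ, r), Lipschitz in r
together with its time derivative (`exists_isBranch`). Uniqueness makes it invariant under the group
(`IsBranch.exists_rho_eq`).

It remains to make γ vanish. The invariant elements of K are spanned by φ and the symmetrized
Noether modes at ξ₀. By Noether's identity γ is orthogonal to the modes computed along the loop `qo
ξ + u ξ r` itself, which are close to the modes along `qo ξ₀`. Hence γ equals its component along φ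
up to o(γ) (`IsBranch.isLittleO_elGrad`), and near the bifurcation point the scalar equation F(ξ, r)
= ⟨φ, γ⟩ = 0 (`bifFun`) already forces γ = 0. The rank of the Noether modes need not be constant in
ξ.

The sign of F comes from pairing γ with the eigenfunction ψ at ξ, which gives κ(ξ) ⟨u, ψ⟩ + o(r).
Since γ, u and ψ are all nearly parallel to φ, κ(ξ) F(ξ, r) r > 0 for κ(ξ) ≠ 0 and small r ≠ 0, how
small depending on ξ (`IsBranch.exists_bifFun_pos`). For (a), with r fixed, F has opposite signs at
two parameters where κ has opposite signs, and the intermediate value theorem in ξ gives a zero. For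
(b), the period times F is the r-derivative of the action along u (`IsBranch.hasDerivAt_action`).
The leading term of the reduced action therefore fixes the sign of F(ξ₀, σ t) for some small t > 0,
and this sign persists for ξ near ξ₀. Close to r = 0 the sign is that of κ r. The two are opposite
when κ Aₙ σⁿ < 0, and the intermediate value theorem in r gives a zero. -/

/-- Continuous `1`-periodic functions with the sup norm. -/
abbrev PerFun (N : ℕ) : Type := C(AddCircle (1 : ℝ), Config N)

/-! ### Periodic functions in the sup norm: mean, primitive and compactness -/

namespace PerFun

variable {N : ℕ}

/-- The element of `PerFun N` defined by a continuous periodic function. -/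
def mk' (f : ℝ → Config N) (hf : Continuous f) (hp : Function.Periodic f 1) : PerFun N where
  toFun := hp.lift
  continuous_toFun := continuous_coinduced_dom.mpr hf

@[simp] theorem mk'_apply (f : ℝ → Config N) (hf : Continuous f) (hp : Function.Periodic f 1)
    (s : ℝ) : mk' f hf hp (s : AddCircle (1 : ℝ)) = f s := rfl

theorem ext_real {u v : PerFun N} (h : ∀ s : ℝ, u (s : AddCircle (1 : ℝ)) = v (s : AddCircle (1 : ℝ))) :
    u = v := by
  ext1 x
  induction x using QuotientAddGroup.induction_on with
  | H s => exact h s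

theorem continuous_real (u : PerFun N) : Continuous fun s : ℝ => u (s : AddCircle (1 : ℝ)) :=
  u.continuous.comp (AddCircle.continuous_mk' 1)

theorem periodic_real (u : PerFun N) : Function.Periodic (fun s : ℝ => u (s : AddCircle (1 : ℝ))) 1 :=
  fun s => by simp

theorem norm_le_of_real {u : PerFun N} {C : ℝ} (hC : 0 ≤ C)
    (h : ∀ s : ℝ, ‖u (s : AddCircle (1 : ℝ))‖ ≤ C) : ‖u‖ ≤ C := by
  rw [ContinuousMap.norm_le _ hC]
  intro x
  induction x using QuotientAddGroup.induction_on with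
  | H s => exact h s

theorem norm_coe_le (u : PerFun N) (x : AddCircle (1 : ℝ)) : ‖u x‖ ≤ ‖u‖ := u.norm_coe_le_norm x

/-- The mean value over a period. -/
def mean (N : ℕ) : PerFun N →L[ℝ] Config N :=
  LinearMap.mkContinuous
    { toFun := fun u => ∫ s in (0 : ℝ)..1, u (s : AddCircle (1 : ℝ))
      map_add' := fun u v => by
        simp only [ContinuousMap.add_apply]
        exact intervalIntegral.integral_add (u.continuous_real.intervalIntegrable _ _)
          (v.continuous_real.intervalIntegrable _ _)
      map_smul' := fun c u => by
        simp only [ContinuousMap.smul_apply, RingHom.id_apply]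
        exact intervalIntegral.integral_smul _ _ } 1 fun u => by
    have := intervalIntegral.norm_integral_le_of_norm_le_const (a := (0 : ℝ)) (b := 1)
      (f := fun s : ℝ => u (s : AddCircle (1 : ℝ))) (C := ‖u‖) (fun s _ => u.norm_coe_le _)
    simpa using this

theorem mean_apply (u : PerFun N) : mean N u = ∫ s in (0 : ℝ)..1, u (s : AddCircle (1 : ℝ)) := rfl

theorem norm_mean_le (u : PerFun N) : ‖mean N u‖ ≤ ‖u‖ := by
  have := intervalIntegral.norm_integral_le_of_norm_le_const (a := (0 : ℝ)) (b := 1)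
    (f := fun s : ℝ => u (s : AddCircle (1 : ℝ))) (C := ‖u‖) (fun s _ => u.norm_coe_le _)
  simpa [mean_apply] using this

/-- Constant functions. -/
def constL (N : ℕ) : Config N →L[ℝ] PerFun N :=
  LinearMap.mkContinuous
    { toFun := fun x => ContinuousMap.const _ x
      map_add' := fun _ _ => rfl
      map_smul' := fun _ _ => rfl } 1 fun x => by
    rw [one_mul]
    exact norm_le_of_real (norm_nonneg _) fun s => le_rfl

@[simp] theorem constL_apply (x : Config N) (s : AddCircle (1 : ℝ)) : constL N x s = x := rfl

/-- The value at time `0`. -/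
def eval0 (N : ℕ) : PerFun N →L[ℝ] Config N := ContinuousMap.evalCLM ℝ ((0 : ℝ) : AddCircle (1 : ℝ))

/-- The primitive vanishing at `0` of the function minus its mean value. -/
def primFun (u : PerFun N) (s : ℝ) : Config N :=
  ∫ t in (0 : ℝ)..s, (u (t : AddCircle (1 : ℝ)) - mean N u)

theorem continuous_sub_mean (u : PerFun N) :
    Continuous fun s : ℝ => u (s : AddCircle (1 : ℝ)) - mean N u :=
  u.continuous_real.sub continuous_const

theorem hasDerivAt_primFun (u : PerFun N) (s : ℝ) :
    HasDerivAt (primFun u) (u (s : AddCircle (1 : ℝ)) - mean N u) s :=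
  intervalIntegral.integral_hasDerivAt_right (u.continuous_sub_mean.intervalIntegrable _ _)
    (u.continuous_sub_mean.stronglyMeasurableAtFilter _ _) u.continuous_sub_mean.continuousAt

theorem periodic_primFun (u : PerFun N) : Function.Periodic (primFun u) 1 := by
  intro s
  have hint := u.continuous_sub_mean.intervalIntegrable (μ := MeasureTheory.volume)
  have hper : Function.Periodic (fun s : ℝ => u (s : AddCircle (1 : ℝ)) - mean N u) 1 :=
    fun s => by simp
  have h1 := intervalIntegral.integral_add_adjacent_intervals (μ := MeasureTheory.volume)
    (hint 0 s) (hint s (s + 1))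
  have h2 := hper.intervalIntegral_add_eq s 0
  have h3 : ∫ t in (0 : ℝ)..0 + 1, (u (t : AddCircle (1 : ℝ)) - mean N u) = 0 := by
    rw [zero_add, intervalIntegral.integral_sub (u.continuous_real.intervalIntegrable _ _)
      (continuous_const.intervalIntegrable _ _), ← mean_apply]
    simp
  rw [primFun, ← h1, h2, h3, add_zero, primFun]

theorem lipschitz_primFun (u : PerFun N) (s t : ℝ) :
    ‖primFun u t - primFun u s‖ ≤ 2 * ‖u‖ * |t - s| := by
  have hint := u.continuous_sub_mean.intervalIntegrable (μ := MeasureTheory.volume)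
  rw [primFun, primFun, intervalIntegral.integral_interval_sub_left (hint _ _) (hint _ _)]
  refine intervalIntegral.norm_integral_le_of_norm_le_const fun x _ => ?_
  calc _ ≤ ‖u (x : AddCircle (1 : ℝ))‖ + ‖mean N u‖ := norm_sub_le _ _
    _ ≤ ‖u‖ + ‖u‖ := add_le_add (u.norm_coe_le _) u.norm_mean_le
    _ = _ := by ring

theorem exists_coe_eq (x : AddCircle (1 : ℝ)) : ∃ s ∈ Set.Icc (0 : ℝ) 1, (s : AddCircle (1 : ℝ)) = x := by
  obtain ⟨s, hs, rfl⟩ := (AddCircle.coe_image_Icc_eq (1 : ℝ) 0).symm ▸ Set.mem_univ x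
  exact ⟨s, by simpa using hs, rfl⟩

theorem norm_primFun_le (u : PerFun N) (s : ℝ) (hs : s ∈ Set.Icc (0 : ℝ) 1) :
    ‖primFun u s‖ ≤ 2 * ‖u‖ := by
  have h := lipschitz_primFun u 0 s
  have h0 : primFun u 0 = 0 := by simp [primFun]
  rw [h0, sub_zero, sub_zero, abs_of_nonneg hs.1] at h
  nlinarith [norm_nonneg u, hs.2]

/-- The primitive vanishing at `0` of the function minus its mean value, as an operator. -/
def prim (N : ℕ) : PerFun N →L[ℝ] PerFun N :=
  LinearMap.mkContinuous
    { toFun := fun u => mk' (primFun u)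
        (continuous_iff_continuousAt.2 fun s => (hasDerivAt_primFun u s).continuousAt)
        (periodic_primFun u)
      map_add' := fun u v => ext_real fun s => by
        simp only [mk'_apply, ContinuousMap.add_apply, primFun, map_add]
        rw [← intervalIntegral.integral_add (u.continuous_sub_mean.intervalIntegrable _ _)
          (v.continuous_sub_mean.intervalIntegrable _ _)]
        congr 1; ext1 t; abel
      map_smul' := fun c u => ext_real fun s => by
        simp only [mk'_apply, ContinuousMap.smul_apply, primFun, map_smul, RingHom.id_apply]
        rw [← intervalIntegral.integral_smul]
        simp only [smul_sub] } 2 fun u => by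
    refine norm_le_of_real (by positivity) fun s => ?_
    obtain ⟨t, ht, hts⟩ := exists_coe_eq (s : AddCircle (1 : ℝ))
    rw [← hts]
    exact norm_primFun_le u t ht

@[simp] theorem prim_apply (u : PerFun N) (s : ℝ) :
    prim N u (s : AddCircle (1 : ℝ)) = primFun u s := rfl

theorem prim_zero (u : PerFun N) : prim N u ((0 : ℝ) : AddCircle (1 : ℝ)) = 0 := by
  rw [prim_apply]
  simp [primFun]

theorem hasDerivAt_prim (u : PerFun N) (s : ℝ) :
    HasDerivAt (fun s : ℝ => prim N u (s : AddCircle (1 : ℝ))) (u (s : AddCircle (1 : ℝ)) - mean N u) s :=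
  hasDerivAt_primFun u s

theorem dist_prim_le (u : PerFun N) (x y : AddCircle (1 : ℝ)) :
    dist (prim N u x) (prim N u y) ≤ 2 * ‖u‖ * dist x y := by
  induction x using QuotientAddGroup.induction_on with
  | H s =>
  induction y using QuotientAddGroup.induction_on with
  | H t =>
  obtain ⟨d, hd, hd'⟩ : ∃ d : ℝ, ((d : ℝ) : AddCircle (1 : ℝ)) = ((s - t : ℝ) : AddCircle (1 : ℝ)) ∧
      |d| = ‖((s - t : ℝ) : AddCircle (1 : ℝ))‖ := by
    -- The representative of s - t nearest to 0 realizes the distance on the circle.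
    refine ⟨(s - t) - round (s - t), ?_, ?_⟩
    · have := AddCircle.coe_period (1 : ℝ)
      have h : (((round (s - t) : ℤ) : ℝ) : AddCircle (1 : ℝ)) = 0 := by
        rw [AddCircle.coe_eq_zero_iff]
        exact ⟨round (s - t), by simp⟩
      rw [AddCircle.coe_sub, h, sub_zero]
    · rw [AddCircle.norm_eq]; simp
  have hst : ((s : ℝ) : AddCircle (1 : ℝ)) = ((t + d : ℝ) : AddCircle (1 : ℝ)) := by
    rw [AddCircle.coe_add, hd, ← AddCircle.coe_add]; congr 1; ring
  have hdist : dist (s : AddCircle (1 : ℝ)) (t : AddCircle (1 : ℝ)) = |d| := by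
    rw [dist_eq_norm, ← AddCircle.coe_sub, hd']
  change dist (prim N u (s : AddCircle (1 : ℝ))) (prim N u (t : AddCircle (1 : ℝ))) ≤
    2 * ‖u‖ * dist (s : AddCircle (1 : ℝ)) (t : AddCircle (1 : ℝ))
  rw [hdist, hst, prim_apply, prim_apply, dist_eq_norm]
  simpa using lipschitz_primFun u t (t + d)

/-- Arzelà–Ascoli: primitives of functions in the unit ball are bounded by 2 and have Lipschitz
constant 2. -/
theorem isCompactOperator_prim : IsCompactOperator (prim N) := by
  refine (isCompactOperator_iff_isCompact_closure_image_closedBall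
    (prim N : PerFun N →ₗ[ℝ] PerFun N) zero_lt_one).2 ?_
  set e := ContinuousMap.isometryEquivBoundedOfCompact (AddCircle (1 : ℝ)) (Config N)
  have hcomp : IsCompact (closure (e '' ((prim N) '' Metric.closedBall 0 1))) := by
    refine BoundedContinuousFunction.arzela_ascoli (Metric.closedBall 0 2) (isCompact_closedBall _ _)
      _ ?_ ?_
    · rintro f x ⟨_, ⟨u, hu, rfl⟩, rfl⟩
      rw [mem_closedBall_zero_iff] at hu ⊢
      change ‖prim N u x‖ ≤ 2
      obtain ⟨s, hs, rfl⟩ := exists_coe_eq x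
      exact (norm_primFun_le u s hs).trans (by linarith)
    · refine Metric.equicontinuous_of_continuity_modulus (fun t => 2 * t) ?_ _ ?_
      · have : Tendsto (fun t : ℝ => 2 * t) (𝓝 0) (𝓝 (2 * 0)) :=
          (continuous_const_mul (2 : ℝ)).tendsto 0
        simpa using this
      · rintro x y ⟨_, ⟨_, ⟨u, hu, rfl⟩, rfl⟩⟩
        rw [mem_closedBall_zero_iff] at hu
        change dist (prim N u x) (prim N u y) ≤ 2 * dist x y
        refine (dist_prim_le u x y).trans ?_
        nlinarith [dist_nonneg (x := x) (y := y)]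
  have := hcomp.image e.symm.continuous
  change IsCompact (e.symm.toHomeomorph '' _) at this
  rw [Homeomorph.image_closure] at this
  have he : e.symm.toHomeomorph '' (e '' ((prim N) '' Metric.closedBall 0 1)) =
      (prim N) '' Metric.closedBall 0 1 := by
    rw [← Set.image_comp]
    have : e.symm.toHomeomorph ∘ e = id := funext fun x => e.symm_apply_apply x
    rw [this, Set.image_id]
  rw [he] at this
  exact this

/-! ### The Green operator and regularity of solutions -/

/-- The inverse of `u ↦ - u'' + u 0`. -/
def green (N : ℕ) : PerFun N →L[ℝ] PerFun N := constL N ∘L mean N - prim N ∘L prim N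

theorem green_apply (p : PerFun N) (s : ℝ) : green N p (s : AddCircle (1 : ℝ)) =
    mean N p - prim N (prim N p) (s : AddCircle (1 : ℝ)) := rfl

theorem isCompactOperator_green : IsCompactOperator (green N) := by
  have h1 : IsCompactOperator (constL N ∘L mean N) :=
    (isCompactOperator_id (E := Config N)).comp_clm (mean N) |>.clm_comp (constL N)
  have h2 : IsCompactOperator (prim N ∘L prim N) := isCompactOperator_prim.comp_clm (prim N)
  exact h1.sub h2

theorem green_zero (p : PerFun N) : green N p ((0 : ℝ) : AddCircle (1 : ℝ)) = mean N p := by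
  rw [green_apply, prim_zero, sub_zero]

/-- `v` is the derivative of `u`. -/
def IsDeriv (u v : PerFun N) : Prop :=
  ∀ s : ℝ, HasDerivAt (fun s : ℝ => u (s : AddCircle (1 : ℝ))) (v (s : AddCircle (1 : ℝ))) s

theorem IsDeriv.mean_eq_zero {u v : PerFun N} (h : IsDeriv u v) : mean N v = 0 := by
  rw [mean_apply, intervalIntegral.integral_eq_sub_of_hasDerivAt (fun s _ => h s)
    (v.continuous_real.intervalIntegrable _ _)]
  simpa [sub_eq_zero] using u.periodic_real 0

theorem IsDeriv.prim_eq {u v : PerFun N} (h : IsDeriv u v) :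
    prim N v = u - constL N (u ((0 : ℝ) : AddCircle (1 : ℝ))) := by
  refine ext_real fun s => ?_
  rw [prim_apply, primFun, h.mean_eq_zero]
  simp only [sub_zero, ContinuousMap.sub_apply, constL_apply]
  exact intervalIntegral.integral_eq_sub_of_hasDerivAt (fun s _ => h s)
    (v.continuous_real.intervalIntegrable _ _)

theorem prim_const (x : Config N) : prim N (constL N x) = 0 := by
  refine ext_real fun s => ?_
  rw [prim_apply, primFun]
  simp [mean_apply]

theorem IsDeriv.green_eq {u v z : PerFun N} (h : IsDeriv u v) (h' : IsDeriv v z) :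
    green N (constL N (u ((0 : ℝ) : AddCircle (1 : ℝ))) - z) = u := by
  refine ext_real fun s => ?_
  have h1 : prim N (prim N (constL N (u ((0 : ℝ) : AddCircle (1 : ℝ))) - z)) =
      constL N (u ((0 : ℝ) : AddCircle (1 : ℝ))) - u := by
    rw [map_sub, prim_const, zero_sub, map_neg, h'.prim_eq, map_sub, prim_const, sub_zero,
      h.prim_eq, neg_sub]
  rw [green_apply, h1, map_sub, h'.mean_eq_zero]
  simp [mean_apply]

/-- The derivative of `green N p`. -/
def greenDeriv (p : PerFun N) : PerFun N := constL N (mean N (prim N p)) - prim N p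

theorem isDeriv_green (p : PerFun N) : IsDeriv (green N p) (greenDeriv p) := fun s => by
  have := (hasDerivAt_prim (prim N p) s).const_sub (mean N p)
  refine this.congr_deriv ?_
  exact neg_sub _ _

theorem isDeriv_greenDeriv (p : PerFun N) : IsDeriv (greenDeriv p) (constL N (mean N p) - p) :=
  fun s => by
    have := (hasDerivAt_prim p s).const_sub (mean N (prim N p))
    refine this.congr_deriv ?_
    exact neg_sub _ _

/-- This is how the second-order equation u'' = z becomes a fixed-point equation for continuous
functions. The term u(0) makes -d²/ds² invertible on constants; no condition on the mean of z is
imposed, since evaluating the fixed-point equation at 0 forces that mean to vanish. -/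
theorem eq_green_iff {u z : PerFun N} :
    u = green N (constL N (u ((0 : ℝ) : AddCircle (1 : ℝ))) - z) ↔
      ∃ v, IsDeriv u v ∧ IsDeriv v z := by
  constructor
  · intro h
    set p := constL N (u ((0 : ℝ) : AddCircle (1 : ℝ))) - z with hp
    refine ⟨greenDeriv p, ?_, ?_⟩
    · conv => enter [1]; rw [h]
      exact isDeriv_green p
    · have h0 : mean N p = u ((0 : ℝ) : AddCircle (1 : ℝ)) := by
        rw [← green_zero, ← h]
      have := isDeriv_greenDeriv p
      rw [h0] at this
      convert this using 1
      rw [hp]; abel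
  · rintro ⟨v, h, h'⟩
    exact (h.green_eq h').symm

/-- Bootstrapping: if w is Cⁿ, so is the right-hand side, hence w' and w gain regularity. -/
theorem contDiff_of_ode {w w' : ℝ → Config N} {Θ : ℝ × Config N → Config N}
    {O : Set (ℝ × Config N)} (hΘ : ContDiffOn ℝ ∞ Θ O)
    (hmem : ∀ s, (s, w s) ∈ O) (hw : ∀ s, HasDerivAt w (w' s) s)
    (hw' : ∀ s, HasDerivAt w' (Θ (s, w s)) s) : ContDiff ℝ ∞ w := by
  have key : ∀ n : ℕ, ContDiff ℝ n w := by
    intro n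
    induction n with
    | zero => exact contDiff_zero.2 (continuous_iff_continuousAt.2 fun s => (hw s).continuousAt)
    | succ n ih =>
      have h1 : ContDiff ℝ n fun s => Θ (s, w s) := by
        have h2 : ContDiffOn ℝ n (fun s => Θ (s, w s)) Set.univ :=
          (hΘ.of_le (by exact_mod_cast le_top)).comp (contDiff_id.prodMk ih).contDiffOn
            fun s _ => hmem s
        exact contDiffOn_univ.1 h2
      have hd' : deriv w' = fun s => Θ (s, w s) := funext fun s => (hw' s).deriv
      have h3 : ContDiff ℝ (n + 1) w' := contDiff_succ_iff_deriv.2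
        ⟨fun s => (hw' s).differentiableAt, by simp, by rwa [hd']⟩
      have hd : deriv w = w' := funext fun s => (hw s).deriv
      have h4 : ContDiff ℝ (n + 1) w := contDiff_succ_iff_deriv.2
        ⟨fun s => (hw s).differentiableAt, by simp, by rw [hd]; exact h3.of_le (by simp)⟩
      exact_mod_cast h4
  exact contDiff_infty.2 key

/-! ### Pointwise operators and the L² pairing -/

/-- The coordinatewise multiplication by constants. -/
def diag {N : ℕ} : (Fin N → ℝ) →ₗ[ℝ] (Config N →L[ℝ] Config N) where
  toFun c := LinearMap.toContinuousLinearMap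
    { toFun := fun x => WithLp.toLp 2 fun i => c i * x i
      map_add' := fun x y => by ext i; simp [mul_add]
      map_smul' := fun a x => by ext i; simp; ring }
  map_add' c d := by ext x i; simp [add_mul]
  map_smul' a c := by ext x i; simp [mul_assoc]

@[simp] theorem diag_apply (c : Fin N → ℝ) (x : Config N) (i : Fin N) : diag c x i = c i * x i := rfl

theorem inner_diag (c : Fin N → ℝ) (x y : Config N) :
    inner ℝ (diag c x) y = inner ℝ x (diag c y) := by
  simp only [PiLp.inner_apply, diag_apply, RCLike.inner_apply, conj_trivial]
  exact Finset.sum_congr rfl fun i _ => by ring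

/-- Pointwise application of a continuous linear map. -/
def post (A : Config N →L[ℝ] Config N) : PerFun N →L[ℝ] PerFun N :=
  A.compLeftContinuous ℝ (AddCircle (1 : ℝ))

@[simp] theorem post_apply (A : Config N →L[ℝ] Config N) (u : PerFun N) (x : AddCircle (1 : ℝ)) :
    post A u x = A (u x) := rfl

theorem norm_post_le (A : Config N →L[ℝ] Config N) (u : PerFun N) : ‖post A u‖ ≤ ‖A‖ * ‖u‖ :=
  norm_le_of_real (by positivity) fun s => (A.le_opNorm _).trans
    (mul_le_mul_of_nonneg_left (u.norm_coe_le _) (norm_nonneg _))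

/-- Pointwise application of a continuous periodic family of continuous linear maps. -/
def mulOp (V : C(AddCircle (1 : ℝ), Config N →L[ℝ] Config N)) : PerFun N →L[ℝ] PerFun N :=
  LinearMap.mkContinuous
    { toFun := fun u => ⟨fun x => V x (u x), V.continuous.clm_apply u.continuous⟩
      map_add' := fun u v => by ext1 x; simp
      map_smul' := fun c u => by ext1 x; simp } ‖V‖ fun u =>
    norm_le_of_real (by positivity) fun s => ((V _).le_opNorm _).trans
      (mul_le_mul (V.norm_coe_le_norm _) (u.norm_coe_le _) (norm_nonneg _) (norm_nonneg V))

@[simp] theorem mulOp_apply (V : C(AddCircle (1 : ℝ), Config N →L[ℝ] Config N)) (u : PerFun N)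
    (x : AddCircle (1 : ℝ)) : mulOp V u x = V x (u x) := rfl

/-- The `L²` inner product. -/
def ip (N : ℕ) : PerFun N →L[ℝ] PerFun N →L[ℝ] ℝ :=
  LinearMap.mkContinuous₂
    (LinearMap.mk₂ ℝ (fun u v : PerFun N =>
        ∫ s in (0 : ℝ)..1, inner ℝ (u (s : AddCircle (1 : ℝ))) (v (s : AddCircle (1 : ℝ))))
      (fun u u' v => by
        simp only [ContinuousMap.add_apply, inner_add_left]
        exact intervalIntegral.integral_add
          ((u.continuous_real.inner v.continuous_real).intervalIntegrable _ _)
          ((u'.continuous_real.inner v.continuous_real).intervalIntegrable _ _))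
      (fun c u v => by
        simp only [ContinuousMap.smul_apply, real_inner_smul_left]
        exact intervalIntegral.integral_const_mul _ _)
      (fun u v v' => by
        simp only [ContinuousMap.add_apply, inner_add_right]
        exact intervalIntegral.integral_add
          ((u.continuous_real.inner v.continuous_real).intervalIntegrable _ _)
          ((u.continuous_real.inner v'.continuous_real).intervalIntegrable _ _))
      (fun c u v => by
        simp only [ContinuousMap.smul_apply, real_inner_smul_right]
        exact intervalIntegral.integral_const_mul _ _)) 1 fun u v => by
    have := intervalIntegral.norm_integral_le_of_norm_le_const (a := (0 : ℝ)) (b := 1)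
      (f := fun s : ℝ => inner ℝ (u (s : AddCircle (1 : ℝ))) (v (s : AddCircle (1 : ℝ))))
      (C := ‖u‖ * ‖v‖) (fun s _ => (norm_inner_le_norm _ _).trans
        (mul_le_mul (u.norm_coe_le _) (v.norm_coe_le _) (norm_nonneg _) (norm_nonneg _)))
    simpa using this

theorem ip_apply (u v : PerFun N) : ip N u v =
    ∫ s in (0 : ℝ)..1, inner ℝ (u (s : AddCircle (1 : ℝ))) (v (s : AddCircle (1 : ℝ))) := rfl

theorem abs_ip_le (u v : PerFun N) : |ip N u v| ≤ ‖u‖ * ‖v‖ := by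
  have := intervalIntegral.norm_integral_le_of_norm_le_const (a := (0 : ℝ)) (b := 1)
    (f := fun s : ℝ => inner ℝ (u (s : AddCircle (1 : ℝ))) (v (s : AddCircle (1 : ℝ))))
    (C := ‖u‖ * ‖v‖) (fun s _ => (norm_inner_le_norm _ _).trans
      (mul_le_mul (u.norm_coe_le _) (v.norm_coe_le _) (norm_nonneg _) (norm_nonneg _)))
  simpa [ip_apply] using this

theorem ip_comm (u v : PerFun N) : ip N u v = ip N v u := by
  simp only [ip_apply, real_inner_comm]

theorem ip_self_nonneg (u : PerFun N) : 0 ≤ ip N u u :=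
  intervalIntegral.integral_nonneg zero_le_one fun _ _ => real_inner_self_nonneg

theorem eq_zero_of_ip_self {u : PerFun N} (h : ip N u u = 0) : u = 0 := by
  by_contra hu
  obtain ⟨s, hs⟩ : ∃ s ∈ Set.Icc (0 : ℝ) 1, u (s : AddCircle (1 : ℝ)) ≠ 0 := by
    by_contra! hcon
    refine hu (ContinuousMap.ext fun x => ?_)
    obtain ⟨s, hs, rfl⟩ := exists_coe_eq x
    exact hcon s hs
  have := intervalIntegral.integral_pos (a := (0 : ℝ)) (b := 1) zero_lt_one
    (f := fun s : ℝ => inner ℝ (u (s : AddCircle (1 : ℝ))) (u (s : AddCircle (1 : ℝ))))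
    (u.continuous_real.inner u.continuous_real).continuousOn (fun _ _ => real_inner_self_nonneg)
    ⟨s, hs.1, real_inner_self_pos.2 hs.2⟩
  rw [ip_apply] at h
  exact this.ne' h

theorem ip_post_diag (c : Fin N → ℝ) (u v : PerFun N) :
    ip N (post (diag c) u) v = ip N u (post (diag c) v) := by
  simp only [ip_apply, post_apply, inner_diag]

theorem IsDeriv.ip_eq {u u' v v' : PerFun N} (h : IsDeriv u u') (h' : IsDeriv v v') :
    ip N u' v = - ip N u v' := by
  have h1 := intervalIntegral.integral_eq_sub_of_hasDerivAt (a := (0 : ℝ)) (b := 1)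
    (fun s _ => (h s).inner ℝ (h' s))
    (((u.continuous_real.inner v'.continuous_real).add
      (u'.continuous_real.inner v.continuous_real)).intervalIntegrable _ _)
  rw [intervalIntegral.integral_add ((u.continuous_real.inner v'.continuous_real).intervalIntegrable _ _)
      ((u'.continuous_real.inner v.continuous_real).intervalIntegrable _ _)] at h1
  have e1 : u ((1 : ℝ) : AddCircle (1 : ℝ)) = u ((0 : ℝ) : AddCircle (1 : ℝ)) := by
    simpa using u.periodic_real 0
  have e2 : v ((1 : ℝ) : AddCircle (1 : ℝ)) = v ((0 : ℝ) : AddCircle (1 : ℝ)) := by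
    simpa using v.periodic_real 0
  rw [e1, e2, sub_self] at h1
  rw [ip_apply, ip_apply]
  linarith

end PerFun

/-! ### Approximations uniform in time along periodic curves -/

section Uniform

/-- Compactness makes the modulus of continuity uniform over K even though the second point a may
lie outside K; membership a ∈ O is part of the conclusion. -/
theorem exists_forall_dist_lt_of_isCompact {A B : Type*} [PseudoMetricSpace A] [PseudoMetricSpace B]
    {f : A → B} {O K : Set A} (hO : IsOpen O) (hf : ContinuousOn f O) (hK : IsCompact K)
    (hKO : K ⊆ O) {ε : ℝ} (hε : 0 < ε) :
    ∃ δ > 0, ∀ x ∈ K, ∀ a, dist a x < δ → a ∈ O ∧ dist (f a) (f x) < ε := by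
  obtain ⟨δ₁, hδ₁, h₁⟩ := hK.exists_thickening_subset_open hO hKO
  have h2 := hK.uniformContinuousAt_of_continuousAt f
    (fun a ha => hf.continuousAt (hO.mem_nhds (hKO ha))) (Metric.dist_mem_uniformity hε)
  obtain ⟨δ₂, hδ₂, h₂⟩ := Metric.mem_uniformity_dist.1 h2
  refine ⟨min δ₁ δ₂, lt_min hδ₁ hδ₂, fun x hx a hax => ⟨h₁ ?_, ?_⟩⟩
  · exact Metric.mem_thickening_iff.2 ⟨x, hx, hax.trans_le (min_le_left _ _)⟩
  · rw [dist_comm]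
    exact h₂ (by rw [dist_comm]; exact hax.trans_le (min_le_right _ _)) hx

/-- Periodicity reduces all times to one compact period. The point a is close to the curve at the
moving parameter ξ, while the values are compared with those at ξ₁, so the variation of the curve
with ξ is absorbed as well. -/
theorem exists_forall_dist_lt_of_periodic {A B : Type*} [PseudoMetricSpace A] [PseudoMetricSpace B]
    {J : Set ℝ} (hJ : IsOpen J) {ξ₁ : ℝ} (hξ₁ : ξ₁ ∈ J) {c : ℝ → ℝ → A}
    (hc : ContinuousOn (fun p : ℝ × ℝ => c p.1 p.2) (J ×ˢ Set.univ))
    (hper : ∀ ξ ∈ J, Function.Periodic (c ξ) 1) {f : A → B} {O : Set A} (hO : IsOpen O)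
    (hf : ContinuousOn f O) (hmem : ∀ s, c ξ₁ s ∈ O) {ε : ℝ} (hε : 0 < ε) :
    ∃ δ > 0, ∀ ξ, |ξ - ξ₁| < δ → ξ ∈ J ∧
      ∀ s a, dist a (c ξ s) < δ → a ∈ O ∧ dist (f a) (f (c ξ₁ s)) < ε := by
  have hK1 : IsCompact (({ξ₁} : Set ℝ) ×ˢ Set.Icc (0 : ℝ) 1) := isCompact_singleton.prod isCompact_Icc
  have hK1J : ({ξ₁} : Set ℝ) ×ˢ Set.Icc (0 : ℝ) 1 ⊆ J ×ˢ Set.univ :=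
    Set.prod_mono (Set.singleton_subset_iff.2 hξ₁) (Set.subset_univ _)
  have hK2 : IsCompact ((fun p : ℝ × ℝ => c p.1 p.2) '' (({ξ₁} : Set ℝ) ×ˢ Set.Icc (0 : ℝ) 1)) :=
    hK1.image_of_continuousOn (hc.mono hK1J)
  obtain ⟨δ₁, hδ₁, h₁⟩ := exists_forall_dist_lt_of_isCompact hO hf hK2
    (by rintro _ ⟨⟨ξ, s⟩, ⟨rfl, -⟩, rfl⟩; exact hmem s) hε
  obtain ⟨δ₂, hδ₂, h₂⟩ := exists_forall_dist_lt_of_isCompact (hJ.prod isOpen_univ) hc hK1 hK1J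
    (half_pos hδ₁)
  refine ⟨min (δ₁ / 2) δ₂, by positivity, fun ξ hξ => ?_⟩
  have hd : ∀ s : ℝ, dist (ξ, s) (ξ₁, s) < δ₂ := fun s => by
    rw [Prod.dist_eq, dist_self, max_eq_left dist_nonneg, Real.dist_eq]
    exact hξ.trans_le (min_le_right _ _)
  have hξJ : ξ ∈ J := (h₂ (ξ₁, 0) ⟨rfl, by simp⟩ (ξ, 0) (hd 0)).1.1
  refine ⟨hξJ, fun s a ha => ?_⟩
  obtain ⟨t, ht, hst⟩ := Function.Periodic.exists_mem_Ico₀ (f := fun s => (c ξ s, c ξ₁ s)) (c := (1 : ℝ))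
    (fun s => by simp [hper ξ hξJ s, hper ξ₁ hξ₁ s]) one_pos s
  simp only [Prod.mk.injEq] at hst
  rw [hst.1] at ha
  rw [hst.2]
  have ht' : t ∈ Set.Icc (0 : ℝ) 1 := Set.Ico_subset_Icc_self ht
  refine h₁ _ ⟨(ξ₁, t), ⟨rfl, ht'⟩, rfl⟩ a ?_
  calc dist a (c ξ₁ t) ≤ dist a (c ξ t) + dist (c ξ t) (c ξ₁ t) := dist_triangle _ _ _
    _ < δ₁ / 2 + δ₁ / 2 := add_lt_add (ha.trans_le (min_le_left _ _))
        (h₂ (ξ₁, t) ⟨rfl, ht'⟩ (ξ, t) (hd t)).2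
    _ = δ₁ := add_halves _

variable {A E F : Type*} [NormedAddCommGroup A] [NormedSpace ℝ A] [NormedAddCommGroup E]
  [NormedSpace ℝ E] [NormedAddCommGroup F] [NormedSpace ℝ F]

theorem hasFDerivAt_of_contDiffOn_prod {f : A → E → F} {O : Set (A × E)} (hO : IsOpen O)
    (hf : ContDiffOn ℝ ∞ (fun p : A × E => f p.1 p.2) O) {p : A × E} (hp : p ∈ O) :
    HasFDerivAt (f p.1) ((fderiv ℝ (fun p : A × E => f p.1 p.2) p).comp
      (ContinuousLinearMap.inr ℝ A E)) p.2 := by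
  have h1 : HasFDerivAt (fun p : A × E => f p.1 p.2) (fderiv ℝ (fun p : A × E => f p.1 p.2) p)
      (p.1, p.2) :=
    ((hf.contDiffAt (hO.mem_nhds hp)).differentiableAt (by simp)).hasFDerivAt
  exact h1.comp p.2 (hasFDerivAt_prodMk_right p.1 p.2)

theorem contDiffOn_fderiv_right {f : A → E → F} {O : Set (A × E)} (hO : IsOpen O)
    (hf : ContDiffOn ℝ ∞ (fun p : A × E => f p.1 p.2) O) :
    ContDiffOn ℝ ∞ (fun p : A × E => fderiv ℝ (f p.1) p.2) O := by
  have h1 : ContDiffOn ℝ ∞ (fderiv ℝ (fun p : A × E => f p.1 p.2)) O :=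
    hf.fderiv_of_isOpen hO (by simp)
  refine (h1.clm_comp (contDiffOn_const (c := ContinuousLinearMap.inr ℝ A E))).congr fun p hp => ?_
  exact (hasFDerivAt_of_contDiffOn_prod hO hf hp).fderiv

variable {J : Set ℝ} {Ω : Set E} {f : ℝ → E → F} {q : ℝ → ℝ → E}

theorem hasFDerivAt_of_contDiffOn_prod' (hJ : IsOpen J) (hΩ : IsOpen Ω)
    (hf : ContDiffOn ℝ ∞ (fun p : ℝ × E => f p.1 p.2) (J ×ˢ Ω)) {ξ : ℝ} (hξ : ξ ∈ J) {x : E}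
    (hx : x ∈ Ω) : HasFDerivAt (f ξ) (fderiv ℝ (f ξ) x) x :=
  (hasFDerivAt_of_contDiffOn_prod (hJ.prod hΩ) hf (p := (ξ, x)) ⟨hξ, hx⟩).differentiableAt.hasFDerivAt

/-- Along a family of periodic curves, a smooth family of maps is uniformly approximated by its
linearization. -/
theorem exists_forall_linear_approx (hJ : IsOpen J) (hΩ : IsOpen Ω) {ξ₁ : ℝ} (hξ₁ : ξ₁ ∈ J)
    (hf : ContDiffOn ℝ ∞ (fun p : ℝ × E => f p.1 p.2) (J ×ˢ Ω))
    (hq : ContinuousOn (fun p : ℝ × ℝ => q p.1 p.2) (J ×ˢ Set.univ))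
    (hper : ∀ ξ ∈ J, Function.Periodic (q ξ) 1) (hmem : ∀ s, q ξ₁ s ∈ Ω) {ε : ℝ} (hε : 0 < ε) :
    ∃ δ > 0, ∀ ξ, |ξ - ξ₁| < δ → ξ ∈ J ∧ ∀ s y y', ‖y‖ < δ → ‖y'‖ < δ → q ξ s + y ∈ Ω ∧
      ‖f ξ (q ξ s + y) - f ξ (q ξ s + y') - fderiv ℝ (f ξ₁) (q ξ₁ s) (y - y')‖ ≤ ε * ‖y - y'‖ := by
  obtain ⟨δ, hδ, h⟩ := exists_forall_dist_lt_of_periodic hJ hξ₁ (c := fun ξ s => (ξ, q ξ s))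
    (f := fun p : ℝ × E => fderiv ℝ (f p.1) p.2) (O := J ×ˢ Ω)
    (continuousOn_fst.prodMk hq) (fun ξ hξ s => by simp [hper ξ hξ s]) (hJ.prod hΩ)
    (contDiffOn_fderiv_right (hJ.prod hΩ) hf).continuousOn (fun s => ⟨hξ₁, hmem s⟩) hε
  refine ⟨δ, hδ, fun ξ hξ => ⟨(h ξ hξ).1, fun s => ?_⟩⟩
  have hball : ∀ y : E, ‖y‖ < δ → q ξ s + y ∈ Ω ∧
      ‖fderiv ℝ (f ξ) (q ξ s + y) - fderiv ℝ (f ξ₁) (q ξ₁ s)‖ ≤ ε := fun y hy => by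
    have := (h ξ hξ).2 s (ξ, q ξ s + y) (by simpa [Prod.dist_eq, dist_eq_norm] using hy)
    refine ⟨this.1.2, ?_⟩
    rw [← dist_eq_norm]
    exact this.2.le
  intro y y' hy hy'
  refine ⟨(hball y hy).1, ?_⟩
  -- Mean value inequality on the ball around the moving point, where the derivative stays within ε
  -- of the fixed one.
  have hmv := (convex_ball (q ξ s) δ).norm_image_sub_le_of_norm_hasFDerivWithin_le'
    (f := f ξ) (f' := fun x => fderiv ℝ (f ξ) x) (φ := fderiv ℝ (f ξ₁) (q ξ₁ s)) (C := ε)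
    (x := q ξ s + y') (y := q ξ s + y) (fun x hx => ?_) (fun x hx => ?_) (by simpa using hy')
    (by simpa using hy)
  · simpa using hmv
  · have hx' := hball (x - q ξ s) (by simpa [dist_eq_norm] using hx)
    rw [add_sub_cancel] at hx'
    exact (hasFDerivAt_of_contDiffOn_prod' hJ hΩ hf (h ξ hξ).1 hx'.1).hasFDerivWithinAt
  · have hx' := hball (x - q ξ s) (by simpa [dist_eq_norm] using hx)
    rw [add_sub_cancel] at hx'
    exact hx'.2

theorem exists_forall_norm_le_of_periodic {F : Type*} [NormedAddCommGroup F] {g : ℝ → F} (hg : Continuous g)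
    (hp : Function.Periodic g 1) : ∃ C, 0 ≤ C ∧ ∀ s, ‖g s‖ ≤ C := by
  obtain ⟨C, hC⟩ := isCompact_Icc.exists_bound_of_continuousOn (s := Set.Icc (0 : ℝ) 1) hg.continuousOn
  refine ⟨C, (norm_nonneg _).trans (hC 0 (by simp)), fun s => ?_⟩
  obtain ⟨t, ht, hst⟩ := hp.exists_mem_Ico₀ one_pos s
  rw [hst]
  exact hC t (Set.Ico_subset_Icc_self ht)

theorem continuous_comp_curve {E G : Type*} [TopologicalSpace E] [TopologicalSpace G]
    {J : Set ℝ} {Ω : Set E} {g : ℝ × E → G}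
    (hg : ContinuousOn g (J ×ˢ Ω)) {ξ₁ : ℝ} (hξ₁ : ξ₁ ∈ J) {c : ℝ → E} (hc : Continuous c)
    (hmem : ∀ s, c s ∈ Ω) : Continuous fun s => g (ξ₁, c s) := by
  refine continuousOn_univ.1 (hg.comp (t := J ×ˢ Ω) (by fun_prop) fun s _ => ⟨hξ₁, hmem s⟩)

/-- The second derivative is bounded along the curve by compactness, so the first derivative varies
by at most a multiple of the distance, and the mean value inequality gains one more power. This is
the source of the O(r²) bound on w in (b). -/
theorem exists_forall_quadratic_approx (hJ : IsOpen J) (hΩ : IsOpen Ω) {ξ₁ : ℝ} (hξ₁ : ξ₁ ∈ J)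
    (hf : ContDiffOn ℝ ∞ (fun p : ℝ × E => f p.1 p.2) (J ×ˢ Ω)) {c : ℝ → E} (hc : Continuous c)
    (hper : Function.Periodic c 1) (hmem : ∀ s, c s ∈ Ω) :
    ∃ C, 0 ≤ C ∧ ∃ δ > 0, ∀ s y, ‖y‖ < δ →
      ‖f ξ₁ (c s + y) - f ξ₁ (c s) - fderiv ℝ (f ξ₁) (c s) y‖ ≤ C * ‖y‖ ^ 2 := by
  have hf1 := contDiffOn_fderiv_right (hJ.prod hΩ) hf
  have hf2 := contDiffOn_fderiv_right (f := fun ξ x => fderiv ℝ (f ξ) x) (hJ.prod hΩ) hf1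
  obtain ⟨δ, hδ, h⟩ := exists_forall_linear_approx (f := fun ξ x => fderiv ℝ (f ξ) x)
    (q := fun _ => c) hJ hΩ hξ₁ hf1 (hc.comp_continuousOn continuousOn_snd) (fun _ _ => hper) hmem
    one_pos
  obtain ⟨C, hC0, hC⟩ := exists_forall_norm_le_of_periodic
    (continuous_comp_curve hf2.continuousOn hξ₁ hc hmem) (fun s => by simp [hper s])
  have h0 := (h ξ₁ (by simpa using hδ)).2
  refine ⟨1 + C, by positivity, δ, hδ, fun s y hy => ?_⟩
  have hball : ∀ z : E, ‖z‖ ≤ ‖y‖ → c s + z ∈ Ω ∧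
      ‖fderiv ℝ (f ξ₁) (c s + z) - fderiv ℝ (f ξ₁) (c s)‖ ≤ (1 + C) * ‖y‖ := fun z hz => by
    obtain ⟨h1, h2⟩ := h0 s z 0 (hz.trans_lt hy) (by simpa using hδ)
    refine ⟨h1, ?_⟩
    rw [add_zero, sub_zero, one_mul] at h2
    have h3 := (fderiv ℝ (fun x => fderiv ℝ (f ξ₁) x) (c s)).le_opNorm z
    have h4 : ‖fderiv ℝ (fun x => fderiv ℝ (f ξ₁) x) (c s)‖ ≤ C := hC s
    have h5 := norm_le_insert' (fderiv ℝ (f ξ₁) (c s + z) - fderiv ℝ (f ξ₁) (c s))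
      (fderiv ℝ (fun x => fderiv ℝ (f ξ₁) x) (c s) z)
    nlinarith [norm_nonneg z, norm_nonneg y]
  have hmv := (convex_closedBall (c s) ‖y‖).norm_image_sub_le_of_norm_hasFDerivWithin_le'
    (f := f ξ₁) (f' := fun x => fderiv ℝ (f ξ₁) x) (φ := fderiv ℝ (f ξ₁) (c s)) (C := (1 + C) * ‖y‖)
    (x := c s) (y := c s + y) (fun x hx => ?_) (fun x hx => ?_) (by simp)
    (by simp)
  · rw [add_sub_cancel_left] at hmv
    refine hmv.trans_eq (by ring)
  · have hx' := hball (x - c s) (by simpa [dist_eq_norm] using hx)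
    rw [add_sub_cancel] at hx'
    exact (hasFDerivAt_of_contDiffOn_prod' hJ hΩ hf hξ₁ hx'.1).hasFDerivWithinAt
  · have hx' := hball (x - c s) (by simpa [dist_eq_norm] using hx)
    rw [add_sub_cancel] at hx'
    exact hx'.2

end Uniform

/-! ### Smooth loops inside the space of continuous ones -/

namespace Loop

open PerFun

variable {N : ℕ}

/-- A smooth periodic function as a continuous periodic function. -/
def toX : Loop N →ₗ[ℝ] PerFun N where
  toFun q := mk' q.1 q.2.1.continuous q.2.2
  map_add' _ _ := ext_real fun _ => rfl
  map_smul' _ _ := ext_real fun _ => rfl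

@[simp] theorem toX_apply (q : Loop N) (s : ℝ) : toX q (s : AddCircle (1 : ℝ)) = q.1 s := rfl

theorem toX_injective : Function.Injective (toX (N := N)) := fun q q' h =>
  Subtype.ext (funext fun s => by rw [← toX_apply, h, toX_apply])

theorem differentiable (q : Loop N) : Differentiable ℝ q.1 := q.2.1.differentiable (by simp)

theorem periodic_deriv {f : ℝ → Config N} (h : Function.Periodic f 1) :
    Function.Periodic (deriv f) 1 := fun s => by
  rw [← deriv_comp_add_const, show (fun x => f (x + 1)) = f from funext h]

/-- The time derivative. -/
def dL : Loop N →ₗ[ℝ] Loop N where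
  toFun q := ⟨deriv q.1, (contDiff_infty_iff_deriv.1 q.2.1).2, periodic_deriv q.2.2⟩
  map_add' p q := Subtype.ext <| funext fun s =>
    deriv_add (p.differentiable s) (q.differentiable s)
  map_smul' c q := Subtype.ext <| funext fun s => deriv_const_smul c (q.differentiable s)

theorem dL_val (q : Loop N) : (dL q).1 = deriv q.1 := rfl

theorem hasDerivAt (q : Loop N) (s : ℝ) : HasDerivAt q.1 ((dL q).1 s) s :=
  (q.differentiable s).hasDerivAt

theorem isDeriv_toX (q : Loop N) : IsDeriv (toX q) (toX (dL q)) := fun s => q.hasDerivAt s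

theorem iteratedDeriv_two (q : Loop N) : iteratedDeriv 2 q.1 = (dL (dL q)).1 := by
  rw [iteratedDeriv_succ, iteratedDeriv_one, dL_val, dL_val]

theorem c1Le_iff {q : Loop N} {b : ℝ} (hb : 0 ≤ b) :
    C1Le q b ↔ ‖toX q‖ ≤ b ∧ ‖toX (dL q)‖ ≤ b :=
  ⟨fun h => ⟨norm_le_of_real hb fun s => (h s).1, norm_le_of_real hb fun s => (h s).2⟩,
    fun h s => ⟨((toX q).norm_coe_le s).trans h.1, ((toX (dL q)).norm_coe_le s).trans h.2⟩⟩

theorem loopInner_eq (u v : Loop N) : loopInner u.1 v.1 = ip N (toX u) (toX v) := rfl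

end Loop

namespace PerFun

variable {N : ℕ}

/-- A derivative of a periodic function has mean zero, so v is `prim N z` minus its mean; the factor
4 is twice the bound 2 for `prim`. It turns sup bounds on second derivatives into bounds on first
derivatives. -/
theorem IsDeriv.norm_le {u v z : PerFun N} (h : IsDeriv u v) (h' : IsDeriv v z) :
    ‖v‖ ≤ 4 * ‖z‖ := by
  have h1 : v = prim N z - constL N (mean N (prim N z)) := by
    have h2 := h'.prim_eq
    have h3 : mean N (prim N z) = - v ((0 : ℝ) : AddCircle (1 : ℝ)) := by
      rw [h2, map_sub, h.mean_eq_zero, zero_sub]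
      simp [mean_apply]
    rw [h3, h2, map_neg]
    abel
  have h4 : ‖prim N z‖ ≤ 2 * ‖z‖ := norm_le_of_real (by positivity) fun s => by
    obtain ⟨t, ht, hts⟩ := exists_coe_eq (s : AddCircle (1 : ℝ))
    rw [← hts]
    exact norm_primFun_le z t ht
  have h5 : ‖constL N (mean N (prim N z))‖ ≤ ‖prim N z‖ :=
    norm_le_of_real (norm_nonneg _) fun s => norm_mean_le _
  rw [h1]
  exact (norm_sub_le _ _).trans (by linarith)

/-- The one-dimensional Sobolev inequality. -/
theorem IsDeriv.norm_sq_le {u v : PerFun N} (h : IsDeriv u v) :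
    ‖u‖ ^ 2 ≤ 2 * ip N u u + ip N v v := by
  have hB : 0 ≤ ip N u u + ip N v v := add_nonneg (ip_self_nonneg u) (ip_self_nonneg v)
  set f : ℝ → ℝ := fun s => inner ℝ (u (s : AddCircle (1 : ℝ))) (u (s : AddCircle (1 : ℝ))) with hf
  have hfc : Continuous f := u.continuous_real.inner u.continuous_real
  have hgc : Continuous fun s : ℝ => inner ℝ (v (s : AddCircle (1 : ℝ))) (v (s : AddCircle (1 : ℝ))) :=
    v.continuous_real.inner v.continuous_real
  have hder : ∀ s : ℝ, HasDerivAt f (2 * inner ℝ (u (s : AddCircle (1 : ℝ))) (v (s : AddCircle (1 : ℝ)))) s :=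
    fun s => ((h s).inner ℝ (h s)).congr_deriv (by rw [real_inner_comm (u (s : AddCircle (1 : ℝ)))]; ring)
  have hdc : Continuous fun s : ℝ => 2 * inner ℝ (u (s : AddCircle (1 : ℝ))) (v (s : AddCircle (1 : ℝ))) :=
    continuous_const.mul (u.continuous_real.inner v.continuous_real)
  -- The increment of |u|² is the integral of 2⟨u, v⟩, which |u|² + |v|² dominates.
  have key : ∀ s ∈ Set.Icc (0 : ℝ) 1, ∀ t ∈ Set.Icc (0 : ℝ) 1, f s ≤ f t + (ip N u u + ip N v v) := by
    intro s hs t ht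
    have h1 := intervalIntegral.integral_eq_sub_of_hasDerivAt (fun x _ => hder x)
      (hdc.intervalIntegrable t s)
    have h2 : |∫ x in t..s, 2 * inner ℝ (u (x : AddCircle (1 : ℝ))) (v (x : AddCircle (1 : ℝ)))| ≤
        ∫ x in (0 : ℝ)..1, (f x + inner ℝ (v (x : AddCircle (1 : ℝ))) (v (x : AddCircle (1 : ℝ)))) := by
      have hpos : ∀ x : ℝ, 0 ≤ f x + inner ℝ (v (x : AddCircle (1 : ℝ))) (v (x : AddCircle (1 : ℝ))) :=
        fun x => add_nonneg (real_inner_self_nonneg (x := u (x : AddCircle (1 : ℝ))))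
          (real_inner_self_nonneg (x := v (x : AddCircle (1 : ℝ))))
      have hint : ∀ a b, IntervalIntegrable (fun x : ℝ => f x + inner ℝ (v (x : AddCircle (1 : ℝ)))
        (v (x : AddCircle (1 : ℝ)))) MeasureTheory.volume a b := fun a b => (hfc.add hgc).intervalIntegrable (μ := MeasureTheory.volume) a b
      rw [← Real.norm_eq_abs]
      refine (intervalIntegral.norm_integral_le_abs_of_norm_le (Eventually.of_forall fun x => ?_)
        (hint t s)).trans ((intervalIntegral.abs_integral_mono_interval ?_
          (Eventually.of_forall hpos) (hint 0 1)).trans_eq ?_)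
      · rw [Real.norm_eq_abs, abs_mul, abs_two, hf]
        simp only []
        rw [real_inner_self_eq_norm_sq,
          real_inner_self_eq_norm_sq]
        have h3 := abs_real_inner_le_norm (u (x : AddCircle (1 : ℝ))) (v (x : AddCircle (1 : ℝ)))
        nlinarith [sq_nonneg (‖u (x : AddCircle (1 : ℝ))‖ - ‖v (x : AddCircle (1 : ℝ))‖)]
      · rw [Set.uIoc_of_le zero_le_one]
        exact Set.Ioc_subset_Ioc (le_min ht.1 hs.1) (max_le ht.2 hs.2)
      · exact abs_of_nonneg (intervalIntegral.integral_nonneg zero_le_one fun x _ => hpos x)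
    have h3 : ∫ x in (0 : ℝ)..1, (f x + inner ℝ (v (x : AddCircle (1 : ℝ))) (v (x : AddCircle (1 : ℝ)))) =
        ip N u u + ip N v v :=
      intervalIntegral.integral_add (hfc.intervalIntegrable _ _) (hgc.intervalIntegrable _ _)
    rw [h1, h3] at h2
    linarith [le_abs_self (f s - f t)]
  -- Averaging over t replaces |u(t)|² by its integral.
  have key2 : ∀ s ∈ Set.Icc (0 : ℝ) 1, f s ≤ 2 * ip N u u + ip N v v := by
    intro s hs
    have h1 := intervalIntegral.integral_mono_on zero_le_one
      (continuous_const.intervalIntegrable (μ := MeasureTheory.volume) 0 1)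
      ((show Continuous fun t => f t + (ip N u u + ip N v v) from
        hfc.add continuous_const).intervalIntegrable 0 1) (fun t ht => key s hs t ht)
    rw [intervalIntegral.integral_add (hfc.intervalIntegrable _ _)
      (continuous_const.intervalIntegrable _ _)] at h1
    simp only [intervalIntegral.integral_const, sub_zero, one_smul] at h1
    have h2 : ∫ x in (0 : ℝ)..1, f x = ip N u u := rfl
    rw [h2] at h1
    linarith
  have h6 : ‖u‖ ≤ √(2 * ip N u u + ip N v v) := norm_le_of_real (Real.sqrt_nonneg _) fun s => by
    obtain ⟨t, ht, hts⟩ := exists_coe_eq (s : AddCircle (1 : ℝ))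
    rw [← hts]
    refine Real.le_sqrt_of_sq_le ?_
    rw [← real_inner_self_eq_norm_sq]
    exact key2 t ht
  calc ‖u‖ ^ 2 ≤ √(2 * ip N u u + ip N v v) ^ 2 := by gcongr
    _ = _ := Real.sq_sqrt (by linarith [ip_self_nonneg u])

end PerFun

namespace Loop

open PerFun

variable {N : ℕ}

open Classical in
/-- The smooth periodic function with the given values (`0` if there is none). -/
def ofFun (f : ℝ → Config N) : Loop N := if h : f ∈ loopSpace N then ⟨f, h⟩ else 0

theorem ofFun_val {f : ℝ → Config N} (h : f ∈ loopSpace N) : (ofFun f).1 = f := by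
  rw [ofFun, dif_pos h]

theorem post_toX_mem (A : Config N →L[ℝ] Config N) (q : Loop N) :
    (fun s => A (q.1 s)) ∈ loopSpace N :=
  ⟨A.contDiff.comp q.2.1, fun s => by simp [q.2.2 s]⟩

/-- Pointwise application of a linear map. -/
def postL (A : Config N →L[ℝ] Config N) (q : Loop N) : Loop N := ⟨_, post_toX_mem A q⟩

theorem toX_postL (A : Config N →L[ℝ] Config N) (q : Loop N) :
    toX (postL A q) = post A (toX q) := ext_real fun _ => rfl

theorem dL_postL (A : Config N →L[ℝ] Config N) (q : Loop N) : dL (postL A q) = postL A (dL q) :=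
  Subtype.ext <| funext fun s => (A.hasFDerivAt.comp_hasDerivAt s (q.hasDerivAt s)).deriv

theorem ip_dL (u v : Loop N) : ip N (toX (dL u)) (toX v) = - ip N (toX u) (toX (dL v)) :=
  u.isDeriv_toX.ip_eq v.isDeriv_toX

theorem eq_zero_of_ip {u : Loop N} (h : ∀ v : Loop N, ip N (toX u) (toX v) = 0) : u = 0 :=
  toX_injective (by rw [eq_zero_of_ip_self (h u), map_zero])

theorem ip_toX_post (c : Fin N → ℝ) (u v : Loop N) :
    ip N (post (diag c) (toX (dL (dL u)))) (toX v) =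
      ip N (toX u) (post (diag c) (toX (dL (dL v)))) := by
  rw [ip_post_diag, ← toX_postL, ip_dL, ip_dL, neg_neg, dL_postL, dL_postL, toX_postL]

end Loop

/-- The continuous map on the circle defined by a continuous periodic function. -/
def perMap {F : Type*} [TopologicalSpace F] (f : ℝ → F) (hf : Continuous f)
    (hp : Function.Periodic f 1) : C(AddCircle (1 : ℝ), F) where
  toFun := hp.lift
  continuous_toFun := continuous_coinduced_dom.mpr hf

@[simp] theorem perMap_apply {F : Type*} [TopologicalSpace F] (f : ℝ → F) (hf : Continuous f)
    (hp : Function.Periodic f 1) (s : ℝ) : perMap f hf hp (s : AddCircle (1 : ℝ)) = f s := rfl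

/-! ### The gradient and the Hessian of the action -/

namespace LagrangianFamily

open PerFun Loop

variable {N : ℕ} (L : LagrangianFamily N) {ξ : ℝ} {q : Loop N}

/-- The masses in the normalized time. -/
def massT (ξ : ℝ) (i : Fin N) : ℝ := L.mass ξ i / L.period ξ ^ 2

/-- The mass matrix in the normalized time. -/
def massM (ξ : ℝ) : Config N →L[ℝ] Config N := diag (L.massT ξ)

/-- The inverse of the mass matrix in the normalized time. -/
def massInv (ξ : ℝ) : Config N →L[ℝ] Config N := diag fun i => (L.massT ξ i)⁻¹

theorem massT_pos (hξ : ξ ∈ L.param) (i : Fin N) : 0 < L.massT ξ i :=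
  div_pos (L.mass_pos ξ hξ i) (pow_pos (L.period_pos ξ hξ) 2)

theorem massM_massInv (hξ : ξ ∈ L.param) (x : Config N) : L.massM ξ (L.massInv ξ x) = x := by
  ext i
  have := (L.massT_pos hξ i).ne'
  simp only [massM, massInv, diag_apply]
  field_simp

theorem massInv_massM (hξ : ξ ∈ L.param) (x : Config N) : L.massInv ξ (L.massM ξ x) = x := by
  ext i
  have := (L.massT_pos hξ i).ne'
  simp only [massM, massInv, diag_apply]
  field_simp

theorem continuousOn_massT (i : Fin N) : ContinuousOn (fun ξ => L.massT ξ i) L.param :=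
  (L.contDiffOn_mass i).continuousOn.div ((L.contDiffOn_period.continuousOn).pow 2)
    fun ξ hξ => (pow_pos (L.period_pos ξ hξ) 2).ne'

theorem continuousOn_massM : ContinuousOn L.massM L.param :=
  (LinearMap.continuous_of_finiteDimensional (diag (N := N))).comp_continuousOn
    (continuousOn_pi.2 L.continuousOn_massT)

theorem continuousOn_massInv : ContinuousOn L.massInv L.param :=
  (LinearMap.continuous_of_finiteDimensional (diag (N := N))).comp_continuousOn
    (continuousOn_pi.2 fun i => (L.continuousOn_massT i).inv₀ fun _ hξ => (L.massT_pos hξ i).ne')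

/-- The Riesz isomorphism as a linear map. -/
def rieszMap (N : ℕ) : (Config N →L[ℝ] ℝ) →L[ℝ] Config N where
  toFun := (InnerProductSpace.toDual ℝ (Config N)).symm
  map_add' := map_add _
  map_smul' c x := by simp
  cont := (InnerProductSpace.toDual ℝ (Config N)).symm.continuous

theorem gradient_eq_rieszMap (f : Config N → ℝ) :
    gradient f = fun x => rieszMap N (fderiv ℝ f x) := rfl

theorem inner_gradient (ξ : ℝ) (x v : Config N) :
    inner ℝ (gradient (L.pot ξ) x) v = fderiv ℝ (L.pot ξ) x v :=
  InnerProductSpace.toDual_symm_apply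

theorem contDiffOn_gradient :
    ContDiffOn ℝ ∞ (fun p : ℝ × Config N => gradient (L.pot p.1) p.2) (L.param ×ˢ L.dom) :=
  ContDiffOn.continuousLinearMap_comp (rieszMap N)
    (contDiffOn_fderiv_right (f := L.pot) (L.isOpen_param.prod L.isOpen_dom) L.contDiffOn_pot)

theorem contDiffOn_hess :
    ContDiffOn ℝ ∞ (fun p : ℝ × Config N => fderiv ℝ (gradient (L.pot p.1)) p.2)
      (L.param ×ˢ L.dom) :=
  contDiffOn_fderiv_right (f := fun ξ => gradient (L.pot ξ)) (L.isOpen_param.prod L.isOpen_dom)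
    L.contDiffOn_gradient

/-- Symmetry of second derivatives; with two integrations by parts in the kinetic term it makes the
Hessian operator self-adjoint. -/
theorem inner_hess (hξ : ξ ∈ L.param) {x : Config N} (hx : x ∈ L.dom) (y z : Config N) :
    inner ℝ (fderiv ℝ (gradient (L.pot ξ)) x y) z =
      inner ℝ y (fderiv ℝ (gradient (L.pot ξ)) x z) := by
  have hc : ContDiffAt ℝ ∞ (L.pot ξ) x := by
    have h1 := L.contDiffOn_pot.contDiffAt
      ((L.isOpen_param.prod L.isOpen_dom).mem_nhds (x := (ξ, x)) ⟨hξ, hx⟩)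
    exact h1.comp (f := fun y => (ξ, y)) x (contDiffAt_const.prodMk contDiffAt_id)
  have hs := (contDiffAt_infty.1 hc 2).isSymmSndFDerivAt (by simp)
  have hd : DifferentiableAt ℝ (fderiv ℝ (L.pot ξ)) x :=
    (hc.fderiv_right (m := ∞) (by simp)).differentiableAt (by simp)
  have h2 : ∀ y z, inner ℝ (fderiv ℝ (gradient (L.pot ξ)) x y) z =
      fderiv ℝ (fderiv ℝ (L.pot ξ)) x y z := fun y z => by
    rw [gradient_eq_rieszMap]
    have h3 := ((rieszMap N).hasFDerivAt.comp x hd.hasFDerivAt).fderiv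
    simp only [Function.comp_def] at h3
    rw [h3]
    exact InnerProductSpace.toDual_symm_apply
  rw [h2, real_inner_comm, h2]
  exact hs y z

/-- The second derivatives of the potential along a curve. -/
def potHess (hξ : ξ ∈ L.param) (hq : L.Inside q) :
    C(AddCircle (1 : ℝ), Config N →L[ℝ] Config N) :=
  perMap (fun s => fderiv ℝ (gradient (L.pot ξ)) (q.1 s))
    (continuous_comp_curve L.contDiffOn_hess.continuousOn hξ q.2.1.continuous hq)
    (fun s => by simp [q.2.2 s])

@[simp] theorem potHess_apply (hξ : ξ ∈ L.param) (hq : L.Inside q) (s : ℝ) :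
    L.potHess hξ hq (s : AddCircle (1 : ℝ)) = fderiv ℝ (gradient (L.pot ξ)) (q.1 s) := rfl

theorem ip_mulOp_potHess (hξ : ξ ∈ L.param) (hq : L.Inside q) (u v : PerFun N) :
    ip N (mulOp (L.potHess hξ hq) u) v = ip N u (mulOp (L.potHess hξ hq) v) := by
  simp only [ip_apply, mulOp_apply, potHess_apply]
  congr 1
  exact funext fun s => L.inner_hess hξ (hq s) _ _

/-- The `L²` gradient of the action divided by the period. -/
def elGrad (ξ : ℝ) (q : Loop N) : Loop N :=
  ofFun fun s => - L.massM ξ ((dL (dL q)).1 s) + gradient (L.pot ξ) (q.1 s)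

theorem contDiff_comp_curve {F : Type*} [NormedAddCommGroup F] [NormedSpace ℝ F]
    {g : ℝ × Config N → F} (hg : ContDiffOn ℝ ∞ g (L.param ×ˢ L.dom)) (hξ : ξ ∈ L.param)
    (hq : L.Inside q) : ContDiff ℝ ∞ fun s => g (ξ, q.1 s) :=
  contDiffOn_univ.1 (hg.comp (t := L.param ×ˢ L.dom)
    (contDiff_const.prodMk q.2.1).contDiffOn fun s _ => ⟨hξ, hq s⟩)

theorem elGrad_apply (hξ : ξ ∈ L.param) (hq : L.Inside q) (s : ℝ) : (L.elGrad ξ q).1 s =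
    - L.massM ξ ((dL (dL q)).1 s) + gradient (L.pot ξ) (q.1 s) := by
  rw [elGrad, ofFun_val]
  refine ⟨((postL (L.massM ξ) (dL (dL q))).2.1.neg).add
    (L.contDiff_comp_curve L.contDiffOn_gradient hξ hq), fun s => ?_⟩
  simp [(dL (dL q)).2.2 s, q.2.2 s]

theorem hessian_eq (ξ : ℝ) (q u : Loop N) (s : ℝ) : L.hessian ξ q u s =
    - L.massM ξ ((dL (dL u)).1 s) + fderiv ℝ (gradient (L.pot ξ)) (q.1 s) (u.1 s) := by
  ext i
  simp only [hessian, iteratedDeriv_two, massM, massT, PiLp.add_apply, PiLp.neg_apply, diag_apply]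
  ring

/-- The Hessian operator on smooth periodic functions. -/
def hessLoop (ξ : ℝ) (q u : Loop N) : Loop N := ofFun (L.hessian ξ q u)

theorem hessLoop_apply (hξ : ξ ∈ L.param) (hq : L.Inside q) (u : Loop N) (s : ℝ) :
    (L.hessLoop ξ q u).1 s = L.hessian ξ q u s := by
  rw [hessLoop, ofFun_val]
  have : L.hessian ξ q u = fun s => - L.massM ξ ((dL (dL u)).1 s) +
      fderiv ℝ (gradient (L.pot ξ)) (q.1 s) (u.1 s) := funext fun s => L.hessian_eq ξ q u s
  rw [this]
  refine ⟨((postL (L.massM ξ) (dL (dL u))).2.1.neg).add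
    ((L.contDiff_comp_curve L.contDiffOn_hess hξ hq).clm_apply u.2.1), fun s => ?_⟩
  simp [(dL (dL u)).2.2 s, q.2.2 s, u.2.2 s]

theorem toX_hessLoop (hξ : ξ ∈ L.param) (hq : L.Inside q) (u : Loop N) :
    toX (L.hessLoop ξ q u) =
      - post (L.massM ξ) (toX (dL (dL u))) + mulOp (L.potHess hξ hq) (toX u) :=
  ext_real fun s => by
    rw [toX_apply, L.hessLoop_apply hξ hq, L.hessian_eq]
    rfl

theorem ip_hessLoop (hξ : ξ ∈ L.param) (hq : L.Inside q) (u v : Loop N) :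
    ip N (toX (L.hessLoop ξ q u)) (toX v) = ip N (toX u) (toX (L.hessLoop ξ q v)) := by
  rw [L.toX_hessLoop hξ hq, L.toX_hessLoop hξ hq, map_add, map_add, map_neg, map_neg]
  simp only [add_apply, neg_apply]
  rw [massM, ip_toX_post, ip_mulOp_potHess]

theorem hessLoop_add (hξ : ξ ∈ L.param) (hq : L.Inside q) (u v : Loop N) :
    L.hessLoop ξ q (u + v) = L.hessLoop ξ q u + L.hessLoop ξ q v :=
  toX_injective (by
    simp only [map_add, L.toX_hessLoop hξ hq]
    abel)

theorem hessLoop_smul (hξ : ξ ∈ L.param) (hq : L.Inside q) (c : ℝ) (u : Loop N) :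
    L.hessLoop ξ q (c • u) = c • L.hessLoop ξ q u :=
  toX_injective (by
    simp only [map_smul, L.toX_hessLoop hξ hq]
    module)

/-- The first variation of the action, with a uniform remainder. -/
theorem exists_action_approx (hξ : ξ ∈ L.param) (hq : L.Inside q) {ε : ℝ} (hε : 0 < ε) :
    ∃ δ > 0, ∀ (h : Loop N) (b : ℝ), ‖toX h‖ ≤ b → ‖toX (dL h)‖ ≤ b → b ≤ δ → L.Inside (q + h) ∧
      |L.action ξ (q + h) - L.action ξ q - L.period ξ * ip N (toX (L.elGrad ξ q)) (toX h)| ≤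
        ε * b := by
  have hT := L.period_pos ξ hξ
  set T := L.period ξ with hTdef
  set M := L.massM ξ with hM
  have hact : ∀ p : Loop N, L.Inside p → L.action ξ p =
      T * (1 / 2 * ip N (post M (toX (dL p))) (toX (dL p)) + ∫ s in (0 : ℝ)..1, L.pot ξ (p.1 s)) := by
    intro p hp
    have hc : Continuous fun s => L.pot ξ (p.1 s) :=
      continuous_comp_curve L.contDiffOn_pot.continuousOn hξ p.2.1.continuous hp
    have hc2 : Continuous fun s : ℝ => inner ℝ (post M (toX (dL p)) (s : AddCircle (1 : ℝ)))
        (toX (dL p) (s : AddCircle (1 : ℝ))) :=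
      (continuous_real _).inner (continuous_real _)
    rw [action, intervalIntegral.integral_const_mul, ip_apply]
    congr 1
    rw [← intervalIntegral.integral_const_mul,
      ← intervalIntegral.integral_add ((hc2.intervalIntegrable _ _).const_mul _)
        (hc.intervalIntegrable _ _)]
    congr 1
    funext s
    congr 2
    rw [PiLp.inner_apply]
    refine Finset.sum_congr rfl fun i _ => ?_
    simp only [post_apply, toX_apply, hM, massM, diag_apply, massT, RCLike.inner_apply,
      conj_trivial, dL_val, ← hTdef]
    field_simp
  obtain ⟨δ, hδ, hlin⟩ := exists_forall_linear_approx (f := L.pot) (q := fun _ => q.1)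
    L.isOpen_param L.isOpen_dom hξ L.contDiffOn_pot (q.2.1.continuous.comp_continuousOn continuousOn_snd)
    (fun _ _ => q.2.2) hq (ε := ε / (2 * T)) (by positivity)
  have h0 := (hlin ξ (by simpa using hδ)).2
  -- The first bound keeps h in the range where the potential is nearly linear; the second makes the
  -- kinetic remainder, at most T‖M‖b²/2, no larger than εb/2.
  refine ⟨min (δ / 2) (ε / (T * (‖M‖ + 1))), by positivity, fun h b hb hb' hbδ => ?_⟩
  have hb0 : 0 ≤ b := (norm_nonneg _).trans hb
  have hhs : ∀ s, ‖h.1 s‖ ≤ b := fun s => ((toX h).norm_coe_le s).trans hb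
  have hhδ : ∀ s, ‖h.1 s‖ < δ := fun s => by
    have := hbδ.trans (min_le_left _ _)
    linarith [hhs s]
  have hin : L.Inside (q + h) := fun s => (h0 s (h.1 s) 0 (hhδ s) (by simpa using hδ)).1
  refine ⟨hin, ?_⟩
  have hc1 : Continuous fun s => L.pot ξ (q.1 s) :=
    continuous_comp_curve L.contDiffOn_pot.continuousOn hξ q.2.1.continuous hq
  have hc2 : Continuous fun s => L.pot ξ ((q + h).1 s) :=
    continuous_comp_curve L.contDiffOn_pot.continuousOn hξ (q + h).2.1.continuous hin
  have hcg : Continuous fun s => gradient (L.pot ξ) (q.1 s) :=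
    continuous_comp_curve L.contDiffOn_gradient.continuousOn hξ q.2.1.continuous hq
  have hc3 : Continuous fun s => inner ℝ (gradient (L.pot ξ) (q.1 s)) (h.1 s) :=
    hcg.inner h.2.1.continuous
  set R : ℝ := ∫ s in (0 : ℝ)..1, (L.pot ξ ((q + h).1 s) - L.pot ξ (q.1 s) -
    inner ℝ (gradient (L.pot ξ) (q.1 s)) (h.1 s)) with hR
  have hRle : |R| ≤ ε / (2 * T) * b := by
    have := intervalIntegral.norm_integral_le_of_norm_le_const (a := (0 : ℝ)) (b := 1)
      (f := fun s => L.pot ξ ((q + h).1 s) - L.pot ξ (q.1 s) -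
        inner ℝ (gradient (L.pot ξ) (q.1 s)) (h.1 s)) (C := ε / (2 * T) * b) (fun s _ => by
        have h2 := (h0 s (h.1 s) 0 (hhδ s) (by simpa using hδ)).2
        rw [add_zero, sub_zero] at h2
        rw [inner_gradient]
        exact h2.trans (mul_le_mul_of_nonneg_left (hhs s) (by positivity)))
    rw [sub_zero, abs_one, mul_one] at this
    exact this
  have hRe : R = (∫ s in (0 : ℝ)..1, L.pot ξ ((q + h).1 s)) - (∫ s in (0 : ℝ)..1, L.pot ξ (q.1 s)) -
      ∫ s in (0 : ℝ)..1, inner ℝ (gradient (L.pot ξ) (q.1 s)) (h.1 s) := by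
    rw [hR, intervalIntegral.integral_sub
      ((hc2.intervalIntegrable _ _).sub (hc1.intervalIntegrable _ _)) (hc3.intervalIntegrable _ _), intervalIntegral.integral_sub (hc2.intervalIntegrable _ _)
      (hc1.intervalIntegrable _ _)]
  have hgr : ip N (toX (L.elGrad ξ q)) (toX h) = ip N (post M (toX (dL q))) (toX (dL h)) +
      ∫ s in (0 : ℝ)..1, inner ℝ (gradient (L.pot ξ) (q.1 s)) (h.1 s) := by
    have e1 : ip N (post M (toX (dL q))) (toX (dL h)) =
        ∫ s in (0 : ℝ)..1, inner ℝ (- M ((dL (dL q)).1 s)) (h.1 s) := by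
      have := ip_dL (postL M (dL q)) h
      rw [dL_postL, toX_postL, toX_postL] at this
      rw [← neg_eq_iff_eq_neg.2 this, ip_apply, ← intervalIntegral.integral_neg]
      simp
    rw [e1, ← intervalIntegral.integral_add, ip_apply]
    · congr 1
      funext s
      rw [toX_apply, L.elGrad_apply hξ hq, inner_add_left]
      rfl
    · exact (((postL M (dL (dL q))).2.1.continuous.neg).inner h.2.1.continuous).intervalIntegrable _ _
    · exact hc3.intervalIntegrable _ _
  have hsym : ip N (post M (toX (dL h))) (toX (dL q)) = ip N (post M (toX (dL q))) (toX (dL h)) := by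
    rw [hM, massM, ip_post_diag, ip_comm]
  -- The kinetic energy is quadratic, so this expansion is exact and only the remainder R of the
  -- potential needs an estimate.
  have hexp : L.action ξ (q + h) - L.action ξ q - T * ip N (toX (L.elGrad ξ q)) (toX h) =
      T * (1 / 2 * ip N (post M (toX (dL h))) (toX (dL h)) + R) := by
    rw [hact _ hin, hact _ hq, hgr, hRe]
    simp only [map_add, add_apply, hsym]
    ring
  rw [hexp, abs_mul, abs_of_pos hT]
  have hq1 : |ip N (post M (toX (dL h))) (toX (dL h))| ≤ ‖M‖ * b * b :=
    (abs_ip_le _ _).trans (mul_le_mul ((norm_post_le _ _).trans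
      (mul_le_mul_of_nonneg_left hb' (norm_nonneg _))) hb' (norm_nonneg _) (by positivity))
  have hbε : b * (T * (‖M‖ + 1)) ≤ ε := (le_div_iff₀ (by positivity)).1 (hbδ.trans (min_le_right _ _))
  have h5 : |1 / 2 * ip N (post M (toX (dL h))) (toX (dL h)) + R| ≤
      1 / 2 * (‖M‖ * b * b) + ε / (2 * T) * b := by
    refine (abs_add_le _ _).trans (add_le_add ?_ hRle)
    rw [abs_mul, abs_of_pos (by norm_num : (0 : ℝ) < 1 / 2)]
    linarith
  calc T * _ ≤ T * (1 / 2 * (‖M‖ * b * b) + ε / (2 * T) * b) := mul_le_mul_of_nonneg_left h5 hT.le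
    _ = 1 / 2 * (b * (T * ‖M‖)) * b + ε / 2 * b := by field_simp
    _ ≤ 1 / 2 * ε * b + ε / 2 * b := by
        have : b * (T * ‖M‖) ≤ ε := by nlinarith
        gcongr
    _ = ε * b := by ring

theorem hasDerivAt_action (hξ : ξ ∈ L.param) (hq : L.Inside q) (v : Loop N) :
    HasDerivAt (fun ε : ℝ => L.action ξ (q + ε • v))
      (L.period ξ * ip N (toX (L.elGrad ξ q)) (toX v)) 0 := by
  set B := max ‖toX v‖ ‖toX (dL v)‖ + 1 with hB
  have hB0 : 0 < B := by positivity
  rw [hasDerivAt_iff_isLittleO, isLittleO_iff]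
  intro c hc
  obtain ⟨δ, hδ, h⟩ := L.exists_action_approx hξ hq (ε := c / B) (by positivity)
  filter_upwards [Metric.ball_mem_nhds (0 : ℝ) (show 0 < δ / B by positivity)] with t ht
  rw [mem_ball_zero_iff, Real.norm_eq_abs, lt_div_iff₀ hB0] at ht
  have h1 := (h (t • v) (|t| * B) ?_ ?_ ht.le).2
  · rw [zero_smul, add_zero, sub_zero, smul_eq_mul, Real.norm_eq_abs, Real.norm_eq_abs]
    rw [map_smul, map_smul, smul_eq_mul] at h1
    refine le_of_eq_of_le (congrArg _ (by ring)) (h1.trans_eq (by field_simp))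
  · rw [map_smul, norm_smul, Real.norm_eq_abs]
    exact mul_le_mul_of_nonneg_left (by linarith [le_max_left ‖toX v‖ ‖toX (dL v)‖]) (abs_nonneg _)
  · rw [map_smul, map_smul, norm_smul, Real.norm_eq_abs]
    exact mul_le_mul_of_nonneg_left (by linarith [le_max_right ‖toX v‖ ‖toX (dL v)‖]) (abs_nonneg _)

theorem hasDerivAt_action_zero_iff (hξ : ξ ∈ L.param) (hq : L.Inside q) (v : Loop N) :
    HasDerivAt (fun ε : ℝ => L.action ξ (q + ε • v)) 0 0 ↔
      ip N (toX (L.elGrad ξ q)) (toX v) = 0 := by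
  have h := L.hasDerivAt_action hξ hq v
  constructor
  · intro h0
    simpa [(L.period_pos ξ hξ).ne'] using h.unique h0
  · intro h0
    rwa [h0, mul_zero] at h

theorem isStationary_iff (hξ : ξ ∈ L.param) :
    L.IsStationary ξ q ↔ L.Inside q ∧ L.elGrad ξ q = 0 := by
  constructor
  · rintro ⟨hq, h⟩
    exact ⟨hq, eq_zero_of_ip fun v => (L.hasDerivAt_action_zero_iff hξ hq v).1 (h v)⟩
  · rintro ⟨hq, h⟩
    exact ⟨hq, fun v => (L.hasDerivAt_action_zero_iff hξ hq v).2 (by simp [h])⟩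

end LagrangianFamily

/-! ### Orthonormal bases of finite-dimensional spaces of loops -/

namespace Loop

open PerFun

variable {N : ℕ}

/-- `e` is an orthonormal basis of `S` for the `L²` inner product. -/
structure IsOrthoBasis (S : Submodule ℝ (Loop N)) {n : ℕ} (e : Fin n → Loop N) : Prop where
  mem : ∀ i, e i ∈ S
  ip_eq : ∀ i j, ip N (toX (e i)) (toX (e j)) = if i = j then 1 else 0
  eq_sum : ∀ x ∈ S, x = ∑ i, ip N (toX (e i)) (toX x) • e i

theorem ip_self_pos {u : Loop N} (hu : u ≠ 0) : 0 < ip N (toX u) (toX u) :=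
  lt_of_le_of_ne (ip_self_nonneg _) fun h =>
    hu (toX_injective (by rw [eq_zero_of_ip_self h.symm, map_zero]))

theorem exists_isOrthoBasis (S : Submodule ℝ (Loop N)) [FiniteDimensional ℝ S] :
    ∃ (n : ℕ) (e : Fin n → Loop N), IsOrthoBasis S e := by
  let B : LinearMap.BilinForm ℝ S := LinearMap.mk₂ ℝ (fun u v => ip N (toX u.1) (toX v.1))
    (fun u u' v => by simp) (fun c u v => by simp) (fun u v v' => by simp) (fun c u v => by simp)
  have hB : LinearMap.IsSymm B := ⟨fun u v => ip_comm _ _⟩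
  obtain ⟨v, hv⟩ := LinearMap.BilinForm.exists_orthogonal_basis (V := S) (K := ℝ) (B := B) hB
  have hpos : ∀ i, 0 < ip N (toX (v i).1) (toX (v i).1) := fun i =>
    ip_self_pos fun h => v.ne_zero i (Subtype.ext h)
  set r : Fin (Module.finrank ℝ S) → ℝ := fun i => √(ip N (toX (v i).1) (toX (v i).1)) with hr
  have hr0 : ∀ i, 0 < r i := fun i => Real.sqrt_pos.2 (hpos i)
  have hrr : ∀ i, r i * r i = ip N (toX (v i).1) (toX (v i).1) := fun i =>
    Real.mul_self_sqrt (hpos i).le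
  have horth : ∀ i j, i ≠ j → ip N (toX (v i).1) (toX (v j).1) = 0 := fun i j hij => hv hij
  refine ⟨_, fun i => (r i)⁻¹ • (v i).1, ⟨fun i => S.smul_mem _ (v i).2, fun i j => ?_, fun x hx => ?_⟩⟩
  · simp only [map_smul, smul_apply, smul_eq_mul]
    by_cases hij : i = j
    · subst hij
      rw [if_pos rfl, ← hrr]
      have := (hr0 i).ne'
      field_simp
    · rw [if_neg hij, horth i j hij]; simp
  · have hx' : x = ∑ i, v.repr ⟨x, hx⟩ i • (v i).1 := by
      have := congrArg Subtype.val (v.sum_repr ⟨x, hx⟩)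
      rw [Submodule.coe_sum] at this
      exact this.symm
    have hc : ∀ i, ip N (toX (v i).1) (toX x) = v.repr ⟨x, hx⟩ i * (r i * r i) := fun i => by
      conv_lhs => rw [hx']
      simp only [map_sum, map_smul, smul_eq_mul]
      rw [Finset.sum_eq_single i (fun j _ hj => by rw [horth i j hj.symm, mul_zero]) (by simp), hrr]
    conv_lhs => rw [hx']
    refine Finset.sum_congr rfl fun i _ => ?_
    simp only [map_smul, smul_apply, smul_eq_mul, hc, smul_smul]
    congr 1
    have := (hr0 i).ne'
    field_simp

/-- The `L²` projector on the span of an orthonormal family. -/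
def projX {n : ℕ} (e : Fin n → Loop N) : PerFun N →L[ℝ] PerFun N :=
  ∑ i, (ip N (toX (e i))).smulRight (toX (e i))

theorem projX_apply {n : ℕ} (e : Fin n → Loop N) (u : PerFun N) :
    projX e u = ∑ i, ip N (toX (e i)) u • toX (e i) := by
  simp [projX]

/-- The projector on smooth functions. -/
def projL {n : ℕ} (e : Fin n → Loop N) (u : Loop N) : Loop N :=
  ∑ i, ip N (toX (e i)) (toX u) • e i

theorem toX_projL {n : ℕ} (e : Fin n → Loop N) (u : Loop N) :
    toX (projL e u) = projX e (toX u) := by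
  simp [projX_apply, projL]

theorem ip_projX {n : ℕ} (e : Fin n → Loop N) (u v : PerFun N) :
    ip N (projX e u) v = ip N u (projX e v) := by
  simp only [projX_apply, map_sum, map_smul, sum_apply, smul_apply, smul_eq_mul]
  exact Finset.sum_congr rfl fun i _ => by rw [ip_comm u]; ring

namespace IsOrthoBasis

variable {S : Submodule ℝ (Loop N)} {n : ℕ} {e : Fin n → Loop N}

theorem ip_projX_eq (h : IsOrthoBasis S e) (i : Fin n) (u : PerFun N) :
    ip N (toX (e i)) (projX e u) = ip N (toX (e i)) u := by
  simp [projX_apply, h.ip_eq]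

theorem projL_mem (h : IsOrthoBasis S e) (u : Loop N) : projL e u ∈ S :=
  S.sum_mem fun i _ => S.smul_mem _ (h.mem i)

theorem projL_eq_self (h : IsOrthoBasis S e) {u : Loop N} (hu : u ∈ S) : projL e u = u :=
  (h.eq_sum u hu).symm

theorem projX_projX (h : IsOrthoBasis S e) (u : PerFun N) : projX e (projX e u) = projX e u := by
  conv_lhs => rw [projX_apply]
  simp only [h.ip_projX_eq]
  rw [projX_apply]

theorem projX_toX (h : IsOrthoBasis S e) {u : Loop N} (hu : u ∈ S) : projX e (toX u) = toX u := by
  rw [← toX_projL, h.projL_eq_self hu]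

theorem ip_projX_mem (h : IsOrthoBasis S e) {k : Loop N} (hk : k ∈ S) (u : PerFun N) :
    ip N (projX e u) (toX k) = ip N u (toX k) := by
  rw [ip_projX, h.projX_toX hk]

end IsOrthoBasis

/-- Lets an equation be solved among continuous functions and still yield a smooth loop. -/
theorem exists_toX_eq {u v z : PerFun N} (h : IsDeriv u v) (h' : IsDeriv v z)
    {Θ : ℝ × Config N → Config N} {O : Set (ℝ × Config N)} (hΘ : ContDiffOn ℝ ∞ Θ O)
    (hmem : ∀ s : ℝ, (s, u (s : AddCircle (1 : ℝ))) ∈ O)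
    (hz : ∀ s : ℝ, z (s : AddCircle (1 : ℝ)) = Θ (s, u (s : AddCircle (1 : ℝ)))) :
    ∃ w : Loop N, toX w = u ∧ toX (dL w) = v ∧ toX (dL (dL w)) = z := by
  have hsm : ContDiff ℝ ∞ fun s : ℝ => u (s : AddCircle (1 : ℝ)) :=
    contDiff_of_ode hΘ hmem h fun s => by rw [← hz]; exact h' s
  refine ⟨⟨_, hsm, u.periodic_real⟩, ext_real fun _ => rfl, ext_real fun s => (h s).deriv,
    ext_real fun s => ?_⟩
  change deriv (deriv fun s : ℝ => u (s : AddCircle (1 : ℝ))) s = _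
  rw [show deriv (fun s : ℝ => u (s : AddCircle (1 : ℝ))) = fun s : ℝ => v (s : AddCircle (1 : ℝ)) from
    funext fun s => (h s).deriv]
  exact (h' s).deriv

end Loop

/-! ### Riesz theory for the periodic problem -/

namespace PerFun

variable {N : ℕ}

/-- Fixed points of this operator are the periodic solutions of `u'' = A u`. -/
def odeOp (A : PerFun N →L[ℝ] PerFun N) : PerFun N →L[ℝ] PerFun N :=
  green N ∘L (constL N ∘L eval0 N - A)

theorem isCompactOperator_odeOp (A : PerFun N →L[ℝ] PerFun N) : IsCompactOperator (odeOp A) :=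
  isCompactOperator_green.comp_clm (constL N ∘L eval0 N - A)

theorem eq_odeOp_iff {A : PerFun N →L[ℝ] PerFun N} {u : PerFun N} :
    u = odeOp A u ↔ ∃ v, IsDeriv u v ∧ IsDeriv v (A u) := eq_green_iff

/-- Fredholm alternative: 1 is either an eigenvalue of the compact operator T or in its resolvent
set. -/
theorem exists_equiv_of_compact {T : PerFun N →L[ℝ] PerFun N} (hT : IsCompactOperator T)
    (hinj : ∀ u, u = T u → u = 0) : ∃ D : PerFun N ≃L[ℝ] PerFun N, ∀ u, D u = u - T u := by
  have hnot : ¬ Module.End.HasEigenvalue (T : Module.End ℝ (PerFun N)) 1 := by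
    intro h
    obtain ⟨u, hu⟩ := h.exists_hasEigenvector
    refine hu.2 (hinj u ?_)
    have := hu.apply_eq_smul
    rw [one_smul] at this
    exact this.symm
  have hres := (hT.hasEigenvalue_or_mem_resolventSet one_ne_zero).resolve_left hnot
  rw [spectrum.mem_resolventSet_iff, map_one] at hres
  obtain ⟨U, hU⟩ := hres
  refine ⟨ContinuousLinearEquiv.ofUnit U, fun u => ?_⟩
  change (U : PerFun N →L[ℝ] PerFun N) u = _
  rw [hU]
  rfl

/-- On this kernel T is the identity, which is therefore compact. -/
theorem finiteDimensional_ker_of_compact {T : PerFun N →L[ℝ] PerFun N} (hT : IsCompactOperator T) :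
    FiniteDimensional ℝ (LinearMap.ker ((1 - T : PerFun N →L[ℝ] PerFun N) : PerFun N →ₗ[ℝ] PerFun N)) := by
  set S := LinearMap.ker ((1 - T : PerFun N →L[ℝ] PerFun N) : PerFun N →ₗ[ℝ] PerFun N)
  have hS : ∀ u ∈ S, T u = u := fun u hu => by
    have : u - T u = 0 := hu
    exact (sub_eq_zero.1 this).symm
  have hcl : IsClosed (S : Set (PerFun N)) := (1 - T).isClosed_ker
  have hr := IsCompactOperator.restrict (f := (T : PerFun N →ₗ[ℝ] PerFun N)) hT
    (fun v hv => by rw [ContinuousLinearMap.coe_coe, hS v hv]; exact hv) hcl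
  refine FiniteDimensional.of_isCompactOperator_id (𝕜 := ℝ) ?_
  convert! hr using 1
  exact funext fun u => Subtype.ext (hS u u.2).symm

end PerFun

/-! ### Zero modes and the invertible linearized equation -/

namespace LagrangianFamily

open PerFun Loop

variable {N : ℕ} (L : LagrangianFamily N) {ξ : ℝ} {q : Loop N}

/-- The kernel of the Hessian. -/
def hessKer (hξ : ξ ∈ L.param) (hq : L.Inside q) : Submodule ℝ (Loop N) where
  carrier := {u | L.hessLoop ξ q u = 0}
  zero_mem' := by simpa using L.hessLoop_smul hξ hq 0 0
  add_mem' := fun {u v} hu hv => by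
    rw [Set.mem_ofPred_eq] at *
    rw [L.hessLoop_add hξ hq, hu, hv, add_zero]
  smul_mem' := fun c u hu => by
    rw [Set.mem_ofPred_eq] at *
    rw [L.hessLoop_smul hξ hq, hu, smul_zero]

theorem mem_hessKer {hξ : ξ ∈ L.param} {hq : L.Inside q} {u : Loop N} :
    u ∈ L.hessKer hξ hq ↔ L.hessLoop ξ q u = 0 := Iff.rfl

theorem post_massInv_massM (hξ : ξ ∈ L.param) (u : PerFun N) :
    post (L.massInv ξ) (post (L.massM ξ) u) = u :=
  ext_real fun _ => L.massInv_massM hξ _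

theorem post_massM_massInv (hξ : ξ ∈ L.param) (u : PerFun N) :
    post (L.massM ξ) (post (L.massInv ξ) u) = u :=
  ext_real fun _ => L.massM_massInv hξ _

theorem finiteDimensional_hessKer (hξ : ξ ∈ L.param) (hq : L.Inside q) :
    FiniteDimensional ℝ (L.hessKer hξ hq) := by
  set A := post (L.massInv ξ) ∘L mulOp (L.potHess hξ hq) with hA
  have := finiteDimensional_ker_of_compact (isCompactOperator_odeOp A)
  have hmem : ∀ u ∈ L.hessKer hξ hq, toX u ∈
      LinearMap.ker ((1 - odeOp A : PerFun N →L[ℝ] PerFun N) : PerFun N →ₗ[ℝ] PerFun N) := by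
    intro u hu
    have h1 : L.hessLoop ξ q u = 0 := hu
    have h2 := L.toX_hessLoop hξ hq u
    rw [h1, map_zero, eq_comm, neg_add_eq_zero] at h2
    have h3 : toX u = odeOp A (toX u) := eq_odeOp_iff.2 ⟨toX (dL u), u.isDeriv_toX, by
      have : A (toX u) = toX (dL (dL u)) := by
        rw [hA, ContinuousLinearMap.comp_apply, ← h2, L.post_massInv_massM hξ]
      rw [this]
      exact (dL u).isDeriv_toX⟩
    exact sub_eq_zero.2 h3
  set S := LinearMap.ker ((1 - odeOp A : PerFun N →L[ℝ] PerFun N) : PerFun N →ₗ[ℝ] PerFun N)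
  let f : L.hessKer hξ hq →ₗ[ℝ] S :=
    (toX.comp (L.hessKer hξ hq).subtype).codRestrict S fun u => hmem u u.2
  refine FiniteDimensional.of_injective (K := ℝ) (V := L.hessKer hξ hq) (V₂ := S) f ?_
  intro u v huv
  exact Subtype.ext (toX_injective (congrArg Subtype.val huv))

/-- The linearized equation, modified on the kernel of the Hessian, is uniquely solvable. -/
theorem exists_linearized_equiv (hξ : ξ ∈ L.param) (hq : L.Inside q) {n : ℕ} {e : Fin n → Loop N}
    (he : IsOrthoBasis (L.hessKer hξ hq) e) :
    ∃ D : PerFun N ≃L[ℝ] PerFun N, ∀ u, D u = u - green N (constL N (u ((0 : ℝ) : AddCircle (1 : ℝ))) -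
      post (L.massInv ξ) (mulOp (L.potHess hξ hq) u + projX e u)) := by
  set A := post (L.massInv ξ) ∘L (mulOp (L.potHess hξ hq) + projX e) with hA
  refine exists_equiv_of_compact (isCompactOperator_odeOp A) fun u hu => ?_
  obtain ⟨v, h, h'⟩ := eq_odeOp_iff.1 hu
  -- Once u is given, the nonlocal term is a fixed combination of the smooth functions `e i`. The
  -- equation is then an ordinary differential equation with smooth right-hand side, and u is
  -- smooth.
  set c : Fin n → ℝ := fun i => ip N (toX (e i)) u with hc
  have hsum : ContDiff ℝ ∞ fun s : ℝ => ∑ i, c i • (e i).1 s :=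
    ContDiff.sum fun i _ => (e i).2.1.const_smul (c i)
  have hΘ : ContDiff ℝ ∞ fun p : ℝ × Config N => L.massInv ξ
      (fderiv ℝ (gradient (L.pot ξ)) (q.1 p.1) p.2 + ∑ i, c i • (e i).1 p.1) :=
    (L.massInv ξ).contDiff.comp ((((L.contDiff_comp_curve L.contDiffOn_hess hξ hq).comp
      contDiff_fst).clm_apply contDiff_snd).add (hsum.comp contDiff_fst))
  obtain ⟨w, rfl, rfl, hw⟩ := exists_toX_eq h h' hΘ.contDiffOn (O := Set.univ) (fun _ => trivial)
    (fun s => by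
      rw [hA]
      simp only [ContinuousLinearMap.comp_apply, post_apply, add_apply, ContinuousMap.add_apply,
        mulOp_apply, potHess_apply, projX_apply, ContinuousMap.sum_apply, ContinuousMap.smul_apply,
        toX_apply, hc])
  have h1 : toX (L.hessLoop ξ q w) + projX e (toX w) = 0 := by
    rw [L.toX_hessLoop hξ hq, hw, hA, ContinuousLinearMap.comp_apply, L.post_massM_massInv hξ,
      add_apply]
    abel
  -- Pairing with a zero mode removes the Hessian term by self-adjointness. Hence w has no component
  -- in the kernel, then lies in the kernel, and so is 0.
  have h2 : ∀ i, ip N (toX (e i)) (toX w) = 0 := fun i => by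
    have := congrArg (fun x => ip N x (toX (e i))) h1
    simp only [map_add, add_apply, map_zero, zero_apply] at this
    rw [L.ip_hessLoop hξ hq, (L.mem_hessKer.1 (he.mem i)), map_zero, map_zero, zero_add,
      he.ip_projX_mem (he.mem i), ip_comm] at this
    exact this
  have h3 : projX e (toX w) = 0 := by
    rw [projX_apply]
    exact Finset.sum_eq_zero fun i _ => by rw [h2]; exact zero_smul ℝ (toX (e i))
  rw [h3, add_zero] at h1
  have h4 : w ∈ L.hessKer hξ hq := toX_injective (by rw [h1, map_zero])
  rw [← he.projX_toX h4, h3]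

end LagrangianFamily

/-! ### A parameter-uniform inverse function theorem -/

/-- Uniform solvability of a family of equations that are close to one invertible linear map. -/
theorem exists_solution_family {X : Type*} [NormedAddCommGroup X] [NormedSpace ℝ X] [CompleteSpace X]
    {F : ℝ → X → X} {D : X ≃L[ℝ] X} {b : ℝ → X} {ξ₀ : ℝ}
    (hF : ∀ ε > 0, ∃ δ > 0, ∀ ξ, |ξ - ξ₀| < δ → ∀ u u', ‖u‖ < δ → ‖u'‖ < δ →
      ‖F ξ u - F ξ u' - D (u - u')‖ ≤ ε * ‖u - u'‖)
    (hF0 : ∀ᶠ ξ in 𝓝 ξ₀, F ξ 0 = 0) (hb : ContinuousAt b ξ₀) {δ₀ : ℝ} (hδ₀ : 0 < δ₀) :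
    ∃ C > 0, ∃ δ > 0, δ ≤ δ₀ ∧ ∃ η > 0, ∀ ξ, |ξ - ξ₀| < η →
      (∀ u u', ‖u‖ < δ → ‖u'‖ < δ → ‖u - u'‖ ≤ C * ‖F ξ u - F ξ u'‖) ∧
      ∀ r, |r| < η → ∃ u, ‖u‖ < δ ∧ F ξ u = r • b ξ := by
  -- The summand 1 keeps c positive. Approximating D with constant 1/(2c) loses half of the lower
  -- bound 1/c for D, whence the Lipschitz constant 2c of the inverse.
  set c : ℝ := ‖(D.symm : X →L[ℝ] X)‖ + 1 with hc
  have hc0 : 0 < c := by positivity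
  obtain ⟨δ₁, hδ₁, h₁⟩ := hF (1 / (2 * c)) (by positivity)
  set δ := min δ₁ δ₀ with hδ
  have hδpos : 0 < δ := lt_min hδ₁ hδ₀
  obtain ⟨η₂, hη₂, h₂⟩ := Metric.eventually_nhds_iff.1
    (hF0.and (hb.norm.eventually (gt_mem_nhds (show ‖b ξ₀‖ < ‖b ξ₀‖ + 1 by linarith))))
  have hD : ∀ d : X, ‖d‖ ≤ c * ‖D d‖ := fun d => by
    have := (D.symm : X →L[ℝ] X).le_opNorm (D d)
    simp only [ContinuousLinearEquiv.coe_coe, ContinuousLinearEquiv.symm_apply_apply] at this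
    nlinarith [norm_nonneg (D d)]
  -- The image of the closed ball of radius δ/2 covers the ball of radius (1/c - 1/(2c)) · δ/2 =
  -- δ/(4c); the last bound on η keeps r b(ξ) inside it.
  refine ⟨2 * c, by positivity, δ, hδpos, min_le_right _ _,
    min (min δ₁ η₂) (δ / (4 * c * (‖b ξ₀‖ + 1))), by positivity, fun ξ hξ => ⟨?_, ?_⟩⟩
  · intro u u' hu hu'
    have h3 := h₁ ξ (hξ.trans_le ((min_le_left _ _).trans (min_le_left _ _))) u u'
      (hu.trans_le (min_le_left _ _)) (hu'.trans_le (min_le_left _ _))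
    have h4 := hD (u - u')
    have h5 : ‖D (u - u')‖ ≤ ‖F ξ u - F ξ u'‖ + 1 / (2 * c) * ‖u - u'‖ := by
      have := norm_sub_le (F ξ u - F ξ u') (F ξ u - F ξ u' - D (u - u'))
      rw [sub_sub_cancel] at this
      linarith
    have h6 : c * ‖D (u - u')‖ ≤ c * ‖F ξ u - F ξ u'‖ + 1 / 2 * ‖u - u'‖ := by
      refine (mul_le_mul_of_nonneg_left h5 hc0.le).trans_eq ?_
      field_simp
    linarith
  · intro r hr
    obtain ⟨h00, hbξ⟩ := h₂ (y := ξ) (by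
      rw [Real.dist_eq]; exact hξ.trans_le ((min_le_left _ _).trans (min_le_right _ _)))
    set k : NNReal := ⟨1 / (2 * c), by positivity⟩ with hk
    have happ : ApproximatesLinearOn (F ξ) (D : X →L[ℝ] X) (Metric.closedBall 0 (δ / 2)) k := by
      intro u hu u' hu'
      rw [mem_closedBall_zero_iff] at hu hu'
      have hδδ : δ ≤ δ₁ := min_le_left _ _
      exact h₁ ξ (hξ.trans_le ((min_le_left _ _).trans (min_le_left _ _))) u u'
        (by linarith) (by linarith)
    set R : (D : X →L[ℝ] X).NonlinearRightInverse :=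
      { toFun := D.symm, nnnorm := ⟨c, hc0.le⟩
        bound' := fun y => by
          have := (D.symm : X →L[ℝ] X).le_opNorm y
          change ‖D.symm y‖ ≤ c * ‖y‖
          simp only [ContinuousLinearEquiv.coe_coe] at this
          nlinarith [norm_nonneg y]
        right_inv' := fun y => by simp } with hR
    have hsurj := happ.surjOn_closedBall_of_nonlinearRightInverse R (b := 0) (ε := δ / 2)
      (by positivity) subset_rfl
    have hRk : ((R.nnnorm : ℝ)⁻¹ - k) * (δ / 2) = δ / (4 * c) := by
      change (c⁻¹ - 1 / (2 * c)) * (δ / 2) = _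
      field_simp; norm_num
    rw [hRk, h00] at hsurj
    obtain ⟨u, hu, hFu⟩ := hsurj (show r • b ξ ∈ _ by
      rw [mem_closedBall_zero_iff, norm_smul, Real.norm_eq_abs]
      have h7 : |r| * (4 * c * (‖b ξ₀‖ + 1)) < δ :=
        (lt_div_iff₀ (by positivity)).1 (hr.trans_le (min_le_right _ _))
      rw [le_div_iff₀ (by positivity)]
      have h8 : |r| * ‖b ξ‖ ≤ |r| * (‖b ξ₀‖ + 1) := mul_le_mul_of_nonneg_left hbξ.le (abs_nonneg r)
      nlinarith)
    rw [mem_closedBall_zero_iff] at hu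
    exact ⟨u, by linarith, hFu⟩

namespace PerFun

variable {N : ℕ}

theorem norm_mulOp_apply_le {V : C(AddCircle (1 : ℝ), Config N →L[ℝ] Config N)} (u : PerFun N) :
    ‖mulOp V u‖ ≤ ‖V‖ * ‖u‖ :=
  norm_le_of_real (by positivity) fun s => ((V _).le_opNorm _).trans
    (mul_le_mul (V.norm_coe_le_norm _) (u.norm_coe_le _) (norm_nonneg _) (norm_nonneg V))

theorem continuous_post : Continuous (post (N := N)) := by
  let f : (Config N →L[ℝ] Config N) →ₗ[ℝ] (PerFun N →L[ℝ] PerFun N) :=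
    { toFun := post
      map_add' := fun A B => by ext u x; rfl
      map_smul' := fun c A => by ext u x; rfl }
  exact AddMonoidHomClass.continuous_of_bound f 1 fun A => by
    rw [one_mul]
    exact ContinuousLinearMap.opNorm_le_bound _ (norm_nonneg A) fun u => norm_post_le A u

open Classical in
/-- The continuous periodic function with the given values (`0` if there is none). -/
def ofReal (f : ℝ → Config N) : PerFun N :=
  if h : Continuous f ∧ Function.Periodic f 1 then mk' f h.1 h.2 else 0

theorem ofReal_apply {f : ℝ → Config N} (hf : Continuous f) (hp : Function.Periodic f 1) (s : ℝ) :
    ofReal f (s : AddCircle (1 : ℝ)) = f s := by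
  rw [ofReal, dif_pos ⟨hf, hp⟩, mk'_apply]

end PerFun

/-! ### The nonlinear part of the gradient along the solution family -/

namespace LagrangianFamily

open PerFun Loop

variable {N : ℕ} {L : LagrangianFamily N} {qo : ℝ → Loop N} {ξ : ℝ}

theorem IsSolutionFamily.inside (hqo : L.IsSolutionFamily qo) (hξ : ξ ∈ L.param) :
    L.Inside (qo ξ) := (hqo.stationary ξ hξ).1

theorem IsSolutionFamily.elGrad_eq_zero (hqo : L.IsSolutionFamily qo) (hξ : ξ ∈ L.param) :
    L.elGrad ξ (qo ξ) = 0 := ((L.isStationary_iff hξ).1 (hqo.stationary ξ hξ)).2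

theorem IsSolutionFamily.continuousOn (hqo : L.IsSolutionFamily qo) :
    ContinuousOn (fun p : ℝ × ℝ => (qo p.1).1 p.2) (L.param ×ˢ Set.univ) := hqo.contDiffOn.continuousOn

theorem IsSolutionFamily.continuousOn_deriv (hqo : L.IsSolutionFamily qo) :
    ContinuousOn (fun p : ℝ × ℝ => (dL (qo p.1)).1 p.2) (L.param ×ˢ Set.univ) :=
  (contDiffOn_fderiv_right (f := fun ξ => (qo ξ).1) (L.isOpen_param.prod isOpen_univ)
    hqo.contDiffOn).continuousOn.clm_apply (continuousOn_const (c := (1 : ℝ)))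

variable (L qo)

/-- The nonlinear part of the gradient of the action at `qo + u`. -/
def nem (ξ : ℝ) (u : PerFun N) : PerFun N :=
  ofReal fun s => gradient (L.pot ξ) ((qo ξ).1 s + u (s : AddCircle (1 : ℝ))) -
    gradient (L.pot ξ) ((qo ξ).1 s)

variable {L qo}

theorem nem_apply (hqo : L.IsSolutionFamily qo) (hξ : ξ ∈ L.param) {u : PerFun N}
    (hu : ∀ s : ℝ, (qo ξ).1 s + u (s : AddCircle (1 : ℝ)) ∈ L.dom) (s : ℝ) :
    L.nem qo ξ u (s : AddCircle (1 : ℝ)) =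
      gradient (L.pot ξ) ((qo ξ).1 s + u (s : AddCircle (1 : ℝ))) -
        gradient (L.pot ξ) ((qo ξ).1 s) := by
  rw [nem, ofReal_apply]
  · exact (continuous_comp_curve L.contDiffOn_gradient.continuousOn hξ
      ((qo ξ).2.1.continuous.add u.continuous_real) hu).sub
      (continuous_comp_curve L.contDiffOn_gradient.continuousOn hξ
      (qo ξ).2.1.continuous (hqo.inside hξ))
  · intro s
    simp [(qo ξ).2.2 s]

theorem nem_zero (hqo : L.IsSolutionFamily qo) (hξ : ξ ∈ L.param) : L.nem qo ξ 0 = 0 :=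
  ext_real fun s => by
    rw [nem_apply hqo hξ (fun s => by simpa using hqo.inside hξ s)]
    simp

theorem exists_nem_approx (hqo : L.IsSolutionFamily qo) {ξ₁ : ℝ} (hξ₁ : ξ₁ ∈ L.param) {ε : ℝ}
    (hε : 0 < ε) : ∃ δ > 0, ∀ ξ, |ξ - ξ₁| < δ → ξ ∈ L.param ∧
      (∀ u : PerFun N, ‖u‖ < δ → ∀ s : ℝ, (qo ξ).1 s + u (s : AddCircle (1 : ℝ)) ∈ L.dom) ∧
      ∀ u u' : PerFun N, ‖u‖ < δ → ‖u'‖ < δ →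
        ‖L.nem qo ξ u - L.nem qo ξ u' - mulOp (L.potHess hξ₁ (hqo.inside hξ₁)) (u - u')‖ ≤
          ε * ‖u - u'‖ := by
  obtain ⟨δ, hδ, h⟩ := exists_forall_linear_approx (f := fun ξ => gradient (L.pot ξ))
    (q := fun ξ => (qo ξ).1) L.isOpen_param L.isOpen_dom hξ₁ L.contDiffOn_gradient hqo.continuousOn
    (fun ξ _ => (qo ξ).2.2) (hqo.inside hξ₁) hε
  refine ⟨δ, hδ, fun ξ hξ => ⟨(h ξ hξ).1, ?_⟩⟩
  have hin : ∀ u : PerFun N, ‖u‖ < δ → ∀ s : ℝ, (qo ξ).1 s + u (s : AddCircle (1 : ℝ)) ∈ L.dom :=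
    fun u hu s => ((h ξ hξ).2 s (u (s : AddCircle (1 : ℝ))) 0 ((u.norm_coe_le _).trans_lt hu)
      (by simpa using hδ)).1
  refine ⟨hin, fun u u' hu hu' => norm_le_of_real (by positivity) fun s => ?_⟩
  have h1 := ((h ξ hξ).2 s (u (s : AddCircle (1 : ℝ))) (u' (s : AddCircle (1 : ℝ)))
    ((u.norm_coe_le _).trans_lt hu) ((u'.norm_coe_le _).trans_lt hu')).2
  simp only [ContinuousMap.sub_apply, mulOp_apply, potHess_apply,
    nem_apply hqo (h ξ hξ).1 (hin u hu), nem_apply hqo (h ξ hξ).1 (hin u' hu'), sub_sub_sub_cancel_right]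
  refine h1.trans (mul_le_mul_of_nonneg_left ?_ hε.le)
  exact (u - u').norm_coe_le (s : AddCircle (1 : ℝ))

theorem exists_nem_quadratic (hqo : L.IsSolutionFamily qo) (hξ : ξ ∈ L.param) :
    ∃ C, 0 ≤ C ∧ ∃ δ > 0, ∀ u : PerFun N, ‖u‖ < δ →
      ‖L.nem qo ξ u - mulOp (L.potHess hξ (hqo.inside hξ)) u‖ ≤ C * ‖u‖ ^ 2 := by
  obtain ⟨C, hC, δ, hδ, h⟩ := exists_forall_quadratic_approx (f := fun ξ => gradient (L.pot ξ))
    L.isOpen_param L.isOpen_dom hξ L.contDiffOn_gradient (qo ξ).2.1.continuous (qo ξ).2.2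
    (hqo.inside hξ)
  obtain ⟨δ', hδ', h'⟩ := exists_nem_approx hqo hξ one_pos
  have hin := (h' ξ (by simpa using hδ')).2.1
  refine ⟨C, hC, min δ δ', by positivity, fun u hu => norm_le_of_real (by positivity) fun s => ?_⟩
  have h1 := h s (u (s : AddCircle (1 : ℝ))) ((u.norm_coe_le _).trans_lt (hu.trans_le (min_le_left _ _)))
  simp only [ContinuousMap.sub_apply, mulOp_apply, potHess_apply,
    nem_apply hqo hξ (hin u (hu.trans_le (min_le_right _ _)))]
  refine h1.trans (mul_le_mul_of_nonneg_left ?_ hC)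
  have := u.norm_coe_le (s : AddCircle (1 : ℝ))
  gcongr

theorem continuousAt_nem (hqo : L.IsSolutionFamily qo) {ξ₁ : ℝ} (hξ₁ : ξ₁ ∈ L.param) {u : PerFun N}
    (hu : ∀ s : ℝ, (qo ξ₁).1 s + u (s : AddCircle (1 : ℝ)) ∈ L.dom) :
    ContinuousAt (fun ξ => L.nem qo ξ u) ξ₁ := by
  have key : ∀ v : PerFun N, (∀ s : ℝ, (qo ξ₁).1 s + v (s : AddCircle (1 : ℝ)) ∈ L.dom) → ∀ ε > 0,
      ∃ δ > 0, ∀ ξ, |ξ - ξ₁| < δ → ξ ∈ L.param ∧ ∀ s : ℝ,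
        (qo ξ).1 s + v (s : AddCircle (1 : ℝ)) ∈ L.dom ∧
        dist (gradient (L.pot ξ) ((qo ξ).1 s + v (s : AddCircle (1 : ℝ))))
          (gradient (L.pot ξ₁) ((qo ξ₁).1 s + v (s : AddCircle (1 : ℝ)))) < ε := by
    intro v hv ε hε
    obtain ⟨δ, hδ, h⟩ := exists_forall_dist_lt_of_periodic L.isOpen_param hξ₁
      (c := fun ξ s => (ξ, (qo ξ).1 s + v (s : AddCircle (1 : ℝ))))
      (f := fun p : ℝ × Config N => gradient (L.pot p.1) p.2) (O := L.param ×ˢ L.dom)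
      (continuousOn_fst.prodMk (hqo.continuousOn.add
        (v.continuous_real.comp_continuousOn continuousOn_snd)))
      (fun ξ _ s => by simp [(qo ξ).2.2 s]) (L.isOpen_param.prod L.isOpen_dom)
      L.contDiffOn_gradient.continuousOn (fun s => ⟨hξ₁, hv s⟩) hε
    refine ⟨δ, hδ, fun ξ hξ => ⟨(h ξ hξ).1, fun s => ?_⟩⟩
    have := (h ξ hξ).2 s (ξ, (qo ξ).1 s + v (s : AddCircle (1 : ℝ))) (by simpa using hδ)
    exact ⟨this.1.2, this.2⟩
  rw [Metric.continuousAt_iff]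
  intro ε hε
  obtain ⟨δ₁, hδ₁, h₁⟩ := key u hu (ε / 4) (by positivity)
  obtain ⟨δ₂, hδ₂, h₂⟩ := key 0 (fun s => by simpa using hqo.inside hξ₁ s) (ε / 4) (by positivity)
  refine ⟨min δ₁ δ₂, by positivity, fun {ξ} hξ => ?_⟩
  rw [Real.dist_eq] at hξ
  have h3 := h₁ ξ (hξ.trans_le (min_le_left _ _))
  have h4 := h₂ ξ (hξ.trans_le (min_le_right _ _))
  rw [dist_eq_norm]
  refine lt_of_le_of_lt (norm_le_of_real (C := ε / 2) (by positivity) fun s => ?_) (by linarith)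
  rw [ContinuousMap.sub_apply, nem_apply hqo h3.1 (fun s => (h3.2 s).1), nem_apply hqo hξ₁ hu]
  have h5 := (h3.2 s).2.le
  have h6 := (h4.2 s).2.le
  simp only [ContinuousMap.zero_apply, add_zero] at h6
  rw [dist_eq_norm] at h5 h6
  rw [sub_sub_sub_comm]
  exact (norm_sub_le _ _).trans (by linarith)

end LagrangianFamily

/-! ### The projected equation -/

namespace LagrangianFamily

open PerFun Loop

variable {N : ℕ}

/-- The operator `u ↦ ∑ ⟨eᵢ'', u⟩ eᵢ`. -/
def kinProj {n : ℕ} (e : Fin n → Loop N) : PerFun N →L[ℝ] PerFun N :=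
  ∑ i, (ip N (toX (dL (dL (e i))))).smulRight (toX (e i))

theorem kinProj_apply {n : ℕ} (e : Fin n → Loop N) (u : PerFun N) :
    kinProj e u = ∑ i, ip N (toX (dL (dL (e i)))) u • toX (e i) := by
  simp [kinProj]

variable (L : LagrangianFamily N) (qo : ℝ → Loop N) {n : ℕ} (e : Fin n → Loop N)

/-- The second derivative prescribed by the equation projected on the complement of the kernel. -/
def lsField (ξ : ℝ) (u : PerFun N) : PerFun N :=
  post (L.massInv ξ) (L.nem qo ξ u - projX e (L.nem qo ξ u) + kinProj e (post (L.massM ξ) u) +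
    projX e u)

/-- The projected equation as an equation for continuous functions. -/
def lsMap (ξ : ℝ) (u : PerFun N) : PerFun N :=
  u - green N (constL N (u ((0 : ℝ) : AddCircle (1 : ℝ))) - L.lsField qo e ξ u)

/-- `v` solves the projected equations with amplitude `r`. -/
structure IsReducedSol (ξ₀ : ℝ) (φ : Loop N) (ξ r : ℝ) (v : Loop N) : Prop where
  inside : L.Inside (qo ξ + v)
  grad_mem : L.hessLoop ξ₀ (qo ξ₀) (L.elGrad ξ (qo ξ + v)) = 0
  proj : projX e (toX v) = r • toX φ

variable {L qo e} {ξ ξ₀ : ℝ}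

/-- Zero modes satisfy M e'' = V e with M the mass matrix and V the second derivative of the
potential, and both M and V are symmetric. This requires the basis to belong to the same parameter
ξ. -/
theorem kinProj_massM (hξ : ξ ∈ L.param) {q : Loop N} (hq : L.Inside q)
    (he : IsOrthoBasis (L.hessKer hξ hq) e) (u : PerFun N) :
    kinProj e (post (L.massM ξ) u) = projX e (mulOp (L.potHess hξ hq) u) := by
  rw [kinProj_apply, projX_apply]
  refine Finset.sum_congr rfl fun i _ => ?_
  have h2 := L.toX_hessLoop hξ hq (e i)
  rw [L.mem_hessKer.1 (he.mem i), map_zero, eq_comm, neg_add_eq_zero] at h2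
  rw [← ip_mulOp_potHess, ← h2, massM, ip_post_diag]

/-- The linearization of `lsField` at `0`. -/
def lsLin (hξ : ξ ∈ L.param) {q : Loop N} (hq : L.Inside q) (e : Fin n → Loop N) :
    PerFun N →L[ℝ] PerFun N :=
  post (L.massInv ξ) ∘L (mulOp (L.potHess hξ hq) + projX e)

/-- Separates a linear operator, whose dependence on ξ comes only from the masses and the period,
from the nonlinear remainder estimated in `exists_nem_approx`. -/
theorem lsField_sub (hξ₀ : ξ₀ ∈ L.param) {q : Loop N} (hq : L.Inside q) (u u' : PerFun N) :
    L.lsField qo e ξ u - L.lsField qo e ξ u' =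
      (post (L.massInv ξ) ∘L (mulOp (L.potHess hξ₀ hq) - projX e ∘L mulOp (L.potHess hξ₀ hq) +
        kinProj e ∘L post (L.massM ξ) + projX e)) (u - u') +
      (post (L.massInv ξ) ∘L (1 - projX e))
        (L.nem qo ξ u - L.nem qo ξ u' - mulOp (L.potHess hξ₀ hq) (u - u')) := by
  simp only [lsField, ContinuousLinearMap.comp_apply, add_apply, sub_apply,
    one_apply_eq_self, ← map_sub, ← map_add]
  congr 1
  simp only [map_sub]
  abel

/-- At ξ₀ the two projected terms cancel by `kinProj_massM`, leaving the operator of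
`exists_linearized_equiv`. -/
theorem lsLin_eq (hξ₀ : ξ₀ ∈ L.param) {q : Loop N} (hq : L.Inside q)
    (he : IsOrthoBasis (L.hessKer hξ₀ hq) e) :
    post (L.massInv ξ₀) ∘L (mulOp (L.potHess hξ₀ hq) - projX e ∘L mulOp (L.potHess hξ₀ hq) +
        kinProj e ∘L post (L.massM ξ₀) + projX e) = lsLin hξ₀ hq e := by
  ext1 u
  simp only [lsLin, ContinuousLinearMap.comp_apply, add_apply, sub_apply,
    kinProj_massM hξ₀ hq he, sub_add_cancel]

theorem exists_lsField_approx (hqo : L.IsSolutionFamily qo) (hξ₀ : ξ₀ ∈ L.param)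
    (he : IsOrthoBasis (L.hessKer hξ₀ (hqo.inside hξ₀)) e) {ε : ℝ} (hε : 0 < ε) :
    ∃ δ > 0, ∀ ξ, |ξ - ξ₀| < δ → ∀ u u' : PerFun N, ‖u‖ < δ → ‖u'‖ < δ →
      ‖L.lsField qo e ξ u - L.lsField qo e ξ u' - lsLin hξ₀ (hqo.inside hξ₀) e (u - u')‖ ≤
        ε * ‖u - u'‖ := by
  have hmem := L.isOpen_param.mem_nhds hξ₀
  have hcI : ContinuousAt (fun ξ => post (L.massInv ξ)) ξ₀ :=
    continuous_post.continuousAt.comp (L.continuousOn_massInv.continuousAt hmem)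
  have hcM : ContinuousAt (fun ξ => post (L.massM ξ)) ξ₀ :=
    continuous_post.continuousAt.comp (L.continuousOn_massM.continuousAt hmem)
  set V := mulOp (L.potHess hξ₀ (hqo.inside hξ₀)) with hV
  set Λ : ℝ → PerFun N →L[ℝ] PerFun N := fun ξ => post (L.massInv ξ) ∘L (V - projX e ∘L V +
        kinProj e ∘L post (L.massM ξ) + projX e) with hΛ
  have hcΛ : ContinuousAt Λ ξ₀ :=
    hcI.clm_comp ((continuousAt_const.add (continuousAt_const.clm_comp hcM)).add continuousAt_const)
  set Q : ℝ → PerFun N →L[ℝ] PerFun N := fun ξ => post (L.massInv ξ) ∘L (1 - projX e) with hQ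
  have hcB : ContinuousAt Q ξ₀ :=
    hcI.clm_comp continuousAt_const
  set B := ‖Q ξ₀‖ + 1 with hB
  have hevΛ : ∀ᶠ ξ in 𝓝 ξ₀, ‖Λ ξ - Λ ξ₀‖ < ε / 2 :=
    (hcΛ.eventually (Metric.ball_mem_nhds (Λ ξ₀) (by positivity : 0 < ε / 2))).mono fun ξ h =>
      lt_of_eq_of_lt (dist_eq_norm (Λ ξ) (Λ ξ₀)).symm h
  have hevQ : ∀ᶠ ξ in 𝓝 ξ₀, ‖Q ξ - Q ξ₀‖ < 1 :=
    (hcB.eventually (Metric.ball_mem_nhds (Q ξ₀) one_pos)).mono fun ξ h =>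
      lt_of_eq_of_lt (dist_eq_norm (Q ξ) (Q ξ₀)).symm h
  obtain ⟨δ₁, hδ₁, h₁⟩ := Metric.eventually_nhds_iff.1 (hevΛ.and hevQ)
  obtain ⟨δ₂, hδ₂, h₂⟩ := exists_nem_approx hqo hξ₀ (ε := ε / (2 * B)) (by positivity)
  refine ⟨min δ₁ δ₂, by positivity, fun ξ hξ u u' hu hu' => ?_⟩
  obtain ⟨h3, h4⟩ := h₁ (y := ξ) (by rw [Real.dist_eq]; exact hξ.trans_le (min_le_left _ _))
  have h5 := (h₂ ξ (hξ.trans_le (min_le_right _ _))).2.2 u u' (hu.trans_le (min_le_right _ _))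
    (hu'.trans_le (min_le_right _ _))
  have h4' : ‖Q ξ‖ ≤ B := by
    have := norm_le_insert' (Q ξ) (Q ξ₀)
    linarith
  rw [lsField_sub hξ₀ (hqo.inside hξ₀), ← lsLin_eq hξ₀ (hqo.inside hξ₀) he, add_sub_right_comm]
  change ‖(Λ ξ - Λ ξ₀) (u - u') + _‖ ≤ _
  refine (norm_add_le _ _).trans ?_
  have h6 : ‖(Λ ξ - Λ ξ₀) (u - u')‖ ≤ ε / 2 * ‖u - u'‖ :=
    ((Λ ξ - Λ ξ₀).le_opNorm _).trans (mul_le_mul_of_nonneg_right h3.le (norm_nonneg _))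
  have h7 : ‖Q ξ (L.nem qo ξ u - L.nem qo ξ u' - V (u - u'))‖ ≤
      B * (ε / (2 * B) * ‖u - u'‖) :=
    (ContinuousLinearMap.le_opNorm _ _).trans (mul_le_mul h4' h5 (norm_nonneg _) (by positivity))
  have h8 : B * (ε / (2 * B) * ‖u - u'‖) = ε / 2 * ‖u - u'‖ := by
    have : B ≠ 0 := by positivity
    field_simp
  linarith

theorem lsField_zero (hqo : L.IsSolutionFamily qo) (hξ : ξ ∈ L.param) :
    L.lsField qo e ξ 0 = 0 := by
  simp [lsField, nem_zero hqo hξ]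

theorem exists_lsField_quadratic (hqo : L.IsSolutionFamily qo) (hξ₀ : ξ₀ ∈ L.param)
    (he : IsOrthoBasis (L.hessKer hξ₀ (hqo.inside hξ₀)) e) :
    ∃ C, 0 ≤ C ∧ ∃ δ > 0, ∀ u : PerFun N, ‖u‖ < δ →
      ‖L.lsField qo e ξ₀ u - lsLin hξ₀ (hqo.inside hξ₀) e u‖ ≤ C * ‖u‖ ^ 2 := by
  obtain ⟨C, hC, δ, hδ, h⟩ := exists_nem_quadratic hqo hξ₀
  refine ⟨‖post (L.massInv ξ₀) ∘L (1 - projX e)‖ * C, by positivity, δ, hδ, fun u hu => ?_⟩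
  have h1 := lsField_sub (qo := qo) (e := e) (ξ := ξ₀) hξ₀ (hqo.inside hξ₀) u 0
  rw [lsField_zero hqo hξ₀, lsLin_eq hξ₀ (hqo.inside hξ₀) he, nem_zero hqo hξ₀] at h1
  simp only [sub_zero] at h1
  rw [h1, add_sub_cancel_left]
  refine (ContinuousLinearMap.le_opNorm _ _).trans ?_
  rw [mul_assoc]
  exact mul_le_mul_of_nonneg_left (h u hu) (norm_nonneg _)

theorem lsMap_sub (hξ₀ : ξ₀ ∈ L.param) {q : Loop N} (hq : L.Inside q) {D : PerFun N ≃L[ℝ] PerFun N}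
    (hD : ∀ u, D u = u - green N (constL N (u ((0 : ℝ) : AddCircle (1 : ℝ))) -
      post (L.massInv ξ₀) (mulOp (L.potHess hξ₀ hq) u + projX e u))) (u u' : PerFun N) :
    L.lsMap qo e ξ u - L.lsMap qo e ξ u' - D (u - u') =
      green N (L.lsField qo e ξ u - L.lsField qo e ξ u' - lsLin hξ₀ hq e (u - u')) := by
  have : lsLin hξ₀ hq e (u - u') =
    post (L.massInv ξ₀) (mulOp (L.potHess hξ₀ hq) (u - u') + projX e (u - u')) := rfl
  rw [hD, ← this, lsMap, lsMap]
  simp only [map_sub, ContinuousMap.sub_apply]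
  abel

theorem continuousAt_lsField (hqo : L.IsSolutionFamily qo) {ξ₁ : ℝ} (hξ₁ : ξ₁ ∈ L.param)
    {u : PerFun N} (hu : ∀ s : ℝ, (qo ξ₁).1 s + u (s : AddCircle (1 : ℝ)) ∈ L.dom) :
    ContinuousAt (fun ξ => L.lsField qo e ξ u) ξ₁ := by
  have hmem := L.isOpen_param.mem_nhds hξ₁
  have hcI : ContinuousAt (fun ξ => post (L.massInv ξ)) ξ₁ :=
    continuous_post.continuousAt.comp (L.continuousOn_massInv.continuousAt hmem)
  have hcM : ContinuousAt (fun ξ => post (L.massM ξ)) ξ₁ :=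
    continuous_post.continuousAt.comp (L.continuousOn_massM.continuousAt hmem)
  have hn := continuousAt_nem hqo hξ₁ hu
  exact hcI.clm_apply (((hn.sub ((projX e).continuous.continuousAt.comp hn)).add
    ((kinProj e).continuous.continuousAt.comp (hcM.clm_apply continuousAt_const))).add
    continuousAt_const)

theorem continuousAt_lsMap (hqo : L.IsSolutionFamily qo) {ξ₁ : ℝ} (hξ₁ : ξ₁ ∈ L.param)
    {u : PerFun N} (hu : ∀ s : ℝ, (qo ξ₁).1 s + u (s : AddCircle (1 : ℝ)) ∈ L.dom) :
    ContinuousAt (fun ξ => L.lsMap qo e ξ u) ξ₁ :=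
  continuousAt_const.sub ((green N).continuous.continuousAt.comp
    (continuousAt_const.sub (continuousAt_lsField hqo hξ₁ hu)))

/-- Stationarity of `qo ξ` cancels its own acceleration against the potential gradient along it. -/
theorem toX_elGrad (hqo : L.IsSolutionFamily qo) (hξ : ξ ∈ L.param) {v : Loop N}
    (hv : L.Inside (qo ξ + v)) : toX (L.elGrad ξ (qo ξ + v)) =
      - post (L.massM ξ) (toX (dL (dL v))) + L.nem qo ξ (toX v) := by
  refine ext_real fun s => ?_
  have h0 := congrFun (congrArg Subtype.val (hqo.elGrad_eq_zero hξ)) s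
  rw [L.elGrad_apply hξ (hqo.inside hξ)] at h0
  have h1 : gradient (L.pot ξ) ((qo ξ).1 s) = L.massM ξ ((dL (dL (qo ξ))).1 s) := by
    exact (neg_add_eq_zero.1 (h0.trans (by rfl))).symm
  rw [toX_apply, L.elGrad_apply hξ hv, ContinuousMap.add_apply, nem_apply (u := toX v) hqo hξ hv, h1]
  simp only [map_add, ContinuousMap.neg_apply, post_apply, toX_apply]
  change - (L.massM ξ ((dL (dL (qo ξ))).1 s + (dL (dL v)).1 s)) + _ = _
  rw [map_add]
  simp only [Submodule.coe_add, Pi.add_apply]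
  abel

/-- With γ the gradient at `qo ξ + v` and P the projector `projX e`, the differential equation says
γ - P γ + P v = r φ. Applying P leaves P v = r φ, and then γ = P γ lies in the kernel; conversely
the two conditions add up to the equation. In the right-hand side `kinProj` stands for P of the
kinetic term with both derivatives moved to the basis, so that it makes sense for merely continuous
functions. -/
theorem isReducedSol_iff (hqo : L.IsSolutionFamily qo) (hξ₀ : ξ₀ ∈ L.param) (hξ : ξ ∈ L.param)
    (he : IsOrthoBasis (L.hessKer hξ₀ (hqo.inside hξ₀)) e) {φ : Loop N}
    (hφ : L.hessLoop ξ₀ (qo ξ₀) φ = 0) {r : ℝ} {v : Loop N} (hv : L.Inside (qo ξ + v)) :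
    L.IsReducedSol qo e ξ₀ φ ξ r v ↔
      toX (dL (dL v)) = L.lsField qo e ξ (toX v) - r • post (L.massInv ξ) (toX φ) := by
  set γ := toX (L.elGrad ξ (qo ξ + v)) with hγ
  have hkin : projX e (post (L.massM ξ) (toX (dL (dL v)))) =
      kinProj e (post (L.massM ξ) (toX v)) := by
    rw [projX_apply, kinProj_apply]
    refine Finset.sum_congr rfl fun i _ => ?_
    rw [ip_comm, massM, ip_toX_post, ← ip_post_diag, ip_comm]
  have hM : post (L.massM ξ) (L.lsField qo e ξ (toX v)) = L.nem qo ξ (toX v) -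
      projX e (L.nem qo ξ (toX v)) + kinProj e (post (L.massM ξ) (toX v)) + projX e (toX v) :=
    L.post_massM_massInv hξ _
  have hsum : γ - projX e γ + projX e (toX v) = post (L.massM ξ)
      (L.lsField qo e ξ (toX v) - toX (dL (dL v))) := by
    rw [map_sub, hM, ← hkin, hγ, toX_elGrad hqo hξ hv, map_add, map_neg]
    abel
  have hφK := he.projX_toX (u := φ) hφ
  constructor
  · rintro ⟨-, hg, hp⟩
    have h1 : projX e γ = γ := he.projX_toX hg
    rw [h1, sub_self, zero_add, hp] at hsum
    have h2 := congrArg (post (L.massInv ξ)) hsum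
    rw [L.post_massInv_massM hξ, map_smul] at h2
    rw [h2]; abel
  · intro h
    have h2 : γ - projX e γ + projX e (toX v) = r • toX φ := by
      rw [hsum, h, sub_sub_cancel, map_smul, L.post_massM_massInv hξ]
    have h3 : projX e (toX v) = r • toX φ := by
      have := congrArg (projX e) h2
      rw [map_add, map_sub, he.projX_projX, he.projX_projX, sub_self, zero_add, map_smul, hφK] at this
      exact this
    refine ⟨hv, ?_, h3⟩
    rw [h3, add_eq_right, sub_eq_zero, hγ, ← toX_projL] at h2
    rw [toX_injective h2]
    exact he.projL_mem _

theorem lsMap_eq_iff {φ : PerFun N} {r : ℝ} {u : PerFun N} :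
    L.lsMap qo e ξ u = r • green N (post (L.massInv ξ) φ) ↔
      ∃ v, IsDeriv u v ∧ IsDeriv v (L.lsField qo e ξ u - r • post (L.massInv ξ) φ) := by
  rw [← eq_green_iff, lsMap, sub_eq_iff_eq_add, ← map_smul, ← map_add]
  have : r • post (L.massInv ξ) φ + (constL N (u ((0 : ℝ) : AddCircle (1 : ℝ))) -
      L.lsField qo e ξ u) = constL N (u ((0 : ℝ) : AddCircle (1 : ℝ))) -
      (L.lsField qo e ξ u - r • post (L.massInv ξ) φ) := by abel
  rw [this]

theorem IsReducedSol.lsMap_eq (hqo : L.IsSolutionFamily qo) (hξ₀ : ξ₀ ∈ L.param) (hξ : ξ ∈ L.param)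
    (he : IsOrthoBasis (L.hessKer hξ₀ (hqo.inside hξ₀)) e) {φ : Loop N}
    (hφ : L.hessLoop ξ₀ (qo ξ₀) φ = 0) {r : ℝ} {v : Loop N} (h : L.IsReducedSol qo e ξ₀ φ ξ r v) :
    L.lsMap qo e ξ (toX v) = r • green N (post (L.massInv ξ) (toX φ)) := by
  refine lsMap_eq_iff.2 ⟨toX (dL v), v.isDeriv_toX, ?_⟩
  rw [← (isReducedSol_iff hqo hξ₀ hξ he hφ h.inside).1 h]
  exact (dL v).isDeriv_toX

theorem exists_isReducedSol (hqo : L.IsSolutionFamily qo) (hξ₀ : ξ₀ ∈ L.param) (hξ : ξ ∈ L.param)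
    (he : IsOrthoBasis (L.hessKer hξ₀ (hqo.inside hξ₀)) e) {φ : Loop N}
    (hφ : L.hessLoop ξ₀ (qo ξ₀) φ = 0) {r : ℝ} {u : PerFun N}
    (hu : ∀ s : ℝ, (qo ξ).1 s + u (s : AddCircle (1 : ℝ)) ∈ L.dom)
    (h : L.lsMap qo e ξ u = r • green N (post (L.massInv ξ) (toX φ))) :
    ∃ v : Loop N, toX v = u ∧ L.IsReducedSol qo e ξ₀ φ ξ r v := by
  obtain ⟨u', h1, h2⟩ := lsMap_eq_iff.1 h
  -- All nonlocal terms of the equation, gathered into one smooth loop; what remains depends on u(s)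
  -- pointwise, so regularity theory applies.
  set k : Loop N := - ∑ i, ip N (toX (e i)) (L.nem qo ξ u) • e i +
    ∑ i, ip N (toX (dL (dL (e i)))) (post (L.massM ξ) u) • e i +
    ∑ i, ip N (toX (e i)) u • e i - r • φ with hk
  have hkX : toX k = - projX e (L.nem qo ξ u) + kinProj e (post (L.massM ξ) u) + projX e u -
      r • toX φ := by
    rw [hk]
    simp only [map_sub, map_add, map_neg, map_sum, map_smul, projX_apply, kinProj_apply]
  have hfield : L.lsField qo e ξ u - r • post (L.massInv ξ) (toX φ) =
      post (L.massInv ξ) (L.nem qo ξ u + toX k) := by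
    rw [lsField, ← map_smul, ← map_sub, hkX]
    congr 1
    abel
  set O : Set (ℝ × Config N) := {p | (qo ξ).1 p.1 + p.2 ∈ L.dom} with hO
  have hΘ : ContDiffOn ℝ ∞ (fun p : ℝ × Config N => L.massInv ξ
      (gradient (L.pot ξ) ((qo ξ).1 p.1 + p.2) - gradient (L.pot ξ) ((qo ξ).1 p.1) + k.1 p.1)) O := by
    refine (L.massInv ξ).contDiff.comp_contDiffOn (ContDiffOn.add (ContDiffOn.sub ?_ ?_) ?_)
    · exact L.contDiffOn_gradient.comp (t := L.param ×ˢ L.dom)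
        (f := fun p : ℝ × Config N => (ξ, (qo ξ).1 p.1 + p.2))
        (contDiff_const.prodMk (((qo ξ).2.1.comp contDiff_fst).add contDiff_snd)).contDiffOn
        fun p hp => ⟨hξ, hp⟩
    · exact ((L.contDiff_comp_curve L.contDiffOn_gradient hξ (hqo.inside hξ)).comp
        contDiff_fst).contDiffOn
    · exact (k.2.1.comp contDiff_fst).contDiffOn
  obtain ⟨v, rfl, -, hv⟩ := exists_toX_eq h1 h2 hΘ hu (fun s => by
    rw [hfield, post_apply, ContinuousMap.add_apply, nem_apply hqo hξ hu, toX_apply])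
  exact ⟨v, rfl, (isReducedSol_iff hqo hξ₀ hξ he hφ hu).2 hv⟩

end LagrangianFamily

/-! ### The branch of solutions of the projected equation -/

namespace LagrangianFamily

open PerFun Loop

variable {N : ℕ}

/-- `u ξ r` is the family of the solutions of the projected equations near `(ξ₀, 0)`, unique in a
`C⁰` ball of radius `δ`. -/
structure IsBranch (L : LagrangianFamily N) (qo : ℝ → Loop N) {n : ℕ} (e : Fin n → Loop N) (ξ₀ : ℝ)
    (φ : Loop N) (C δ η : ℝ) (u : ℝ → ℝ → Loop N) : Prop where
  C_pos : 0 < C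
  δ_pos : 0 < δ
  η_pos : 0 < η
  mem_param : ∀ {ξ}, |ξ - ξ₀| < η → ξ ∈ L.param
  sol : ∀ {ξ r}, |ξ - ξ₀| < η → |r| < η → L.IsReducedSol qo e ξ₀ φ ξ r (u ξ r)
  norm_lt : ∀ {ξ r}, |ξ - ξ₀| < η → |r| < η → ‖toX (u ξ r)‖ < δ
  unique : ∀ {ξ r v}, |ξ - ξ₀| < η → |r| < η → ‖toX v‖ < δ → L.IsReducedSol qo e ξ₀ φ ξ r v →
    v = u ξ r
  norm_sub_le : ∀ {ξ r r'}, |ξ - ξ₀| < η → |r| < η → |r'| < η →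
    ‖toX (u ξ r - u ξ r')‖ ≤ C * |r - r'|
  norm_deriv_sub_le : ∀ {ξ r r'}, |ξ - ξ₀| < η → |r| < η → |r'| < η →
    ‖toX (dL (u ξ r - u ξ r'))‖ ≤ C * |r - r'|
  continuousAt : ∀ {ξ r}, |ξ - ξ₀| < η → |r| < η → ContinuousAt (fun ξ => toX (u ξ r)) ξ
  direction : ∀ ε > 0, ∃ η' > 0, ∀ ξ r, |ξ - ξ₀| < η' → |r| < η' →
    C1Le (u ξ r - r • φ) (ε * |r|)
  quadratic : ∃ K, ∃ η' > 0, ∀ r, |r| < η' → C1Le (u ξ₀ r - r • φ) (K * r ^ 2)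

variable {L : LagrangianFamily N} {qo : ℝ → Loop N} {n : ℕ} {e : Fin n → Loop N} {ξ ξ₀ : ℝ}

/-- Because φ is its own projection, adding and subtracting it shows that r φ solves the linearized
projected equation with amplitude r. -/
theorem toX_dL_dL_of_hessLoop_eq_zero (hξ₀ : ξ₀ ∈ L.param) {q : Loop N} (hq : L.Inside q)
    (he : IsOrthoBasis (L.hessKer hξ₀ hq) e) {φ : Loop N} (hφ : L.hessLoop ξ₀ q φ = 0) :
    toX (dL (dL φ)) = lsLin hξ₀ hq e (toX φ) - post (L.massInv ξ₀) (toX φ) := by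
  have h2 := L.toX_hessLoop hξ₀ hq φ
  rw [hφ, map_zero, eq_comm, neg_add_eq_zero] at h2
  have h3 := he.projX_toX (u := φ) hφ
  change _ = post (L.massInv ξ₀) (mulOp (L.potHess hξ₀ hq) (toX φ) + projX e (toX φ)) - _
  rw [h3, map_add, add_sub_cancel_right, ← h2, L.post_massInv_massM hξ₀]

-- Existence, uniqueness and the C⁰ Lipschitz bound come from `exists_solution_family`. The
-- differential equation turns C⁰ bounds into bounds on second derivatives, and `IsDeriv.norm_le`
-- into bounds on first derivatives. For the asymptotics r φ is used as an approximate solution: its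
-- distance to the branch is at most a multiple of its defect E, which is o(r), and O(r²) at ξ₀.
set_option maxHeartbeats 1000000 in
theorem exists_isBranch (hqo : L.IsSolutionFamily qo) (hξ₀ : ξ₀ ∈ L.param)
    (he : IsOrthoBasis (L.hessKer hξ₀ (hqo.inside hξ₀)) e) {φ : Loop N}
    (hφ : L.hessLoop ξ₀ (qo ξ₀) φ = 0) :
    ∃ C δ η u, L.IsBranch qo e ξ₀ φ C δ η u := by
  classical
  obtain ⟨D, hD⟩ := L.exists_linearized_equiv hξ₀ (hqo.inside hξ₀) he
  set Λ := lsLin hξ₀ (hqo.inside hξ₀) e with hΛ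
  have hmem := L.isOpen_param.mem_nhds hξ₀
  have hcI : ContinuousAt (fun ξ => post (L.massInv ξ) (toX φ)) ξ₀ :=
    (continuous_post.continuousAt.comp (L.continuousOn_massInv.continuousAt hmem)).clm_apply
      continuousAt_const
  obtain ⟨δ₁, hδ₁, h₁⟩ := exists_lsField_approx hqo hξ₀ he one_pos
  obtain ⟨δ₂, hδ₂, h₂⟩ := exists_nem_approx hqo hξ₀ one_pos
  obtain ⟨Cq, hCq, δ₃, hδ₃, h₃⟩ := exists_lsField_quadratic hqo hξ₀ he
  obtain ⟨C, hC, δ, hδ, hδ', η, hη, hmain⟩ := exists_solution_family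
    (F := L.lsMap qo e) (D := D) (b := fun ξ => green N (post (L.massInv ξ) (toX φ))) (ξ₀ := ξ₀)
    (fun ε hε => by
      obtain ⟨d, hd, h⟩ := exists_lsField_approx hqo hξ₀ he
        (ε := ε / (‖green N‖ + 1)) (by positivity)
      refine ⟨d, hd, fun ξ hξ u u' hu hu' => ?_⟩
      rw [lsMap_sub hξ₀ (hqo.inside hξ₀) hD]
      refine ((green N).le_opNorm _).trans ((mul_le_mul_of_nonneg_left (h ξ hξ u u' hu hu')
        (norm_nonneg _)).trans ?_)
      rw [← mul_assoc]
      refine mul_le_mul_of_nonneg_right ?_ (norm_nonneg _)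
      rw [mul_div_assoc', div_le_iff₀ (by positivity)]
      nlinarith)
    (by
      filter_upwards [hmem] with ξ hξ
      simp [lsMap, lsField_zero hqo hξ])
    ((green N).continuous.continuousAt.comp hcI) (lt_min hδ₁ hδ₂)
  obtain ⟨η₁, hη₁, hbd⟩ := Metric.eventually_nhds_iff.1
    (hcI.norm.eventually (gt_mem_nhds (lt_add_one ‖post (L.massInv ξ₀) (toX φ)‖)))
  set B := ‖post (L.massInv ξ₀) (toX φ)‖ + 1 with hB
  have hB0 : 0 < B := by positivity
  set η₀ := min (min η η₁) (min δ₁ δ₂) with hη₀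
  have hle1 : η₀ ≤ η := (min_le_left _ _).trans (min_le_left _ _)
  have hle2 : η₀ ≤ η₁ := (min_le_left _ _).trans (min_le_right _ _)
  have hle3 : η₀ ≤ δ₁ := (min_le_right _ _).trans (min_le_left _ _)
  have hle4 : η₀ ≤ δ₂ := (min_le_right _ _).trans (min_le_right _ _)
  have hδ1 : δ ≤ δ₁ := hδ'.trans (min_le_left _ _)
  have hδ2 : δ ≤ δ₂ := hδ'.trans (min_le_right _ _)
  have hη₀pos : 0 < η₀ := by positivity
  have hpar : ∀ ξ, |ξ - ξ₀| < η₀ → ξ ∈ L.param := fun ξ hξ => (h₂ ξ (hξ.trans_le hle4)).1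
  have hex : ∀ ξ r, |ξ - ξ₀| < η₀ → |r| < η₀ →
      ∃ v : Loop N, ‖toX v‖ < δ ∧ L.IsReducedSol qo e ξ₀ φ ξ r v := by
    intro ξ r hξ hr
    obtain ⟨u, hu, hFu⟩ := (hmain ξ (hξ.trans_le hle1)).2 r (hr.trans_le hle1)
    obtain ⟨v, rfl, hv⟩ := exists_isReducedSol hqo hξ₀ (hpar ξ hξ) he hφ
      ((h₂ ξ (hξ.trans_le hle4)).2.1 u (hu.trans_le hδ2)) hFu
    exact ⟨v, hu, hv⟩
  choose! u hu using hex
  -- constants for the comparison of second derivatives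
  set K := ‖Λ‖ + 1 with hK
  have hlip : ∀ ξ, |ξ - ξ₀| < η₀ → ∀ v v' : PerFun N, ‖v‖ < δ₁ → ‖v'‖ < δ₁ →
      ‖L.lsField qo e ξ v - L.lsField qo e ξ v'‖ ≤ K * ‖v - v'‖ := by
    intro ξ hξ v v' hv hv'
    have h4 := h₁ ξ (hξ.trans_le hle3) v v' hv hv'
    have h5 := norm_le_insert' (L.lsField qo e ξ v - L.lsField qo e ξ v') (Λ (v - v'))
    have h6 := Λ.le_opNorm (v - v')
    rw [hK]
    linarith
  have hLip : ∀ ξ r r', |ξ - ξ₀| < η₀ → |r| < η₀ → |r'| < η₀ →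
      ‖toX (u ξ r - u ξ r')‖ ≤ C * (‖green N‖ * B) * |r - r'| := by
    intro ξ r r' hξ hr hr'
    obtain ⟨h4, h5⟩ := hu ξ r hξ hr
    obtain ⟨h6, h7⟩ := hu ξ r' hξ hr'
    have h8 := (hmain ξ (hξ.trans_le hle1)).1 _ _ h4 h6
    rw [h5.lsMap_eq hqo hξ₀ (hpar ξ hξ) he hφ, h7.lsMap_eq hqo hξ₀ (hpar ξ hξ) he hφ,
      ← sub_smul r r' (green N (post (L.massInv ξ) (toX φ))), norm_smul, Real.norm_eq_abs] at h8
    rw [map_sub]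
    have h9 : ‖green N (post (L.massInv ξ) (toX φ))‖ ≤ ‖green N‖ * B :=
      ((green N).le_opNorm _).trans (mul_le_mul_of_nonneg_left
        (hbd (y := ξ) (by rw [Real.dist_eq]; exact hξ.trans_le hle2)).le (norm_nonneg _))
    refine h8.trans ?_
    rw [mul_assoc, mul_comm (‖green N‖ * B)]
    exact mul_le_mul_of_nonneg_left (mul_le_mul_of_nonneg_left h9 (abs_nonneg _)) hC.le
  have hode : ∀ ξ r, |ξ - ξ₀| < η₀ → |r| < η₀ → toX (dL (dL (u ξ r))) =
      L.lsField qo e ξ (toX (u ξ r)) - r • post (L.massInv ξ) (toX φ) := fun ξ r hξ hr =>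
    (isReducedSol_iff hqo hξ₀ (hpar ξ hξ) he hφ (hu ξ r hξ hr).2.inside).1 (hu ξ r hξ hr).2
  -- the deviation from `r φ`
  set E : ℝ → ℝ → PerFun N := fun ξ r => L.lsField qo e ξ (toX (r • φ)) - Λ (toX (r • φ)) -
    r • (post (L.massInv ξ) (toX φ) - post (L.massInv ξ₀) (toX φ)) with hE
  obtain ⟨η₂, hη₂, hsmall⟩ : ∃ η₂ > 0, ∀ r : ℝ, |r| < η₂ → ‖toX (r • φ)‖ < δ ∧
      ‖toX (r • φ)‖ < δ₃ := by
    have : ContinuousAt (fun r : ℝ => ‖r • toX φ‖) 0 := by fun_prop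
    have h0 : ‖(0 : ℝ) • toX φ‖ = 0 := by rw [zero_smul ℝ (toX φ), norm_zero]
    obtain ⟨η₂, hη₂, h⟩ := Metric.eventually_nhds_iff.1
      (this.eventually (gt_mem_nhds (show ‖(0 : ℝ) • toX φ‖ < min δ δ₃ by
        rw [h0]; positivity)))
    refine ⟨η₂, hη₂, fun r hr => ?_⟩
    have := h (y := r) (by rwa [Real.dist_eq, sub_zero])
    rw [map_smul]
    exact lt_min_iff.1 this
  have hφ2 : ∀ r : ℝ, toX (dL (dL (r • φ))) = Λ (toX (r • φ)) -
      r • post (L.massInv ξ₀) (toX φ) := fun r => by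
    have h4 : dL (dL (r • φ)) = r • dL (dL φ) := by rw [map_smul, map_smul]
    rw [h4, map_smul, map_smul, map_smul,
      toX_dL_dL_of_hessLoop_eq_zero hξ₀ (hqo.inside hξ₀) he hφ, smul_sub r]
  -- The first summand bounds the deviation itself. The second bounds its derivative by 4 times the
  -- second derivative, where K is the Lipschitz constant of `lsField` and 1 accounts for E.
  set C₂ := C * ‖green N‖ + 4 * (K * (C * ‖green N‖) + 1) with hC₂
  have hdev : ∀ ξ r, |ξ - ξ₀| < η₀ → |r| < η₀ → |r| < η₂ →
      C1Le (u ξ r - r • φ) (C₂ * ‖E ξ r‖) := by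
    intro ξ r hξ hr hr2
    obtain ⟨h4, h5⟩ := hu ξ r hξ hr
    have h6 := (hsmall r hr2).1
    have h8 := (hmain ξ (hξ.trans_le hle1)).1 _ _ h4 h6
    -- By `hφ2` the linear parts cancel, so the defect contains only the nonlinear remainder and the
    -- change of the masses and the period with ξ.
    have hF : L.lsMap qo e ξ (toX (u ξ r)) - L.lsMap qo e ξ (toX (r • φ)) = - green N (E ξ r) := by
      rw [h5.lsMap_eq hqo hξ₀ (hpar ξ hξ) he hφ, lsMap]
      have h9 := (eq_green_iff (u := toX (r • φ)) (z := toX (dL (dL (r • φ))))).2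
        ⟨_, isDeriv_toX _, isDeriv_toX _⟩
      have h10 : toX (r • φ) - green N (constL N ((toX (r • φ)) ((0 : ℝ) : AddCircle (1 : ℝ))) -
          L.lsField qo e ξ (toX (r • φ))) = green N (L.lsField qo e ξ (toX (r • φ)) -
            toX (dL (dL (r • φ)))) := by
        nth_rewrite 1 [h9]
        rw [← map_sub]
        congr 1
        abel
      rw [h10, ← map_smul, ← map_sub, ← map_neg]
      congr 1
      rw [hφ2, hE]
      simp only []
      rw [smul_sub r]
      abel
    rw [hF, norm_neg] at h8
    have hw : ‖toX (u ξ r - r • φ)‖ ≤ C * ‖green N‖ * ‖E ξ r‖ := by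
      rw [map_sub, mul_assoc]
      exact h8.trans (mul_le_mul_of_nonneg_left ((green N).le_opNorm _) hC.le)
    have hw2 : toX (dL (dL (u ξ r - r • φ))) = L.lsField qo e ξ (toX (u ξ r)) -
        L.lsField qo e ξ (toX (r • φ)) + E ξ r := by
      rw [map_sub dL, map_sub dL, map_sub toX, hode ξ r hξ hr, hφ2, hE]
      simp only []
      rw [smul_sub r]
      abel
    have h11 : ‖toX (dL (dL (u ξ r - r • φ)))‖ ≤ (K * (C * ‖green N‖) + 1) * ‖E ξ r‖ := by
      rw [hw2]
      refine (norm_add_le _ _).trans ?_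
      have := hlip ξ hξ _ _ (h4.trans_le hδ1) (h6.trans_le hδ1)
      rw [← map_sub] at this
      have h12 : K * ‖toX (u ξ r - r • φ)‖ ≤ K * (C * ‖green N‖ * ‖E ξ r‖) :=
        mul_le_mul_of_nonneg_left hw (by positivity)
      linarith
    have h13 := (isDeriv_toX (u ξ r - r • φ)).norm_le (isDeriv_toX _)
    have hE0 := norm_nonneg (E ξ r)
    have hK0 : 0 ≤ K * (C * ‖green N‖) := by positivity
    have hG0 : 0 ≤ C * ‖green N‖ := by positivity
    refine (c1Le_iff (by positivity)).2 ⟨hw.trans ?_, h13.trans ?_⟩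
    · exact mul_le_mul_of_nonneg_right (by rw [hC₂]; linarith) hE0
    · have : C₂ * ‖E ξ r‖ = C * ‖green N‖ * ‖E ξ r‖ +
          4 * ((K * (C * ‖green N‖) + 1) * ‖E ξ r‖) := by rw [hC₂]; ring
      have := mul_nonneg hG0 hE0
      linarith
  have hC₂0 : 0 < C₂ := by
    have hK0 : 0 ≤ K * (C * ‖green N‖) := by positivity
    have hG0 : 0 ≤ C * ‖green N‖ := by positivity
    rw [hC₂]; positivity
  -- Built like `C₂`, with B bounding the inhomogeneity M⁻¹ φ.
  set C₁ := C * (‖green N‖ * B) + 4 * (K * (C * (‖green N‖ * B)) + B) with hC₁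
  have hG0 : 0 ≤ C * (‖green N‖ * B) := by positivity
  have hK0 : 0 ≤ K * (C * (‖green N‖ * B)) := by positivity
  refine ⟨C₁, δ, η₀, u, by rw [hC₁]; positivity, hδ, hη₀pos, fun {ξ} hξ => hpar ξ hξ,
    fun {ξ r} hξ hr => (hu ξ r hξ hr).2, fun {ξ r} hξ hr => (hu ξ r hξ hr).1, ?_, ?_, ?_, ?_, ?_, ?_⟩
  · intro ξ r v hξ hr hv hsol
    obtain ⟨h4, h5⟩ := hu ξ r hξ hr
    have h8 := (hmain ξ (hξ.trans_le hle1)).1 _ _ hv h4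
    rw [hsol.lsMap_eq hqo hξ₀ (hpar ξ hξ) he hφ, h5.lsMap_eq hqo hξ₀ (hpar ξ hξ) he hφ, sub_self,
      norm_zero, mul_zero] at h8
    exact toX_injective (sub_eq_zero.1 (norm_le_zero_iff.1 h8))
  · intro ξ r r' hξ hr hr'
    refine (hLip ξ r r' hξ hr hr').trans (mul_le_mul_of_nonneg_right ?_ (abs_nonneg _))
    rw [hC₁]; linarith
  · intro ξ r r' hξ hr hr'
    refine ((isDeriv_toX (u ξ r - u ξ r')).norm_le (isDeriv_toX _)).trans ?_
    have h4 : toX (dL (dL (u ξ r - u ξ r'))) = L.lsField qo e ξ (toX (u ξ r)) -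
        L.lsField qo e ξ (toX (u ξ r')) - (r - r') • post (L.massInv ξ) (toX φ) := by
      rw [map_sub dL, map_sub dL, map_sub toX, hode ξ r hξ hr, hode ξ r' hξ hr',
        sub_smul r r' (post (L.massInv ξ) (toX φ))]
      abel
    have h5 := hlip ξ hξ _ _ ((hu ξ r hξ hr).1.trans_le hδ1) ((hu ξ r' hξ hr').1.trans_le hδ1)
    rw [← map_sub] at h5
    have h6 := mul_le_mul_of_nonneg_left (hLip ξ r r' hξ hr hr') (show 0 ≤ K by positivity)
    have h7 : ‖(r - r') • post (L.massInv ξ) (toX φ)‖ ≤ B * |r - r'| := by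
      rw [norm_smul, Real.norm_eq_abs, mul_comm]
      exact mul_le_mul_of_nonneg_right
        (hbd (y := ξ) (by rw [Real.dist_eq]; exact hξ.trans_le hle2)).le (abs_nonneg _)
    have h8 : ‖toX (dL (dL (u ξ r - u ξ r')))‖ ≤
        (K * (C * (‖green N‖ * B)) + B) * |r - r'| := by
      rw [h4]
      refine (norm_sub_le _ _).trans ?_
      linarith
    have h9 := mul_nonneg hG0 (abs_nonneg (r - r'))
    have h10 : C₁ * |r - r'| = C * (‖green N‖ * B) * |r - r'| +
        4 * ((K * (C * (‖green N‖ * B)) + B) * |r - r'|) := by rw [hC₁]; ring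
    linarith
  · intro ξ r hξ hr
    set v := toX (u ξ r) with hv
    have hnear : ∀ᶠ ξ' in 𝓝 ξ, |ξ' - ξ₀| < η₀ :=
      (isOpen_lt (by fun_prop) continuous_const).mem_nhds hξ
    have hcont := continuousAt_lsMap (e := e) hqo (hpar ξ hξ)
      ((h₂ ξ (hξ.trans_le hle4)).2.1 v ((hu ξ r hξ hr).1.trans_le hδ2))
    have hcI' : ContinuousAt (fun ξ => r • green N (post (L.massInv ξ) (toX φ))) ξ :=
      (continuous_const_smul r).continuousAt.comp ((green N).continuous.continuousAt.comp
        ((continuous_post.continuousAt.comp (L.continuousOn_massInv.continuousAt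
          (L.isOpen_param.mem_nhds (hpar ξ hξ)))).clm_apply continuousAt_const))
    -- The solution v at ξ is inserted in the equation at ξ'; its residual tends to 0, and the
    -- uniform Lipschitz bound of the inverse turns this into convergence of the solutions.
    have h5 : Tendsto (fun ξ' => C * ‖r • green N (post (L.massInv ξ') (toX φ)) -
        L.lsMap qo e ξ' v‖) (𝓝 ξ) (𝓝 0) := by
      have h6 : Tendsto (fun ξ' => C * ‖r • green N (post (L.massInv ξ') (toX φ)) -
          L.lsMap qo e ξ' v‖) (𝓝 ξ) (𝓝 (C * ‖r • green N (post (L.massInv ξ) (toX φ)) -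
          L.lsMap qo e ξ v‖)) := (hcI'.sub hcont).norm.const_mul C
      have h7 : C * ‖r • green N (post (L.massInv ξ) (toX φ)) - L.lsMap qo e ξ v‖ = 0 := by
        rw [(hu ξ r hξ hr).2.lsMap_eq hqo hξ₀ (hpar ξ hξ) he hφ, sub_self, norm_zero, mul_zero]
      rwa [h7] at h6
    refine tendsto_iff_norm_sub_tendsto_zero.2 (squeeze_zero' (Eventually.of_forall fun _ =>
      norm_nonneg _) ?_ h5)
    filter_upwards [hnear] with ξ' hξ'
    rw [← (hu ξ' r hξ' hr).2.lsMap_eq hqo hξ₀ (hpar ξ' hξ') he hφ]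
    exact (hmain ξ' (hξ'.trans_le hle1)).1 _ _ (hu ξ' r hξ' hr).1 (hu ξ r hξ hr).1
  · intro ε hε
    set ε' := ε / (C₂ * (‖toX φ‖ + 1)) with hε'
    have hε'0 : 0 < ε' := by positivity
    obtain ⟨d, hd, h⟩ := exists_lsField_approx hqo hξ₀ he hε'0
    obtain ⟨d', hd', hI⟩ := Metric.eventually_nhds_iff.1
      (hcI.eventually (Metric.ball_mem_nhds _ hε'0))
    obtain ⟨d₂, hd₂, hs⟩ : ∃ d₂ > 0, ∀ r : ℝ, |r| < d₂ → ‖toX (r • φ)‖ < d := by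
      refine ⟨d / (‖toX φ‖ + 1), by positivity, fun r hr => ?_⟩
      rw [lt_div_iff₀ (by positivity)] at hr
      rw [map_smul, norm_smul, Real.norm_eq_abs]
      nlinarith [abs_nonneg r]
    refine ⟨min (min η₀ η₂) (min (min d d') d₂), by positivity, fun ξ r hξ hr => ?_⟩
    simp only [lt_min_iff] at hξ hr
    refine (fun s => ?_)
    have h4 := hdev ξ r hξ.1.1 hr.1.1 hr.1.2 s
    have h5 := h ξ hξ.2.1.1 (toX (r • φ)) 0 (hs r hr.2.2) (by rw [norm_zero]; exact hd)
    rw [lsField_zero hqo (hpar ξ hξ.1.1)] at h5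
    simp only [sub_zero] at h5
    have h6 : ‖post (L.massInv ξ) (toX φ) - post (L.massInv ξ₀) (toX φ)‖ < ε' :=
      lt_of_eq_of_lt (dist_eq_norm _ _).symm (hI (y := ξ) (by rw [Real.dist_eq]; exact hξ.2.1.2))
    have h7 : ‖E ξ r‖ ≤ ε' * (‖toX φ‖ + 1) * |r| := by
      refine (norm_sub_le _ _).trans ?_
      rw [norm_smul, Real.norm_eq_abs]
      rw [map_smul toX, norm_smul, Real.norm_eq_abs] at h5
      rw [map_smul toX]
      have h9 := mul_le_mul_of_nonneg_left h6.le (abs_nonneg r)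
      linarith
    have h8 : C₂ * ‖E ξ r‖ ≤ ε * |r| := by
      refine (mul_le_mul_of_nonneg_left h7 hC₂0.le).trans_eq ?_
      rw [hε']
      field_simp
    exact ⟨h4.1.trans h8, h4.2.trans h8⟩
  · refine ⟨C₂ * (Cq * ‖toX φ‖ ^ 2), min η₀ η₂, by positivity, fun r hr s => ?_⟩
    rw [lt_min_iff] at hr
    have h4 := hdev ξ₀ r (by rw [sub_self, abs_zero]; exact hη₀pos) hr.1 hr.2 s
    have h5 := h₃ (toX (r • φ)) (hsmall r hr.2).2
    have h8 : C₂ * ‖E ξ₀ r‖ ≤ C₂ * (Cq * ‖toX φ‖ ^ 2) * r ^ 2 := by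
      rw [mul_assoc]
      refine mul_le_mul_of_nonneg_left ?_ hC₂0.le
      have : E ξ₀ r = L.lsField qo e ξ₀ (toX (r • φ)) - Λ (toX (r • φ)) := by
        rw [hE]
        simp only [sub_self]
        rw [smul_zero r, sub_zero]
      rw [this]
      refine h5.trans_eq ?_
      rw [map_smul toX, norm_smul, Real.norm_eq_abs, mul_pow, sq_abs]
      ring
    exact ⟨h4.1.trans h8, h4.2.trans h8⟩

end LagrangianFamily

/-! ### Quadratic form bounds and the averaging projector -/

namespace PerFun

variable {N : ℕ}

theorem ip_nonneg {u v : PerFun N} (h : ∀ s : ℝ, 0 ≤ inner ℝ (u (s : AddCircle (1 : ℝ)))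
    (v (s : AddCircle (1 : ℝ)))) : 0 ≤ ip N u v :=
  intervalIntegral.integral_nonneg zero_le_one fun s _ => h s

theorem neg_le_ip_mulOp (V : C(AddCircle (1 : ℝ), Config N →L[ℝ] Config N)) (u : PerFun N) :
    - (‖V‖ * ip N u u) ≤ ip N (mulOp V u) u := by
  have h : 0 ≤ ip N (mulOp V u + ‖V‖ • u) u := ip_nonneg fun s => by
    change 0 ≤ inner ℝ (V s (u s) + ‖V‖ • u s) (u s)
    rw [inner_add_left, real_inner_smul_left, real_inner_self_eq_norm_sq]
    have h1 := abs_le.1 (abs_real_inner_le_norm (V s (u s)) (u s))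
    have h2 := ((V s).le_opNorm (u s)).trans
      (mul_le_mul_of_nonneg_right (V.norm_coe_le_norm s) (norm_nonneg _))
    nlinarith [norm_nonneg (u s)]
  rw [map_add, map_smul] at h
  simp only [add_apply, smul_apply, smul_eq_mul] at h
  linarith

theorem le_ip_post_diag {c : Fin N → ℝ} {m : ℝ} (h : ∀ i, m ≤ c i) (u : PerFun N) :
    m * ip N u u ≤ ip N (post (diag c) u) u := by
  have h : 0 ≤ ip N (post (diag c) u + (-m) • u) u := ip_nonneg fun s => by
    change 0 ≤ inner ℝ (diag c (u s) + (-m) • u s) (u s)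
    rw [PiLp.inner_apply]
    refine Finset.sum_nonneg fun i _ => ?_
    simp only [PiLp.add_apply, PiLp.smul_apply, diag_apply, smul_eq_mul]
    change 0 ≤ u s i * (c i * u s i + -m * u s i)
    nlinarith [mul_nonneg (sub_nonneg.2 (h i)) (sq_nonneg (u s i))]
  rw [map_add, map_smul] at h
  simp only [add_apply, smul_apply, smul_eq_mul] at h
  linarith

end PerFun

section GroupProj

open PerFun Loop

variable {N : ℕ} {G : Type*} [Group G] [Fintype G] (ρ : Representation ℝ G (Loop N))

theorem groupProj_apply (u : Loop N) :
    groupProj ρ u = (Fintype.card G : ℝ)⁻¹ • ∑ g : G, ρ g u := by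
  simp [groupProj]

theorem rho_groupProj (g : G) (u : Loop N) : ρ g (groupProj ρ u) = groupProj ρ u := by
  rw [groupProj_apply, map_smul, map_sum]
  congr 1
  refine Fintype.sum_equiv (Equiv.mulLeft g) _ _ fun h => ?_
  rw [Equiv.coe_mulLeft, map_mul]
  rfl

theorem groupProj_eq_iff {u : Loop N} : groupProj ρ u = u ↔ ∀ g, ρ g u = u := by
  constructor
  · intro h g
    rw [← h, rho_groupProj]
  · intro h
    rw [groupProj_apply]
    simp only [h, Finset.sum_const, Finset.card_univ]
    rw [← Nat.cast_smul_eq_nsmul ℝ, inv_smul_smul₀ (by simp)]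

theorem groupProj_groupProj (u : Loop N) : groupProj ρ (groupProj ρ u) = groupProj ρ u :=
  (groupProj_eq_iff ρ).2 fun g => rho_groupProj ρ g u

end GroupProj

/-! ### Equivariance and invariance of the branch -/

namespace LagrangianFamily

open PerFun Loop

variable {N : ℕ} {L : LagrangianFamily N} {qo : ℝ → Loop N} {n : ℕ} {e : Fin n → Loop N} {ξ ξ₀ : ℝ}

/-- The kinetic part of the gradient is linear, so only `nem` has to be linearized. This weak form
lets identities for the gradient be differentiated into identities for the Hessian. -/
theorem hasDerivAt_ip_elGrad (hqo : L.IsSolutionFamily qo) (hξ : ξ ∈ L.param) (u v : Loop N) :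
    HasDerivAt (fun ε : ℝ => ip N (toX (L.elGrad ξ (qo ξ + ε • u))) (toX v))
      (ip N (toX (L.hessLoop ξ (qo ξ) u)) (toX v)) 0 := by
  rw [hasDerivAt_iff_isLittleO, isLittleO_iff]
  intro c hc
  set B := ‖toX u‖ * ‖toX v‖ + ‖toX u‖ + 1 with hB
  have hB0 : 0 < B := by positivity
  obtain ⟨δ, hδ, h⟩ := exists_nem_approx hqo hξ (ε := c / B) (by positivity)
  obtain ⟨-, hin, happ⟩ := h ξ (by simpa using hδ)
  filter_upwards [Metric.ball_mem_nhds (0 : ℝ) (show 0 < δ / B by positivity)] with t ht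
  rw [mem_ball_zero_iff, Real.norm_eq_abs, lt_div_iff₀ hB0] at ht
  have hsm : ‖toX (t • u)‖ < δ := by
    rw [map_smul, norm_smul, Real.norm_eq_abs]
    have : 0 ≤ ‖toX u‖ * ‖toX v‖ := by positivity
    nlinarith [abs_nonneg t]
  have h1 := happ (toX (t • u)) 0 hsm (by simpa using hδ)
  rw [nem_zero hqo hξ, sub_zero, sub_zero] at h1
  have h2 := toX_elGrad (v := t • u) hqo hξ (hin _ hsm)
  have h3 : toX (L.elGrad ξ (qo ξ + t • u)) - t • toX (L.hessLoop ξ (qo ξ) u) =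
      L.nem qo ξ (toX (t • u)) - mulOp (L.potHess hξ (hqo.inside hξ)) (toX (t • u)) := by
    rw [h2, L.toX_hessLoop hξ (hqo.inside hξ)]
    simp only [map_smul]
    module
  have h4 := abs_ip_le (toX (L.elGrad ξ (qo ξ + t • u)) - t • toX (L.hessLoop ξ (qo ξ) u)) (toX v)
  rw [map_sub (ip N), map_smul (ip N)] at h4
  simp only [sub_apply, smul_apply] at h4
  have h5 : L.elGrad ξ (qo ξ + (0 : ℝ) • u) = 0 := by
    rw [zero_smul, add_zero, hqo.elGrad_eq_zero hξ]
  rw [h5, map_zero, map_zero]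
  simp only [zero_apply, sub_zero]
  rw [Real.norm_eq_abs, Real.norm_eq_abs]
  refine h4.trans ?_
  rw [h3]
  rw [map_smul toX, norm_smul, Real.norm_eq_abs, ← map_smul toX] at h1
  refine (mul_le_mul_of_nonneg_right h1 (norm_nonneg _)).trans ?_
  have h6 : c / B * (|t| * ‖toX u‖) * ‖toX v‖ = c * |t| * ((‖toX u‖ * ‖toX v‖) / B) := by
    field_simp
  rw [h6]
  refine mul_le_of_le_one_right (by positivity) ((div_le_one hB0).2 ?_)
  rw [hB]
  linarith [norm_nonneg (toX u)]

section Symmetry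

variable {G : Type*} [Group G] {ρ : Representation ℝ G (Loop N)}

theorem IsSymmetryGroup.ip_rho (hG : L.IsSymmetryGroup ρ qo) (g : G) (u v : Loop N) :
    ip N (toX (ρ g u)) (toX (ρ g v)) = ip N (toX u) (toX v) := hG.isometry g u v

theorem rho_rho_inv (ρ : Representation ℝ G (Loop N)) (g : G) (v : Loop N) : ρ g (ρ g⁻¹ v) = v := by
  rw [← Module.End.mul_apply, ← map_mul, mul_inv_cancel, map_one]
  rfl

theorem IsSymmetryGroup.ip_rho_left (hG : L.IsSymmetryGroup ρ qo) (g : G) (u v : Loop N) :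
    ip N (toX (ρ g u)) (toX v) = ip N (toX u) (toX (ρ g⁻¹ v)) := by
  rw [← hG.ip_rho g u, rho_rho_inv]

theorem IsSymmetryGroup.eq_rho (hG : L.IsSymmetryGroup ρ qo) {g : G} {a b : Loop N}
    (h : ∀ v, ip N (toX a) (toX (ρ g v)) = ip N (toX b) (toX v)) : a = ρ g b := by
  refine sub_eq_zero.1 (eq_zero_of_ip fun v => ?_)
  rw [map_sub, map_sub, sub_apply, ← rho_rho_inv ρ g v, h, hG.ip_rho, sub_self]

/-- The gradient is determined by the derivatives of the invariant action, and isometry carries g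
across the pairing. Invariance is only known inside the domain, where the line through q stays for
small parameters. -/
theorem IsSymmetryGroup.elGrad_rho (hG : L.IsSymmetryGroup ρ qo) (hξ : ξ ∈ L.param) (g : G)
    {q : Loop N} (hq : L.Inside q) : L.elGrad ξ (ρ g q) = ρ g (L.elGrad ξ q) := by
  refine hG.eq_rho fun v => ?_
  have h1 := L.hasDerivAt_action hξ (hG.inside g q hq) (ρ g v)
  have h2 := L.hasDerivAt_action hξ hq v
  obtain ⟨δ, hδ, h⟩ := L.exists_action_approx hξ hq one_pos
  have h3 : (fun ε : ℝ => L.action ξ (ρ g q + ε • ρ g v)) =ᶠ[𝓝 0]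
      fun ε : ℝ => L.action ξ (q + ε • v) := by
    set B := max ‖toX v‖ ‖toX (dL v)‖ + 1 with hB
    have hB0 : 0 < B := by positivity
    filter_upwards [Metric.ball_mem_nhds (0 : ℝ) (show 0 < δ / B by positivity)] with t ht
    rw [mem_ball_zero_iff, Real.norm_eq_abs, lt_div_iff₀ hB0] at ht
    have h1 := (h (t • v) (|t| * B) ?_ ?_ ht.le).1
    · rw [← map_smul, ← map_add, hG.action_eq ξ hξ g _ h1]
    · rw [map_smul, norm_smul, Real.norm_eq_abs]
      exact mul_le_mul_of_nonneg_left (by linarith [le_max_left ‖toX v‖ ‖toX (dL v)‖]) (abs_nonneg _)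
    · rw [map_smul, map_smul, norm_smul, Real.norm_eq_abs]
      exact mul_le_mul_of_nonneg_left (by linarith [le_max_right ‖toX v‖ ‖toX (dL v)‖]) (abs_nonneg _)
  exact mul_left_cancel₀ (L.period_pos ξ hξ).ne' ((h1.congr_of_eventuallyEq h3.symm).unique h2)

theorem eventually_inside (hqo : L.IsSolutionFamily qo) (hξ : ξ ∈ L.param) (u : Loop N) :
    ∀ᶠ t : ℝ in 𝓝 0, L.Inside (qo ξ + t • u) := by
  obtain ⟨δ, hδ, h⟩ := exists_nem_approx hqo hξ one_pos
  have : ContinuousAt (fun r : ℝ => ‖r • toX u‖) 0 := by fun_prop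
  have h0 : ‖(0 : ℝ) • toX u‖ = 0 := by rw [zero_smul ℝ (toX u), norm_zero]
  filter_upwards [this.eventually (gt_mem_nhds (show ‖(0 : ℝ) • toX u‖ < δ by rwa [h0]))] with t ht
  exact (h ξ (by simpa using hδ)).2.1 (t • toX u) ht

theorem IsSymmetryGroup.hessLoop_rho (hG : L.IsSymmetryGroup ρ qo) (hqo : L.IsSolutionFamily qo)
    (hξ : ξ ∈ L.param) (g : G) (u : Loop N) :
    L.hessLoop ξ (qo ξ) (ρ g u) = ρ g (L.hessLoop ξ (qo ξ) u) := by
  refine hG.eq_rho fun v => ?_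
  refine ((hasDerivAt_ip_elGrad hqo hξ (ρ g u) (ρ g v)).congr_of_eventuallyEq ?_).unique
    (hasDerivAt_ip_elGrad hqo hξ u v)
  filter_upwards [eventually_inside hqo hξ u] with t ht
  have : qo ξ + t • ρ g u = ρ g (qo ξ + t • u) := by
    rw [map_add, map_smul, hG.fixed ξ hξ]
  rw [this, hG.elGrad_rho hξ g ht, hG.ip_rho]

/-- Symmetries are bounded from `C¹` to `C⁰`. -/
theorem IsSymmetryGroup.exists_norm_rho_le (hG : L.IsSymmetryGroup ρ qo)
    (hqo : L.IsSolutionFamily qo) (hξ : ξ ∈ L.param) :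
    ∃ C, 0 ≤ C ∧ ∀ (g : G) (u : Loop N) (b : ℝ), ‖toX u‖ ≤ b → ‖toX (dL u)‖ ≤ b →
      ‖toX (ρ g u)‖ ≤ C * b := by
  -- A filter argument rather than a minimum, so that N = 0 is covered.
  obtain ⟨m, hm, hm0⟩ : ∃ m : ℝ, (∀ i, m < L.massT ξ i) ∧ 0 < m :=
    ((eventually_all.2 fun i => eventually_nhdsWithin_of_eventually_nhds
      (gt_mem_nhds (L.massT_pos hξ i))).and self_mem_nhdsWithin : ∀ᶠ m : ℝ in 𝓝[>] 0,
        (∀ i, m < L.massT ξ i) ∧ 0 < m).exists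
  set V := L.potHess hξ (hqo.inside hξ) with hV
  have hform : ∀ u : Loop N, ip N (toX (L.hessLoop ξ (qo ξ) u)) (toX u) =
      ip N (post (L.massM ξ) (toX (dL u))) (toX (dL u)) + ip N (mulOp V (toX u)) (toX u) := by
    intro u
    rw [L.toX_hessLoop hξ (hqo.inside hξ), map_add, map_neg]
    simp only [add_apply, neg_apply]
    have h := ip_dL (postL (L.massM ξ) (dL u)) u
    rw [dL_postL, toX_postL, toX_postL] at h
    rw [h, neg_neg]
  set K := 2 + 2 * (‖L.massM ξ‖ + ‖V‖ + ‖V‖) / m with hK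
  have hK0 : 0 ≤ K := by positivity
  refine ⟨K, hK0, fun g u b hu hu' => ?_⟩
  have hb : 0 ≤ b := (norm_nonneg _).trans hu
  set w := ρ g u with hw
  -- The symmetry commutes with the Hessian and is isometric, so it preserves this quadratic form,
  -- which controls ∫|w'|² up to the L² norm of w. The L² norm is preserved too, and the Sobolev
  -- inequality then bounds w in C⁰.
  have h1 : ip N (toX (L.hessLoop ξ (qo ξ) w)) (toX w) =
      ip N (toX (L.hessLoop ξ (qo ξ) u)) (toX u) := by
    rw [hw, hG.hessLoop_rho hqo hξ, hG.ip_rho]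
  rw [hform, hform] at h1
  have h2 : ip N (toX w) (toX w) = ip N (toX u) (toX u) := hG.ip_rho g u u
  have h3 : ip N (toX u) (toX u) ≤ b ^ 2 := by
    refine ((le_abs_self _).trans (abs_ip_le _ _)).trans ?_
    nlinarith [norm_nonneg (toX u)]
  have h4 := neg_le_ip_mulOp V (toX w)
  have h5 := le_ip_post_diag (fun i => (hm i).le) (toX (dL w))
  have h6 : ip N (mulOp V (toX u)) (toX u) ≤ ‖V‖ * b ^ 2 := by
    refine ((le_abs_self _).trans (abs_ip_le _ _)).trans ?_
    calc ‖mulOp V (toX u)‖ * ‖toX u‖ ≤ (‖V‖ * b) * b := mul_le_mul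
          ((norm_mulOp_apply_le _).trans (mul_le_mul_of_nonneg_left hu (norm_nonneg V))) hu
          (norm_nonneg _) (by positivity)
      _ = ‖V‖ * b ^ 2 := by ring
  have h7 : ip N (post (L.massM ξ) (toX (dL u))) (toX (dL u)) ≤ ‖L.massM ξ‖ * b ^ 2 := by
    refine ((le_abs_self _).trans (abs_ip_le _ _)).trans ?_
    calc ‖post (L.massM ξ) (toX (dL u))‖ * ‖toX (dL u)‖ ≤ (‖L.massM ξ‖ * b) * b := mul_le_mul
          ((norm_post_le _ _).trans (mul_le_mul_of_nonneg_left hu' (norm_nonneg _))) hu'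
          (norm_nonneg _) (by positivity)
      _ = ‖L.massM ξ‖ * b ^ 2 := by ring
  have h8 := (isDeriv_toX w).norm_sq_le
  have h9 : m * ip N (toX (dL w)) (toX (dL w)) ≤ (‖L.massM ξ‖ + ‖V‖ + ‖V‖) * b ^ 2 := by
    change m * _ ≤ ip N (post (L.massM ξ) (toX (dL w))) (toX (dL w)) at h5
    have h10 : ‖V‖ * ip N (toX w) (toX w) ≤ ‖V‖ * b ^ 2 :=
      mul_le_mul_of_nonneg_left (h2.trans_le h3) (norm_nonneg V)
    linarith
  have h10 : ip N (toX (dL w)) (toX (dL w)) ≤ (‖L.massM ξ‖ + ‖V‖ + ‖V‖) / m * b ^ 2 := by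
    rw [div_mul_eq_mul_div, le_div_iff₀ hm0]
    linarith
  have h11 : ‖toX w‖ ^ 2 ≤ K * b ^ 2 := by
    rw [hK, add_mul, mul_div_assoc]
    nlinarith [ip_self_nonneg (toX (dL w))]
  have h12 : ‖toX w‖ ^ 2 ≤ (K * b) ^ 2 := by
    have : 1 ≤ K := by
      have : 0 ≤ 2 * (‖L.massM ξ‖ + ‖V‖ + ‖V‖) / m := by positivity
      linarith
    refine h11.trans ?_
    rw [mul_pow]
    exact mul_le_mul_of_nonneg_right (by nlinarith) (sq_nonneg b)
  exact abs_le_of_sq_le_sq' h12 (by positivity) |>.2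

/-- The kernel is invariant under the isometric action, so its orthogonal projector commutes with
the group. -/
theorem IsSymmetryGroup.projL_rho (hG : L.IsSymmetryGroup ρ qo) (hqo : L.IsSolutionFamily qo)
    (hξ₀ : ξ₀ ∈ L.param) (he : IsOrthoBasis (L.hessKer hξ₀ (hqo.inside hξ₀)) e) (g : G)
    (v : Loop N) : projL e (ρ g v) = ρ g (projL e v) := by
  have hK : ∀ (g : G) {k : Loop N}, k ∈ L.hessKer hξ₀ (hqo.inside hξ₀) →
      ρ g k ∈ L.hessKer hξ₀ (hqo.inside hξ₀) := fun g k hk => by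
    rw [mem_hessKer] at *
    rw [hG.hessLoop_rho hqo hξ₀, hk, map_zero]
  rw [← he.projL_eq_self (hK g (he.projL_mem v))]
  refine Finset.sum_congr rfl fun i _ => ?_
  have h1 : ip N (toX (e i)) (toX (ρ g v)) = ip N (toX (e i)) (toX (ρ g (projL e v))) := by
    rw [ip_comm, hG.ip_rho_left, ip_comm (toX (e i)), hG.ip_rho_left, toX_projL,
      he.ip_projX_mem (hK g⁻¹ (he.mem i))]
  rw [h1]

variable {φ : Loop N} {C δ η : ℝ} {u : ℝ → ℝ → Loop N}

theorem IsBranch.apply_zero (hu : L.IsBranch qo e ξ₀ φ C δ η u) (hqo : L.IsSolutionFamily qo)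
    (hξ₀ : ξ₀ ∈ L.param) (hξ : |ξ - ξ₀| < η) : u ξ 0 = 0 := by
  refine (hu.unique hξ (by simpa using hu.η_pos) (by simpa using hu.δ_pos) ⟨?_, ?_, ?_⟩).symm
  · rw [add_zero]
    exact hqo.inside (hu.mem_param hξ)
  · rw [add_zero, hqo.elGrad_eq_zero (hu.mem_param hξ)]
    exact (L.hessKer hξ₀ (hqo.inside hξ₀)).zero_mem
  · rw [map_zero, map_zero, zero_smul ℝ (toX φ)]

/-- Symmetries map solutions of the projected problem to solutions with the same amplitude.
Uniqueness holds only in a C⁰ ball, and no C⁰ continuity of the action of G is assumed, so smallness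
of the image is drawn from `exists_norm_rho_le` and the C¹ bound on the branch. -/
theorem IsBranch.exists_rho_eq (hu : L.IsBranch qo e ξ₀ φ C δ η u) (hqo : L.IsSolutionFamily qo)
    (hG : L.IsSymmetryGroup ρ qo) (hξ₀ : ξ₀ ∈ L.param)
    (he : IsOrthoBasis (L.hessKer hξ₀ (hqo.inside hξ₀)) e) (hφ : ∀ g, ρ g φ = φ) :
    ∃ η' > 0, ∀ ξ r, |ξ - ξ₀| < η' → |r| < η' → ∀ g, ρ g (u ξ r) = u ξ r := by
  obtain ⟨B, hB, hb⟩ := hG.exists_norm_rho_le hqo hξ₀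
  have hη := hu.η_pos
  have hδ := hu.δ_pos
  have hC := hu.C_pos
  refine ⟨min η (δ / (B * C + 1)), by positivity, fun ξ r hξ hr g => ?_⟩
  rw [lt_min_iff] at hξ hr
  have hp := hu.mem_param hξ.1
  have hs := hu.sol hξ.1 hr.1
  have h0 : |(0 : ℝ)| < η := by simpa using hη
  have h1 := hu.norm_sub_le hξ.1 hr.1 h0
  have h2 := hu.norm_deriv_sub_le hξ.1 hr.1 h0
  rw [hu.apply_zero hqo hξ₀ hξ.1, sub_zero, sub_zero] at h1 h2
  refine hu.unique hξ.1 hr.1 ?_ ⟨?_, ?_, ?_⟩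
  · refine (hb g _ _ h1 h2).trans_lt ?_
    have h3 := (lt_div_iff₀ (by positivity)).1 hr.2
    nlinarith [abs_nonneg r]
  · rw [← hG.fixed ξ hp g, ← map_add]
    exact hG.inside g _ hs.inside
  · rw [← hG.fixed ξ hp g, ← map_add, hG.elGrad_rho hp g hs.inside,
      hG.hessLoop_rho hqo hξ₀, hs.grad_mem, map_zero]
  · have h4 : projL e (u ξ r) = r • φ := toX_injective (by rw [toX_projL, hs.proj, map_smul])
    rw [← toX_projL, hG.projL_rho hqo hξ₀ he, h4, map_smul, hφ, map_smul]

variable [Fintype G]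

theorem IsSymmetryGroup.ip_groupProj (hG : L.IsSymmetryGroup ρ qo) (u v : Loop N) :
    ip N (toX (groupProj ρ u)) (toX v) = ip N (toX u) (toX (groupProj ρ v)) := by
  rw [groupProj_apply, groupProj_apply]
  simp only [map_smul, map_sum, smul_apply, sum_apply]
  congr 1
  refine Fintype.sum_equiv (Equiv.inv G) _ _ fun g => ?_
  rw [hG.ip_rho_left]
  rfl

end Symmetry

end LagrangianFamily

/-! ### Conservation laws and Noether's identity -/

section Partial

variable {A E F : Type*} [NormedAddCommGroup A] [NormedSpace ℝ A] [NormedAddCommGroup E]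
  [NormedSpace ℝ E] [NormedAddCommGroup F] [NormedSpace ℝ F] {f : A → E → F} {F' : A × E →L[ℝ] F}
  {x : A} {v : E}

theorem fderiv_left_eq (h : HasFDerivAt (fun p : A × E => f p.1 p.2) F' (x, v)) :
    fderiv ℝ (fun y => f y v) x = F'.comp (ContinuousLinearMap.inl ℝ A E) := by
  have : HasFDerivAt (fun y => f y v) (F'.comp (ContinuousLinearMap.inl ℝ A E)) x :=
    HasFDerivAt.comp (g := fun p : A × E => f p.1 p.2) (f := fun y => (y, v)) x h
      (hasFDerivAt_prodMk_left x v)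
  exact this.fderiv

theorem fderiv_right_eq (h : HasFDerivAt (fun p : A × E => f p.1 p.2) F' (x, v)) :
    fderiv ℝ (fun w => f x w) v = F'.comp (ContinuousLinearMap.inr ℝ A E) := by
  have : HasFDerivAt (fun w => f x w) (F'.comp (ContinuousLinearMap.inr ℝ A E)) v :=
    HasFDerivAt.comp (g := fun p : A × E => f p.1 p.2) (f := fun w => (x, w)) v h
      (hasFDerivAt_prodMk_right x v)
  exact this.fderiv

end Partial

namespace LagrangianFamily

open PerFun Loop

variable {N : ℕ} (L : LagrangianFamily N) (I : ℝ → Config N → Config N → ℝ)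

/-- The variation connected to a conservation law as a function of the parameter, the position and
the derivative of the position with respect to the normalized time. -/
def noetherField (p : ℝ × Config N × Config N) : Config N :=
  ((L.period p.1)⁻¹ ^ 2) • L.massInv p.1
    (gradient (fun w => I p.1 p.2.1 w) ((L.period p.1)⁻¹ • p.2.2))

/-- The variation of `q` connected to a conservation law as a smooth periodic function. -/
def noetherLoop (ξ : ℝ) (q : Loop N) : Loop N := ofFun (L.noetherMode I ξ q)

variable {L I} {qo : ℝ → Loop N} {ξ ξ₀ : ℝ} {q : Loop N}

theorem noetherMode_eq (hξ : ξ ∈ L.param) (s : ℝ) :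
    L.noetherMode I ξ q s = L.noetherField I (ξ, q.1 s, (dL q).1 s) := by
  have hT := (L.period_pos ξ hξ).ne'
  ext i
  have hm := (L.mass_pos ξ hξ i).ne'
  simp only [noetherMode, noetherField, massInv, massT, PiLp.smul_apply, diag_apply, smul_eq_mul,
    dL_val]
  field_simp

theorem IsConserved.contDiffOn_gradient (hI : L.IsConserved I) :
    ContDiffOn ℝ ∞ (fun p : ℝ × Config N × Config N => gradient (fun w => I p.1 p.2.1 w) p.2.2)
      (L.param ×ˢ L.dom ×ˢ Set.univ) := by
  have hO : IsOpen {p : (ℝ × Config N) × Config N | p.1 ∈ L.param ×ˢ L.dom} :=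
    (L.isOpen_param.prod L.isOpen_dom).preimage continuous_fst
  have h1 : ContDiffOn ℝ ∞ (fun p : (ℝ × Config N) × Config N => I p.1.1 p.1.2 p.2)
      {p : (ℝ × Config N) × Config N | p.1 ∈ L.param ×ˢ L.dom} :=
    hI.contDiffOn.comp (f := fun p : (ℝ × Config N) × Config N => (p.1.1, p.1.2, p.2))
      (by fun_prop) fun p hp => ⟨hp.1, hp.2, trivial⟩
  have h2 := ContDiffOn.continuousLinearMap_comp (rieszMap N)
    (contDiffOn_fderiv_right (f := fun (a : ℝ × Config N) w => I a.1 a.2 w) hO h1)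
  exact h2.comp (f := fun p : ℝ × Config N × Config N => ((p.1, p.2.1), p.2.2))
    (by fun_prop) fun p hp => ⟨hp.1, hp.2.1⟩

theorem IsConserved.noetherLoop_apply (hI : L.IsConserved I) (hξ : ξ ∈ L.param) (hq : L.Inside q)
    (s : ℝ) : (L.noetherLoop I ξ q).1 s = L.noetherField I (ξ, q.1 s, (dL q).1 s) := by
  rw [noetherLoop, ofFun_val, noetherMode_eq hξ]
  have : L.noetherMode I ξ q = fun s => L.noetherField I (ξ, q.1 s, (dL q).1 s) :=
    funext fun s => noetherMode_eq hξ s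
  rw [this]
  have h1 : ContDiff ℝ ∞ fun s => gradient (fun w => I ξ (q.1 s) w) ((L.period ξ)⁻¹ • (dL q).1 s) :=
    contDiffOn_univ.1 (hI.contDiffOn_gradient.comp
      (f := fun s => (ξ, q.1 s, (L.period ξ)⁻¹ • (dL q).1 s))
      (contDiff_const.prodMk (q.2.1.prodMk ((dL q).2.1.const_smul _))).contDiffOn
      fun s _ => ⟨hξ, hq s, trivial⟩)
  have h2 : ContDiff ℝ ∞ fun s => ((L.period ξ)⁻¹ ^ 2) • L.massInv ξ
      (gradient (fun w => I ξ (q.1 s) w) ((L.period ξ)⁻¹ • (dL q).1 s)) :=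
    ((L.massInv ξ).contDiff.comp h1).const_smul _
  refine ⟨h2, fun s => ?_⟩
  simp only [q.2.2 s, (dL q).2.2 s]

theorem IsConserved.loopInner_noetherMode (hI : L.IsConserved I) (hξ : ξ ∈ L.param)
    (hq : L.Inside q) (u : Loop N) :
    loopInner (L.noetherMode I ξ q) u.1 = ip N (toX (L.noetherLoop I ξ q)) (toX u) := by
  rw [← loopInner_eq]
  congr 1
  exact funext fun s => by rw [hI.noetherLoop_apply hξ hq, noetherMode_eq hξ]

theorem continuousOn_noetherField (hI : L.IsConserved I) :
    ContinuousOn (L.noetherField I) (L.param ×ˢ L.dom ×ˢ Set.univ) := by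
  have hT : ContinuousOn (fun p : ℝ × Config N × Config N => (L.period p.1)⁻¹)
      (L.param ×ˢ L.dom ×ˢ Set.univ) :=
    (L.contDiffOn_period.continuousOn.comp continuousOn_fst fun p hp => hp.1).inv₀
      fun p hp => (L.period_pos _ hp.1).ne'
  refine (hT.pow 2).smul ((L.continuousOn_massInv.comp continuousOn_fst fun p hp => hp.1).clm_apply
    (hI.contDiffOn_gradient.continuousOn.comp
      (f := fun p : ℝ × Config N × Config N => (p.1, p.2.1, (L.period p.1)⁻¹ • p.2.2))
      (continuousOn_fst.prodMk ((continuous_fst.comp continuous_snd).continuousOn.prodMk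
        (hT.smul (continuous_snd.comp continuous_snd).continuousOn)))
      fun p hp => ⟨hp.1, hp.2.1, trivial⟩))

theorem IsConserved.exists_noetherLoop_approx (hI : L.IsConserved I) (hqo : L.IsSolutionFamily qo)
    (hξ₀ : ξ₀ ∈ L.param) {ε : ℝ} (hε : 0 < ε) :
    ∃ δ > 0, ∀ ξ, |ξ - ξ₀| < δ → ∀ u : Loop N, ‖toX u‖ < δ → ‖toX (dL u)‖ < δ →
      L.Inside (qo ξ + u) ∧
        ‖toX (L.noetherLoop I ξ (qo ξ + u)) - toX (L.noetherLoop I ξ₀ (qo ξ₀))‖ ≤ ε := by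
  obtain ⟨δ, hδ, h⟩ := exists_forall_dist_lt_of_periodic L.isOpen_param hξ₀
    (c := fun ξ s => (ξ, (qo ξ).1 s, (dL (qo ξ)).1 s)) (f := L.noetherField I)
    (O := L.param ×ˢ L.dom ×ˢ Set.univ)
    (continuousOn_fst.prodMk (hqo.continuousOn.prodMk hqo.continuousOn_deriv))
    (fun ξ _ s => by simp only [(qo ξ).2.2 s, (dL (qo ξ)).2.2 s])
    (L.isOpen_param.prod (L.isOpen_dom.prod isOpen_univ)) (continuousOn_noetherField hI)
    (fun s => ⟨hξ₀, hqo.inside hξ₀ s, trivial⟩) hε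
  refine ⟨δ, hδ, fun ξ hξ u hu hu' => ?_⟩
  obtain ⟨hp, h⟩ := h ξ hξ
  have h1 : ∀ s, _ := fun s => h s (ξ, (qo ξ + u).1 s, (dL (qo ξ + u)).1 s) (by
    have e1 : dist ((qo ξ + u).1 s) ((qo ξ).1 s) = ‖u.1 s‖ := by
      rw [dist_eq_norm]; congr 1; exact add_sub_cancel_left _ _
    have e2 : dist ((dL (qo ξ + u)).1 s) ((dL (qo ξ)).1 s) = ‖(dL u).1 s‖ := by
      rw [dist_eq_norm, map_add]; congr 1; exact add_sub_cancel_left _ _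
    rw [Prod.dist_eq, Prod.dist_eq, dist_self, e1, e2]
    refine max_lt hδ (max_lt ?_ ?_)
    · exact ((toX u).norm_coe_le s).trans_lt hu
    · exact ((toX (dL u)).norm_coe_le s).trans_lt hu')
  have hin : L.Inside (qo ξ + u) := fun s => (h1 s).1.2.1
  refine ⟨hin, norm_le_of_real hε.le fun s => ?_⟩
  rw [ContinuousMap.sub_apply, toX_apply, toX_apply, hI.noetherLoop_apply hp hin,
    hI.noetherLoop_apply hξ₀ (hqo.inside hξ₀), ← dist_eq_norm]
  exact (h1 s).2.le

/-- Noether's identity. -/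
theorem IsConserved.ip_elGrad_noetherLoop (hI : L.IsConserved I) (hξ : ξ ∈ L.param)
    (hq : L.Inside q) : ip N (toX (L.elGrad ξ q)) (toX (L.noetherLoop I ξ q)) = 0 := by
  set T := L.period ξ with hT
  have hT0 : T ≠ 0 := (L.period_pos ξ hξ).ne'
  -- For a first integral the derivative along an arbitrary loop involves only the failure of the
  -- equations of motion, that is, the gradient paired with the Noether mode. Its integral over a
  -- period vanishes.
  have hder : ∀ s, HasDerivAt (fun s => I ξ (q.1 s) (T⁻¹ • (dL q).1 s))
      (-T * inner ℝ ((L.elGrad ξ q).1 s) ((L.noetherLoop I ξ q).1 s)) s := by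
    intro s
    set x := q.1 s with hx
    set v := T⁻¹ • (dL q).1 s with hv
    have hsm : ContDiffAt ℝ ∞ (fun p : Config N × Config N => I ξ p.1 p.2) (x, v) :=
      (hI.contDiffOn.contDiffAt ((L.isOpen_param.prod (L.isOpen_dom.prod isOpen_univ)).mem_nhds
        (show (ξ, x, v) ∈ _ from ⟨hξ, hq s, trivial⟩))).comp (x, v)
        (contDiffAt_const.prodMk contDiffAt_id)
    have hF := (hsm.differentiableAt (by simp)).hasFDerivAt
    set F := fderiv ℝ (fun p : Config N × Config N => I ξ p.1 p.2) (x, v) with hFdef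
    have hF1 : fderiv ℝ (fun y => I ξ y v) x = F.comp (ContinuousLinearMap.inl ℝ _ _) :=
      fderiv_left_eq hF
    have hF2 : fderiv ℝ (fun w => I ξ x w) v = F.comp (ContinuousLinearMap.inr ℝ _ _) :=
      fderiv_right_eq hF
    set g := gradient (fun w => I ξ x w) v with hg
    have hg' : ∀ y, inner ℝ g y = F (0, y) := fun y => by
      have : inner ℝ g y = fderiv ℝ (fun w => I ξ x w) v y := InnerProductSpace.toDual_symm_apply
      rw [this, hF2]
      rfl
    have hc := hI.conserved ξ hξ x (hq s) v
    rw [hF1, hF2] at hc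
    change F (v, 0) + F (0, L.accel ξ x) = 0 at hc
    have hcur := hF.comp_hasDerivAt s ((q.hasDerivAt s).prodMk (((dL q).hasDerivAt s).const_smul T⁻¹))
    refine hcur.congr_deriv ?_
    have e1 : (dL q).1 s = T • v := by rw [hv, smul_inv_smul₀ hT0]
    have e2 : F ((dL q).1 s, T⁻¹ • (dL (dL q)).1 s) = T * F (v, 0) + F (0, T⁻¹ • (dL (dL q)).1 s) := by
      rw [← smul_eq_mul, ← map_smul, ← map_add, e1]
      simp
    rw [e2, hI.noetherLoop_apply hξ hq, L.elGrad_apply hξ hq]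
    change _ = -T * inner ℝ _ ((T⁻¹ ^ 2) • L.massInv ξ g)
    have e3 : L.massInv ξ (gradient (L.pot ξ) x) = T ^ 2 • L.accel ξ x := by
      ext i
      have hm := (L.mass_pos ξ hξ i).ne'
      simp only [massInv, massT, diag_apply, accel, PiLp.smul_apply, smul_eq_mul]
      rw [← hT]
      field_simp
    rw [inner_smul_right, massInv, ← inner_diag]
    change _ = -T * (T⁻¹ ^ 2 * inner ℝ (L.massInv ξ _) g)
    rw [map_add, map_neg, L.massInv_massM hξ, e3, real_inner_comm, hg']
    have e4 : F (0, -(dL (dL q)).1 s + T ^ 2 • L.accel ξ x) =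
        - F (0, (dL (dL q)).1 s) + T ^ 2 * F (0, L.accel ξ x) := by
      rw [← smul_eq_mul, ← map_smul, ← map_neg, ← map_add]
      simp
    have e5 : F (0, T⁻¹ • (dL (dL q)).1 s) = T⁻¹ * F (0, (dL (dL q)).1 s) := by
      rw [← smul_eq_mul, ← map_smul]
      simp
    rw [e4, e5]
    have : F (v, 0) = - F (0, L.accel ξ x) := by linarith
    rw [this]
    field_simp
    ring
  have h := intervalIntegral.integral_eq_sub_of_hasDerivAt (a := (0 : ℝ)) (b := 1)
    (fun s _ => hder s) ((continuous_const.mul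
      ((L.elGrad ξ q).2.1.continuous.inner (L.noetherLoop I ξ q).2.1.continuous)).intervalIntegrable _ _)
  have h1 : q.1 1 = q.1 0 := by simpa using q.2.2 0
  have h2 : (dL q).1 1 = (dL q).1 0 := by simpa using (dL q).2.2 0
  rw [h1, h2, sub_self, intervalIntegral.integral_const_mul] at h
  rw [ip_apply]
  exact (mul_eq_zero.1 h).resolve_left (neg_ne_zero.2 hT0)

end LagrangianFamily

namespace PerFun

open Loop

variable {N : ℕ} {α : Type*} {l : Filter α}

/-- Only z₀ - z(a) contributes to the pairing, and it tends to 0. -/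
theorem isLittleO_ip {γ z : α → Loop N} {z₀ : Loop N}
    (hz : Tendsto (fun a => toX (z a)) l (𝓝 (toX z₀)))
    (h : ∀ᶠ a in l, ip N (toX (γ a)) (toX (z a)) = 0) :
    (fun a => ip N (toX (γ a)) (toX z₀)) =o[l] fun a => toX (γ a) := by
  rw [isLittleO_iff]
  intro c hc
  filter_upwards [h, hz.eventually (Metric.closedBall_mem_nhds _ hc)] with a ha hza
  rw [dist_eq_norm] at hza
  have h1 : ip N (toX (γ a)) (toX z₀) = - ip N (toX (γ a)) (toX (z a) - toX z₀) := by
    rw [map_sub, ha, zero_sub, neg_neg]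
  rw [h1, norm_neg, Real.norm_eq_abs, mul_comm]
  exact (abs_ip_le _ _).trans (mul_le_mul_of_nonneg_left hza (norm_nonneg _))

end PerFun

/-! ### Noether modes as zero modes, and the critical mode -/

namespace LagrangianFamily

open PerFun Loop

variable {N : ℕ} {L : LagrangianFamily N} {I : ℝ → Config N → Config N → ℝ} {qo : ℝ → Loop N}
  {ξ ξ₀ : ℝ} {q : Loop N}

theorem mem_eigenfunctions_iff (hξ : ξ ∈ L.param) (hq : L.Inside q) {κ : ℝ} {u : Loop N} :
    u ∈ L.eigenfunctions ξ q κ ↔ L.hessLoop ξ q u = κ • u ∧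
      ∀ I, L.IsConserved I → ip N (toX (L.noetherLoop I ξ q)) (toX u) = 0 := by
  refine and_congr ⟨fun h => Subtype.ext (funext fun s => ?_), fun h s => ?_⟩
    (forall₂_congr fun I hI => ?_)
  · rw [L.hessLoop_apply hξ hq, h s]; rfl
  · rw [← L.hessLoop_apply hξ hq, h]; rfl
  · rw [hI.loopInner_noetherMode hξ hq]

/-- Noether's identity is differentiated in the direction u at the stationary loop. The gradient is
O(t) there, so continuity of the mode suffices and the derivative is ⟨H u, z⟩ = 0; self-adjointness
moves H to z. -/
theorem IsConserved.hessLoop_noetherLoop (hI : L.IsConserved I) (hqo : L.IsSolutionFamily qo)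
    (hξ : ξ ∈ L.param) : L.hessLoop ξ (qo ξ) (L.noetherLoop I ξ (qo ξ)) = 0 := by
  set z := L.noetherLoop I ξ (qo ξ) with hz
  refine eq_zero_of_ip fun u => ?_
  rw [ip_comm, ← L.ip_hessLoop hξ (hqo.inside hξ)]
  refine (hasDerivAt_ip_elGrad hqo hξ u z).unique ?_
  obtain ⟨δ, hδ, h⟩ := exists_nem_approx hqo hξ one_pos
  obtain ⟨-, hin, happ⟩ := h ξ (by simpa using hδ)
  set V := mulOp (L.potHess hξ (hqo.inside hξ)) with hV
  set K := ‖L.massM ξ‖ * ‖toX (dL (dL u))‖ + (‖V‖ + 1) * ‖toX u‖ + 1 with hK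
  have hK0 : 0 < K := by positivity
  rw [hasDerivAt_iff_isLittleO, isLittleO_iff]
  intro c hc
  obtain ⟨δ', hδ', h'⟩ := hI.exists_noetherLoop_approx hqo hξ (ε := c / K) (by positivity)
  set B := ‖toX u‖ + ‖toX (dL u)‖ + 1 with hB
  have hB0 : 0 < B := by positivity
  filter_upwards [Metric.ball_mem_nhds (0 : ℝ) (show 0 < min δ δ' / B by positivity)] with t ht
  rw [mem_ball_zero_iff, Real.norm_eq_abs, lt_div_iff₀ hB0] at ht
  have h1 : ‖toX (t • u)‖ < min δ δ' := by
    rw [map_smul, norm_smul, Real.norm_eq_abs]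
    refine lt_of_le_of_lt (mul_le_mul_of_nonneg_left ?_ (abs_nonneg t)) ht
    linarith [norm_nonneg (toX (dL u))]
  have h2 : ‖toX (dL (t • u))‖ < min δ δ' := by
    rw [map_smul, map_smul, norm_smul, Real.norm_eq_abs]
    refine lt_of_le_of_lt (mul_le_mul_of_nonneg_left ?_ (abs_nonneg t)) ht
    linarith [norm_nonneg (toX u)]
  have hsm := h1.trans_le (min_le_left _ _)
  obtain ⟨hin', h3⟩ := h' ξ (by simpa using hδ') (t • u) (h1.trans_le (min_le_right _ _))
    (h2.trans_le (min_le_right _ _))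
  have h4 := hI.ip_elGrad_noetherLoop hξ hin'
  have h5 := happ (toX (t • u)) 0 hsm (by simpa using hδ)
  rw [nem_zero hqo hξ, sub_zero, sub_zero, one_mul] at h5
  have h6 : ‖toX (L.elGrad ξ (qo ξ + t • u))‖ ≤ K * |t| := by
    rw [toX_elGrad hqo hξ hin']
    have h7 := norm_le_insert' (L.nem qo ξ (toX (t • u))) (V (toX (t • u)))
    have h8 := V.le_opNorm (toX (t • u))
    have h9 : ‖- post (L.massM ξ) (toX (dL (dL (t • u))))‖ ≤
        ‖L.massM ξ‖ * (|t| * ‖toX (dL (dL u))‖) := by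
      rw [norm_neg, map_smul, map_smul, map_smul]
      refine (norm_post_le _ _).trans_eq ?_
      rw [norm_smul, Real.norm_eq_abs]
    refine (norm_add_le _ _).trans ?_
    have h10 : ‖toX (t • u)‖ = |t| * ‖toX u‖ := by rw [map_smul, norm_smul, Real.norm_eq_abs]
    rw [h10] at h5 h8
    rw [hK]
    nlinarith [abs_nonneg t]
  have h7 : ip N (toX (L.elGrad ξ (qo ξ + t • u))) (toX z) =
      - ip N (toX (L.elGrad ξ (qo ξ + t • u))) (toX (L.noetherLoop I ξ (qo ξ + t • u)) - toX z) := by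
    rw [map_sub, h4, zero_sub, neg_neg]
  have h8 : L.elGrad ξ (qo ξ + (0 : ℝ) • u) = 0 := by
    rw [zero_smul, add_zero, hqo.elGrad_eq_zero hξ]
  rw [h8, map_zero, map_zero, h7]
  simp only [zero_apply, sub_zero, smul_zero, norm_neg]
  rw [Real.norm_eq_abs, Real.norm_eq_abs]
  refine (abs_ip_le _ _).trans ((mul_le_mul h6 h3 (norm_nonneg _) (by positivity)).trans_eq ?_)
  field_simp

variable {G : Type*} [Group G] [Fintype G]

variable (L) in
/-- The span of the symmetrized variations connected to conservation laws. -/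
def noetherSpan (ρ : Representation ℝ G (Loop N)) (ξ : ℝ) (q : Loop N) : Submodule ℝ (Loop N) :=
  Submodule.span ℝ {x | ∃ I, L.IsConserved I ∧ groupProj ρ (L.noetherLoop I ξ q) = x}

variable {ρ : Representation ℝ G (Loop N)}

theorem IsSymmetryGroup.hessLoop_groupProj (hG : L.IsSymmetryGroup ρ qo)
    (hqo : L.IsSolutionFamily qo) (hξ : ξ ∈ L.param) {u : Loop N} (hu : L.hessLoop ξ (qo ξ) u = 0) :
    L.hessLoop ξ (qo ξ) (groupProj ρ u) = 0 := by
  rw [groupProj_apply]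
  refine (L.hessKer hξ (hqo.inside hξ)).smul_mem _ (Submodule.sum_mem _ fun g _ => ?_)
  rw [mem_hessKer, hG.hessLoop_rho hqo hξ, hu, map_zero]

theorem IsSymmetryGroup.noetherSpan_le (hG : L.IsSymmetryGroup ρ qo) (hqo : L.IsSolutionFamily qo)
    (hξ : ξ ∈ L.param) : L.noetherSpan ρ ξ (qo ξ) ≤ L.hessKer hξ (hqo.inside hξ) := by
  refine Submodule.span_le.2 ?_
  rintro _ ⟨I, hI, rfl⟩
  exact hG.hessLoop_groupProj hqo hξ (hI.hessLoop_noetherLoop hqo hξ)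

theorem groupProj_of_mem_noetherSpan {x : Loop N} (hx : x ∈ L.noetherSpan ρ ξ q) :
    groupProj ρ x = x := by
  have : L.noetherSpan ρ ξ q ≤ LinearMap.eqLocus (groupProj ρ) LinearMap.id := by
    refine Submodule.span_le.2 ?_
    rintro _ ⟨I, hI, rfl⟩
    exact groupProj_groupProj ρ _
  exact this hx

theorem IsSymmetryGroup.ip_eq_zero_of_mem_noetherSpan (hG : L.IsSymmetryGroup ρ qo) {u x : Loop N}
    (hx : x ∈ L.noetherSpan ρ ξ q) (hu : groupProj ρ u = u)
    (hz : ∀ I, L.IsConserved I → ip N (toX (L.noetherLoop I ξ q)) (toX u) = 0) :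
    ip N (toX x) (toX u) = 0 := by
  induction hx using Submodule.span_induction with
  | mem x h =>
    obtain ⟨I, hI, rfl⟩ := h
    rw [hG.ip_groupProj, hu, hz I hI]
  | zero => simp
  | add x y _ _ hx hy => rw [map_add, map_add, add_apply, hx, hy, add_zero]
  | smul c x _ hx => rw [map_smul, map_smul, smul_apply, hx, smul_zero]

theorem IsSymmetryGroup.isLittleO_ip_noetherSpan {α : Type*} {l : Filter α}
    (hG : L.IsSymmetryGroup ρ qo) {γ : α → Loop N} (hγ : ∀ᶠ a in l, groupProj ρ (γ a) = γ a)
    (h : ∀ I, L.IsConserved I → (fun a => ip N (toX (γ a)) (toX (L.noetherLoop I ξ q)))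
      =o[l] fun a => toX (γ a)) {x : Loop N} (hx : x ∈ L.noetherSpan ρ ξ q) :
    (fun a => ip N (toX (γ a)) (toX x)) =o[l] fun a => toX (γ a) := by
  induction hx using Submodule.span_induction with
  | mem x hx =>
    obtain ⟨I, hI, rfl⟩ := hx
    refine (h I hI).congr' ?_ EventuallyEq.rfl
    filter_upwards [hγ] with a ha
    rw [← hG.ip_groupProj, ha]
  | zero => simp
  | add x y _ _ hx hy =>
    simp only [map_add]
    exact hx.add hy
  | smul c x _ hx =>
    simp only [map_smul, smul_eq_mul]
    exact hx.const_mul_left c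

variable {n m : ℕ} {e : Fin n → Loop N} {f : Fin m → Loop N} {φ : Loop N}

/-- `φ` spans the invariant zero modes that are orthogonal to the conservation laws. -/
structure IsCriticalMode (L : LagrangianFamily N) (ρ : Representation ℝ G (Loop N)) (ξ : ℝ)
    (q φ : Loop N) : Prop where
  ne_zero : φ ≠ 0
  hess : L.hessLoop ξ q φ = 0
  orth : ∀ I, L.IsConserved I → ip N (toX (L.noetherLoop I ξ q)) (toX φ) = 0
  inv : groupProj ρ φ = φ
  eq_smul : ∀ u, L.hessLoop ξ q u = 0 →
    (∀ I, L.IsConserved I → ip N (toX (L.noetherLoop I ξ q)) (toX u) = 0) → groupProj ρ u = u →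
    ∃ c : ℝ, u = c • φ

theorem IsCriticalMode.projL_eq_zero (h : L.IsCriticalMode ρ ξ q φ) (hG : L.IsSymmetryGroup ρ qo)
    (hf : IsOrthoBasis (L.noetherSpan ρ ξ q) f) : projL f φ = 0 :=
  Finset.sum_eq_zero fun i _ => by
    rw [hG.ip_eq_zero_of_mem_noetherSpan (hf.mem i) h.inv h.orth, zero_smul]

/-- Removing its component in the symmetrized Noether span leaves x invariant, a zero mode, and
orthogonal to the Noether modes, hence a multiple of φ. Since φ is orthogonal to that span, pairing
with φ gives the coefficient. -/
theorem IsCriticalMode.sub_projL_eq (h : L.IsCriticalMode ρ ξ (qo ξ) φ) (hG : L.IsSymmetryGroup ρ qo)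
    (hqo : L.IsSolutionFamily qo) (hξ : ξ ∈ L.param)
    (hf : IsOrthoBasis (L.noetherSpan ρ ξ (qo ξ)) f) {x : Loop N} (hx : L.hessLoop ξ (qo ξ) x = 0)
    (hP : groupProj ρ x = x) :
    x - projL f x = (ip N (toX φ) (toX x) / ip N (toX φ) (toX φ)) • φ := by
  have hW : ∀ y ∈ L.noetherSpan ρ ξ (qo ξ), ip N (toX y) (toX (x - projL f x)) = 0 := fun y hy => by
    rw [map_sub, map_sub, toX_projL, ip_comm _ (projX f _), hf.ip_projX_mem hy, ip_comm, sub_self]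
  have hPy : groupProj ρ (x - projL f x) = x - projL f x := by
    rw [map_sub, hP, groupProj_of_mem_noetherSpan (hf.projL_mem x)]
  obtain ⟨c, hc⟩ := h.eq_smul (x - projL f x)
    ((L.hessKer hξ (hqo.inside hξ)).sub_mem hx (hG.noetherSpan_le hqo hξ (hf.projL_mem x)))
    (fun I hI => by
      rw [← hPy, ← hG.ip_groupProj]
      exact hW _ (Submodule.subset_span ⟨I, hI, rfl⟩)) hPy
  have h1 : ip N (toX φ) (toX (x - projL f x)) = ip N (toX φ) (toX x) := by
    rw [map_sub, map_sub, toX_projL, ← ip_projX, ← toX_projL, h.projL_eq_zero hG hf, map_zero,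
      map_zero, zero_apply, sub_zero]
  rw [hc, map_smul, map_smul, smul_eq_mul] at h1
  rw [hc, ← h1, mul_div_cancel_right₀ _ (ip_self_pos h.ne_zero).ne']

/-- The difference is exactly the projection of γ on the symmetrized Noether span, which is
finite-dimensional with every coefficient o(γ). -/
theorem IsCriticalMode.isLittleO_projL {α : Type*} {l : Filter α}
    (h : L.IsCriticalMode ρ ξ (qo ξ) φ) (hG : L.IsSymmetryGroup ρ qo) (hqo : L.IsSolutionFamily qo)
    (hξ : ξ ∈ L.param) (he : IsOrthoBasis (L.hessKer hξ (hqo.inside hξ)) e)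
    {γ : α → Loop N} (hγ : ∀ᶠ a in l, groupProj ρ (γ a) = γ a)
    (hz : ∀ I, L.IsConserved I → (fun a => ip N (toX (γ a)) (toX (L.noetherLoop I ξ (qo ξ))))
      =o[l] fun a => toX (γ a)) :
    (fun a => projX e (toX (γ a)) - (ip N (toX φ) (toX (γ a)) / ip N (toX φ) (toX φ)) • toX φ)
      =o[l] fun a => toX (γ a) := by
  have hle := hG.noetherSpan_le hqo hξ
  have := L.finiteDimensional_hessKer hξ (hqo.inside hξ)
  have : FiniteDimensional ℝ (L.noetherSpan ρ ξ (qo ξ)) := Submodule.finiteDimensional_of_le hle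
  obtain ⟨m, f, hf⟩ := exists_isOrthoBasis (L.noetherSpan ρ ξ (qo ξ))
  have h1 : (fun a => projX f (toX (γ a))) =o[l] fun a => toX (γ a) := by
    simp only [projX_apply]
    refine IsLittleO.fun_sum fun i _ => ?_
    have h2 := hG.isLittleO_ip_noetherSpan hγ hz (hf.mem i)
    rw [isLittleO_iff] at h2 ⊢
    intro c hc
    filter_upwards [h2 (c := c / (‖toX (f i)‖ + 1)) (by positivity)] with a ha
    rw [norm_smul, ip_comm]
    have h3 := mul_le_mul ha (lt_add_one ‖toX (f i)‖).le (norm_nonneg (toX (f i)))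
      (by positivity : 0 ≤ c / (‖toX (f i)‖ + 1) * ‖toX (γ a)‖)
    refine h3.trans_eq ?_
    field_simp
  refine h1.congr' ?_ EventuallyEq.rfl
  filter_upwards [hγ] with a ha
  have hinv : groupProj ρ (projL e (γ a)) = projL e (γ a) :=
    (groupProj_eq_iff ρ).2 fun g => by
      rw [← hG.projL_rho hqo hξ he, (groupProj_eq_iff ρ).1 ha g]
  have h2 := h.sub_projL_eq hG hqo hξ hf (he.projL_mem (γ a)) hinv
  have h3 : projL f (projL e (γ a)) = projL f (γ a) := by
    refine Finset.sum_congr rfl fun i _ => ?_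
    rw [toX_projL, ip_comm, he.ip_projX_mem (hle (hf.mem i)), ip_comm]
  have h4 : ip N (toX φ) (toX (projL e (γ a))) = ip N (toX φ) (toX (γ a)) := by
    rw [toX_projL, ip_comm, he.ip_projX_mem h.hess, ip_comm]
  rw [h3, h4] at h2
  have h5 := congrArg toX h2
  rw [map_sub, map_smul, toX_projL, toX_projL] at h5
  rw [← h5, sub_sub_cancel]

end LagrangianFamily

/-! ### Gradients and eigenfunctions near the bifurcation point -/

namespace LagrangianFamily

open PerFun Loop

variable {N : ℕ} {L : LagrangianFamily N} {qo : ℝ → Loop N} {n : ℕ} {e : Fin n → Loop N} {ξ ξ₀ : ℝ}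
  {G : Type*} [Group G] [Fintype G] {ρ : Representation ℝ G (Loop N)} {φ : Loop N} {C δ η : ℝ}
  {u : ℝ → ℝ → Loop N}

theorem IsBranch.norm_le (hu : L.IsBranch qo e ξ₀ φ C δ η u) (hqo : L.IsSolutionFamily qo)
    (hξ₀ : ξ₀ ∈ L.param) {r : ℝ} (hξ : |ξ - ξ₀| < η) (hr : |r| < η) :
    ‖toX (u ξ r)‖ ≤ C * |r| ∧ ‖toX (dL (u ξ r))‖ ≤ C * |r| := by
  have h0 : |(0 : ℝ)| < η := by simpa using hu.η_pos
  have h1 := hu.norm_sub_le hξ hr h0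
  have h2 := hu.norm_deriv_sub_le hξ hr h0
  rw [hu.apply_zero hqo hξ₀ hξ, sub_zero, sub_zero] at h1 h2
  exact ⟨h1, h2⟩

theorem eventually_abs_lt (ξ₀ : ℝ) (hη : 0 < η) :
    ∀ᶠ p : ℝ × ℝ in 𝓝 (ξ₀, 0), |p.1 - ξ₀| < η ∧ |p.2| < η := by
  have h1 : ContinuousAt (fun p : ℝ × ℝ => |p.1 - ξ₀|) (ξ₀, 0) := by fun_prop
  have h2 : ContinuousAt (fun p : ℝ × ℝ => |p.2|) (ξ₀, 0) := by fun_prop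
  exact (h1.eventually (gt_mem_nhds (by simpa using hη))).and
    (h2.eventually (gt_mem_nhds (by simpa using hη)))

/-- Near the bifurcation point the gradient of the action on the solutions of the projected equations
is nearly proportional to the critical mode. -/
theorem IsBranch.isLittleO_elGrad (hu : L.IsBranch qo e ξ₀ φ C δ η u) (hqo : L.IsSolutionFamily qo)
    (hG : L.IsSymmetryGroup ρ qo) (hξ₀ : ξ₀ ∈ L.param)
    (he : IsOrthoBasis (L.hessKer hξ₀ (hqo.inside hξ₀)) e)
    (hφ : L.IsCriticalMode ρ ξ₀ (qo ξ₀) φ) :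
    (fun p : ℝ × ℝ => toX (L.elGrad p.1 (qo p.1 + u p.1 p.2)) -
      (ip N (toX φ) (toX (L.elGrad p.1 (qo p.1 + u p.1 p.2))) / ip N (toX φ) (toX φ)) • toX φ)
      =o[𝓝 (ξ₀, 0)] fun p => toX (L.elGrad p.1 (qo p.1 + u p.1 p.2)) := by
  obtain ⟨η', hη', hsym⟩ := hu.exists_rho_eq hqo hG hξ₀ he ((groupProj_eq_iff ρ).1 hφ.inv)
  have hC := hu.C_pos
  refine (hφ.isLittleO_projL hG hqo hξ₀ he ?_ fun I hI => isLittleO_ip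
    (z := fun p => L.noetherLoop I p.1 (qo p.1 + u p.1 p.2)) ?_ ?_).congr' ?_ EventuallyEq.rfl
  · filter_upwards [eventually_abs_lt ξ₀ hu.η_pos, eventually_abs_lt ξ₀ hη'] with p hp hp'
    refine (groupProj_eq_iff ρ).2 fun g => ?_
    have h1 := hu.mem_param hp.1
    have h2 : ρ g (qo p.1 + u p.1 p.2) = qo p.1 + u p.1 p.2 := by
      rw [map_add, hG.fixed _ h1, hsym _ _ hp'.1 hp'.2]
    rw [← hG.elGrad_rho h1 g (hu.sol hp.1 hp.2).inside, h2]
  · rw [Metric.tendsto_nhds]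
    intro ε hε
    obtain ⟨d, hd, h⟩ := hI.exists_noetherLoop_approx hqo hξ₀ (half_pos hε)
    filter_upwards [eventually_abs_lt ξ₀ hu.η_pos, eventually_abs_lt ξ₀ hd,
      eventually_abs_lt ξ₀ (div_pos hd hC)] with p hp hp' hp''
    have h1 := hu.norm_le hqo hξ₀ hp.1 hp.2
    have h2 : C * |p.2| < d := by
      rw [mul_comm]
      exact (lt_div_iff₀ hC).1 hp''.2
    rw [dist_eq_norm]
    exact ((h p.1 hp'.1 _ (h1.1.trans_lt h2) (h1.2.trans_lt h2)).2).trans_lt (half_lt_self hε)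
  · filter_upwards [eventually_abs_lt ξ₀ hu.η_pos] with p hp
    exact hI.ip_elGrad_noetherLoop (hu.mem_param hp.1) (hu.sol hp.1 hp.2).inside
  · filter_upwards [eventually_abs_lt ξ₀ hu.η_pos] with p hp
    rw [he.projX_toX (hu.sol hp.1 hp.2).grad_mem]

/-- Both operators are compared with the same `nem` at ξ, using `exists_nem_approx` once at the base
point ξ₀ and once at ξ. The comparison is made at t v with t small and then divided by t. -/
theorem eventually_norm_potHess_sub_le (hqo : L.IsSolutionFamily qo) (hξ₀ : ξ₀ ∈ L.param) {ε : ℝ}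
    (hε : 0 < ε) : ∀ᶠ ξ in 𝓝 ξ₀, ∀ hξ : ξ ∈ L.param, ∀ v : PerFun N,
      ‖mulOp (L.potHess hξ (hqo.inside hξ)) v - mulOp (L.potHess hξ₀ (hqo.inside hξ₀)) v‖ ≤
        ε * ‖v‖ := by
  obtain ⟨d, hd, h⟩ := exists_nem_approx hqo hξ₀ (half_pos hε)
  filter_upwards [Metric.ball_mem_nhds ξ₀ hd] with ξ hξd hξ v
  obtain ⟨d', hd', h'⟩ := exists_nem_approx hqo hξ (half_pos hε)
  obtain ⟨t, ht, ht0⟩ : ∃ t : ℝ, t * (‖v‖ + 1) < min d d' ∧ 0 < t :=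
    ⟨min d d' / 2 / (‖v‖ + 1), by
      rw [div_mul_cancel₀ _ (by positivity)]
      exact half_lt_self (by positivity), by positivity⟩
  have h1 : ‖t • v‖ < min d d' := by
    rw [norm_smul, Real.norm_eq_abs, abs_of_pos ht0]
    nlinarith
  have h2 := (h ξ (by rwa [mem_ball_iff_norm, Real.norm_eq_abs] at hξd)).2.2 (t • v) 0
    (h1.trans_le (min_le_left _ _)) (by simpa using hd)
  have h3 := (h' ξ (by simpa using hd')).2.2 (t • v) 0
    (h1.trans_le (min_le_right _ _)) (by simpa using hd')
  rw [nem_zero hqo hξ, sub_zero, sub_zero] at h2 h3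
  have h4 : t * ‖mulOp (L.potHess hξ (hqo.inside hξ)) v -
      mulOp (L.potHess hξ₀ (hqo.inside hξ₀)) v‖ ≤ t * (ε * ‖v‖) := by
    have h5 : t * ‖mulOp (L.potHess hξ (hqo.inside hξ)) v -
        mulOp (L.potHess hξ₀ (hqo.inside hξ₀)) v‖ =
        ‖(L.nem qo ξ (t • v) - mulOp (L.potHess hξ₀ (hqo.inside hξ₀)) (t • v)) -
          (L.nem qo ξ (t • v) - mulOp (L.potHess hξ (hqo.inside hξ)) (t • v))‖ := by
      rw [sub_sub_sub_cancel_left, map_smul, map_smul, ← smul_sub t (mulOp (L.potHess hξ (hqo.inside hξ)) v),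
        norm_smul, Real.norm_eq_abs, abs_of_pos ht0]
    rw [h5]
    refine (norm_sub_le _ _).trans ?_
    rw [norm_smul, Real.norm_eq_abs, abs_of_pos ht0] at h2 h3
    linarith
  exact le_of_mul_le_mul_left h4 ht0

/-- Eigenfunctions for small eigenvalues are nearly zero modes. -/
theorem isLittleO_sub_projX (hqo : L.IsSolutionFamily qo) (hξ₀ : ξ₀ ∈ L.param)
    (he : IsOrthoBasis (L.hessKer hξ₀ (hqo.inside hξ₀)) e) {κ : ℝ → ℝ} {ψ : ℝ → Loop N}
    (hκ : Tendsto κ (𝓝 ξ₀) (𝓝 0)) (hψ : ∀ ξ ∈ L.param, L.hessLoop ξ (qo ξ) (ψ ξ) = κ ξ • ψ ξ) :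
    (fun ξ => toX (ψ ξ) - projX e (toX (ψ ξ))) =o[𝓝 ξ₀] fun ξ => toX (ψ ξ) := by
  obtain ⟨D, hD⟩ := L.exists_linearized_equiv hξ₀ (hqo.inside hξ₀) he
  set V := mulOp (L.potHess hξ₀ (hqo.inside hξ₀)) with hV
  have hmem := L.isOpen_param.mem_nhds hξ₀
  have hcI : ContinuousAt (fun ξ => post (L.massInv ξ)) ξ₀ :=
    continuous_post.continuousAt.comp (L.continuousOn_massInv.continuousAt hmem)
  set B := ‖post (L.massInv ξ₀)‖ + 1 with hB
  have hB0 : 0 < B := by positivity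
  set S := ‖(D.symm : PerFun N →L[ℝ] PerFun N)‖ * ‖green N‖ with hS
  have hS0 : 0 ≤ S := by positivity
  rw [isLittleO_iff]
  intro c hc
  set ε := c / ((S + 1) * (‖V‖ + B + B + 1)) with hε
  have hε0 : 0 < ε := by positivity
  have ev1 : ∀ᶠ ξ in 𝓝 ξ₀, ‖post (L.massInv ξ) - post (L.massInv ξ₀)‖ < min ε 1 :=
    (hcI.eventually (Metric.ball_mem_nhds (post (L.massInv ξ₀)) (by positivity : 0 < min ε 1))).mono
      fun ξ h => lt_of_eq_of_lt (dist_eq_norm (post (L.massInv ξ)) (post (L.massInv ξ₀))).symm h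
  have ev2 : ∀ᶠ ξ in 𝓝 ξ₀, |κ ξ| < ε :=
    (hκ.eventually (Metric.ball_mem_nhds 0 hε0)).mono fun ξ h => by
      rwa [Real.dist_eq, sub_zero] at h
  filter_upwards [hmem, ev1, ev2, eventually_norm_potHess_sub_le hqo hξ₀ hε0] with ξ hξ h1 h2 h3
  have h3 := h3 hξ (toX (ψ ξ))
  set x := toX (ψ ξ) with hx
  set k := projL e (ψ ξ) with hk
  have hk0 : L.hessLoop ξ₀ (qo ξ₀) k = 0 := he.projL_mem _
  have hk1 : toX k = projX e x := toX_projL e _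
  have hODE : toX (dL (dL (ψ ξ))) = post (L.massInv ξ)
      (mulOp (L.potHess hξ (hqo.inside hξ)) x - κ ξ • x) := by
    have h4 := L.toX_hessLoop hξ (hqo.inside hξ) (ψ ξ)
    rw [hψ ξ hξ, map_smul] at h4
    have h5 : mulOp (L.potHess hξ (hqo.inside hξ)) x - κ ξ • x =
        post (L.massM ξ) (toX (dL (dL (ψ ξ)))) := by
      rw [h4]; abel
    rw [h5, L.post_massInv_massM hξ]
  have hDk : D (toX k) = green N (post (L.massInv ξ₀) (toX k)) := by
    have h4 := (eq_green_iff (u := toX k) (z := toX (dL (dL k)))).2 ⟨_, isDeriv_toX _, isDeriv_toX _⟩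
    have h5 := toX_dL_dL_of_hessLoop_eq_zero hξ₀ (hqo.inside hξ₀) he hk0
    rw [hD]
    nth_rewrite 1 [h4]
    rw [← map_sub, h5]
    congr 1
    change _ - (post (L.massInv ξ₀) (V (toX k) + projX e (toX k)) - _) - (_ - _) = _
    abel
  have hDx : D x = green N (post (L.massInv ξ₀) (V x) + post (L.massInv ξ₀) (projX e x) -
      toX (dL (dL (ψ ξ)))) := by
    have h4 := (eq_green_iff (u := x) (z := toX (dL (dL (ψ ξ))))).2 ⟨_, isDeriv_toX _, isDeriv_toX _⟩
    rw [hD]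
    nth_rewrite 1 [h4]
    rw [← map_sub, map_add]
    congr 1
    abel
  -- D is invertible, so it suffices to bound this image. It is the defect of ψ in the equation for
  -- zero modes at ξ₀, small because masses, potential and eigenvalue vary continuously there. No
  -- continuity of ψ in ξ is used.
  have hDd : D (x - projX e x) = green N (post (L.massInv ξ₀) (V x) - toX (dL (dL (ψ ξ)))) := by
    rw [← hk1, map_sub, hDx, hDk, ← map_sub, hk1]
    congr 1
    abel
  have hrest : post (L.massInv ξ₀) (V x) - toX (dL (dL (ψ ξ))) =
      - (post (L.massInv ξ) - post (L.massInv ξ₀)) (V x) - post (L.massInv ξ)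
        (mulOp (L.potHess hξ (hqo.inside hξ)) x - V x) + κ ξ • post (L.massInv ξ) x := by
    rw [hODE, map_sub, map_sub, map_smul]
    change _ = - (post (L.massInv ξ) (V x) - post (L.massInv ξ₀) (V x)) - _ + _
    abel
  have hBξ : ‖post (L.massInv ξ)‖ ≤ B := by
    have := norm_le_insert' (post (L.massInv ξ)) (post (L.massInv ξ₀))
    have := h1.trans_le (min_le_right _ _)
    linarith
  have e1 : ‖(post (L.massInv ξ) - post (L.massInv ξ₀)) (V x)‖ ≤ ε * (‖V‖ * ‖x‖) :=
    (ContinuousLinearMap.le_opNorm _ _).trans (mul_le_mul (h1.trans_le (min_le_left _ _)).le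
      (V.le_opNorm x) (norm_nonneg _) hε0.le)
  have e2 : ‖post (L.massInv ξ) (mulOp (L.potHess hξ (hqo.inside hξ)) x - V x)‖ ≤
      B * (ε * ‖x‖) :=
    (ContinuousLinearMap.le_opNorm _ _).trans (mul_le_mul hBξ h3 (norm_nonneg _) hB0.le)
  have e3 : ‖κ ξ • post (L.massInv ξ) x‖ ≤ ε * (B * ‖x‖) := by
    rw [norm_smul, Real.norm_eq_abs]
    exact mul_le_mul h2.le ((ContinuousLinearMap.le_opNorm _ _).trans
      (mul_le_mul_of_nonneg_right hBξ (norm_nonneg _))) (norm_nonneg _) hε0.le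
  have e4 : ‖post (L.massInv ξ₀) (V x) - toX (dL (dL (ψ ξ)))‖ ≤
      (‖V‖ + B + B) * ε * ‖x‖ := by
    rw [hrest]
    refine (norm_add_le _ _).trans ?_
    have := norm_sub_le (- (post (L.massInv ξ) - post (L.massInv ξ₀)) (V x))
      (post (L.massInv ξ) (mulOp (L.potHess hξ (hqo.inside hξ)) x - V x))
    rw [norm_neg] at this
    linarith
  have e5 : ‖x - projX e x‖ ≤ S * ‖post (L.massInv ξ₀) (V x) - toX (dL (dL (ψ ξ)))‖ := by
    have h4 := (D.symm : PerFun N →L[ℝ] PerFun N).le_opNorm (D (x - projX e x))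
    rw [ContinuousLinearEquiv.coe_coe, ContinuousLinearEquiv.symm_apply_apply] at h4
    refine h4.trans ?_
    rw [hDd, hS, mul_assoc]
    exact mul_le_mul_of_nonneg_left ((green N).le_opNorm _) (norm_nonneg _)
  refine e5.trans ((mul_le_mul_of_nonneg_left e4 hS0).trans ?_)
  rw [← mul_assoc]
  refine mul_le_mul_of_nonneg_right ?_ (norm_nonneg _)
  have h6 : ε * ((S + 1) * (‖V‖ + B + B + 1)) = c := by
    rw [hε]
    exact div_mul_cancel₀ _ (by positivity)
  rw [← h6]
  have h7 : S * (‖V‖ + B + B) ≤ (S + 1) * (‖V‖ + B + B + 1) :=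
    mul_le_mul (by linarith) (by linarith) (by positivity) (by positivity)
  nlinarith

/-- Near the bifurcation point the eigenfunctions are nearly proportional to the critical mode. -/
theorem isLittleO_eigenfunction (hqo : L.IsSolutionFamily qo)
    (hG : L.IsSymmetryGroup ρ qo) (hξ₀ : ξ₀ ∈ L.param)
    (he : IsOrthoBasis (L.hessKer hξ₀ (hqo.inside hξ₀)) e)
    (hφ : L.IsCriticalMode ρ ξ₀ (qo ξ₀) φ) {κ : ℝ → ℝ} {ψ : ℝ → Loop N}
    (hκ : Tendsto κ (𝓝 ξ₀) (𝓝 0)) (hψ : ∀ ξ ∈ L.param, ψ ξ ∈ L.eigenfunctions ξ (qo ξ) (κ ξ))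
    (hinv : ∀ ξ ∈ L.param, groupProj ρ (ψ ξ) = ψ ξ) :
    (fun ξ => toX (ψ ξ) - (ip N (toX φ) (toX (ψ ξ)) / ip N (toX φ) (toX φ)) • toX φ)
      =o[𝓝 ξ₀] fun ξ => toX (ψ ξ) := by
  have hmem := L.isOpen_param.mem_nhds hξ₀
  have hψ' : ∀ ξ (hξ : ξ ∈ L.param), _ := fun ξ hξ =>
    (mem_eigenfunctions_iff hξ (hqo.inside hξ)).1 (hψ ξ hξ)
  have h1 := isLittleO_sub_projX hqo hξ₀ he hκ fun ξ hξ => (hψ' ξ hξ).1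
  have h2 := hφ.isLittleO_projL (l := 𝓝 ξ₀) (γ := ψ) hG hqo hξ₀ he
    (by filter_upwards [hmem] with ξ hξ using hinv ξ hξ) fun I hI => isLittleO_ip
      (z := fun ξ => L.noetherLoop I ξ (qo ξ)) (by
        rw [Metric.tendsto_nhds]
        intro ε hε
        obtain ⟨d, hd, h⟩ := hI.exists_noetherLoop_approx hqo hξ₀ (half_pos hε)
        filter_upwards [Metric.ball_mem_nhds ξ₀ hd] with ξ hξ
        rw [mem_ball_iff_norm, Real.norm_eq_abs] at hξ
        have h3 := (h ξ hξ 0 (by simpa using hd) (by simpa using hd)).2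
        rw [add_zero] at h3
        rw [dist_eq_norm]
        exact h3.trans_lt (half_lt_self hε)) (by
        filter_upwards [hmem] with ξ hξ
        rw [ip_comm]
        exact (hψ' ξ hξ).2 I hI)
  refine (h1.add h2).congr_left fun ξ => ?_
  abel

end LagrangianFamily

/-! ### The bifurcation function: zeros, sign and continuity -/

/-- Each relative error is below 1, so X shares its sign with P and with Q; Q = 0 would force X = 0.
-/
theorem mul_pos_of_abs_sub_le {X P Q B : ℝ} (hB : 0 < B) (hP : P ≠ 0)
    (h : |X - P * B| ≤ 3 / 4 * (|P| * B)) (h' : |X - Q * B| ≤ |Q| * B / 2) : 0 < P * Q := by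
  have h1 : 0 < X * P := by
    rcases lt_or_gt_of_ne hP with hn | hn
    · rw [abs_of_neg hn] at h
      have := (abs_le.1 h).2
      exact mul_pos_of_neg_of_neg (by nlinarith) hn
    · rw [abs_of_pos hn] at h
      have := (abs_le.1 h).1
      exact mul_pos (by nlinarith) hn
  have h2 : 0 < X * Q := by
    rcases lt_trichotomy Q 0 with hn | hn | hn
    · rw [abs_of_neg hn] at h'
      have := (abs_le.1 h').2
      exact mul_pos_of_neg_of_neg (by nlinarith) hn
    · rw [hn, abs_zero, zero_mul, zero_div, sub_zero, abs_nonpos_iff] at h'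
      rw [h', zero_mul] at h1
      exact absurd h1 (lt_irrefl _)
    · rw [abs_of_pos hn] at h'
      have := (abs_le.1 h').1
      exact mul_pos (by nlinarith) hn
  have h3 := mul_pos h1 h2
  have h4 : X * P * (X * Q) = X ^ 2 * (P * Q) := by ring
  rw [h4] at h3
  exact pos_of_mul_pos_right h3 (sq_nonneg X)

namespace PerFun

open Loop

variable {N : ℕ}

theorem norm_le_of_near {φ x : PerFun N} {ε a : ℝ} (hε : ε ≤ 1 / 2) (h : ‖x - a • φ‖ ≤ ε * ‖x‖) :
    ‖x‖ ≤ 2 * (|a| * ‖φ‖) := by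
  have h1 := norm_le_insert' x (a • φ)
  have h2 : ‖a • φ‖ = |a| * ‖φ‖ := by rw [norm_smul, Real.norm_eq_abs]
  nlinarith [norm_nonneg x]

/-- The inner product of functions that are nearly proportional to `φ`. -/
theorem exists_abs_ip_sub_le {φ : PerFun N} (hφ : 0 < ip N φ φ) :
    ∃ ε > 0, ε ≤ 1 / 2 ∧ ∀ (x y : PerFun N) (a b : ℝ), ‖x - a • φ‖ ≤ ε * ‖x‖ →
      ‖y - b • φ‖ ≤ ε * ‖y‖ → |ip N x y - a * b * ip N φ φ| ≤ |a * b| * ip N φ φ / 2 := by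
  set B := ip N φ φ with hB
  set M := ‖φ‖ with hM
  set ε := min (1 / 2) (B / (12 * M ^ 2 + 1)) with hε
  have hε0 : 0 < ε := by positivity
  have hε1 : ε ≤ 1 / 2 := min_le_left _ _
  have hε2 : ε * (12 * M ^ 2) ≤ B := by
    have := (le_div_iff₀ (by positivity)).1 (min_le_right (1 / 2) (B / (12 * M ^ 2 + 1)))
    rw [← hε] at this
    linarith
  refine ⟨ε, hε0, hε1, fun x y a b hx hy => ?_⟩
  have h1 := norm_le_of_near hε1 hx
  have h2 := norm_le_of_near hε1 hy
  have h3 : ‖x - a • φ‖ ≤ 2 * ε * M * |a| :=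
    hx.trans ((mul_le_mul_of_nonneg_left h1 hε0.le).trans_eq (by ring))
  have h4 : ‖y - b • φ‖ ≤ 2 * ε * M * |b| :=
    hy.trans ((mul_le_mul_of_nonneg_left h2 hε0.le).trans_eq (by ring))
  have h5 : ip N x y - a * b * B = ip N (x - a • φ) y + a * ip N φ (y - b • φ) := by
    simp only [map_sub, map_smul, sub_apply, smul_apply, smul_eq_mul]
    rw [← hB]
    ring
  have h6 : |ip N (x - a • φ) y| ≤ 2 * ε * M * |a| * (2 * (|b| * M)) :=
    (abs_ip_le _ _).trans (mul_le_mul h3 h2 (norm_nonneg _) (by positivity))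
  have h7 : |a * ip N φ (y - b • φ)| ≤ |a| * (M * (2 * ε * M * |b|)) := by
    rw [abs_mul]
    exact mul_le_mul_of_nonneg_left ((abs_ip_le _ _).trans
      (mul_le_mul_of_nonneg_left h4 (norm_nonneg _))) (abs_nonneg _)
  rw [h5, abs_mul]
  refine (abs_add_le _ _).trans ?_
  have h8 : 0 ≤ |a| * |b| := by positivity
  nlinarith

end PerFun

namespace LagrangianFamily

open PerFun Loop

variable {N : ℕ} {L : LagrangianFamily N} {qo : ℝ → Loop N} {n : ℕ} {e : Fin n → Loop N} {ξ ξ₀ : ℝ}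
  {G : Type*} [Group G] [Fintype G] {ρ : Representation ℝ G (Loop N)} {φ : Loop N} {C δ η : ℝ}
  {u : ℝ → ℝ → Loop N}

variable (L qo φ u) in
/-- The bifurcation function: the component of the gradient of the action along the critical mode. -/
def bifFun (ξ r : ℝ) : ℝ := ip N (toX φ) (toX (L.elGrad ξ (qo ξ + u ξ r)))

theorem exists_box {p : ℝ × ℝ → Prop} (h : ∀ᶠ x : ℝ × ℝ in 𝓝 (ξ₀, 0), p x) :
    ∃ η > 0, ∀ ξ r, |ξ - ξ₀| < η → |r| < η → p (ξ, r) := by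
  obtain ⟨η, hη, h⟩ := Metric.eventually_nhds_iff.1 h
  refine ⟨η, hη, fun ξ r hξ hr => h (y := (ξ, r)) ?_⟩
  rw [Prod.dist_eq, Real.dist_eq, Real.dist_eq, sub_zero]
  exact max_lt hξ hr

/-- When the component along φ vanishes, the gradient is at most half its own norm. -/
theorem IsBranch.exists_elGrad_eq_zero (hu : L.IsBranch qo e ξ₀ φ C δ η u)
    (hqo : L.IsSolutionFamily qo) (hG : L.IsSymmetryGroup ρ qo) (hξ₀ : ξ₀ ∈ L.param)
    (he : IsOrthoBasis (L.hessKer hξ₀ (hqo.inside hξ₀)) e)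
    (hφ : L.IsCriticalMode ρ ξ₀ (qo ξ₀) φ) :
    ∃ η' > 0, ∀ ξ r, |ξ - ξ₀| < η' → |r| < η' → L.bifFun qo φ u ξ r = 0 →
      L.elGrad ξ (qo ξ + u ξ r) = 0 := by
  have h := (isLittleO_iff.1 (hu.isLittleO_elGrad hqo hG hξ₀ he hφ)) (c := 1 / 2) (by norm_num)
  obtain ⟨η', hη', h'⟩ := exists_box (ξ₀ := ξ₀) h
  refine ⟨η', hη', fun ξ r hξ hr h0 => ?_⟩
  have h1 := norm_le_of_near le_rfl (h' ξ r hξ hr)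
  simp only [bifFun] at h0
  rw [h0, zero_div, abs_zero, zero_mul, mul_zero] at h1
  exact toX_injective (by rw [norm_le_zero_iff.1 h1, map_zero])

theorem ip_elGrad (hqo : L.IsSolutionFamily qo) (hξ : ξ ∈ L.param) {v : Loop N}
    (hv : L.Inside (qo ξ + v)) (ψ : Loop N) :
    ip N (toX ψ) (toX (L.elGrad ξ (qo ξ + v))) =
      - ip N (post (L.massM ξ) (toX (dL (dL ψ)))) (toX v) + ip N (toX ψ) (L.nem qo ξ (toX v)) := by
  rw [toX_elGrad hqo hξ hv, map_add, map_neg, massM, ip_toX_post]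

/-- Self-adjointness moves the linear part of the gradient onto ψ, where it becomes multiplication
by κ. -/
theorem ip_elGrad_eigenfunction (hqo : L.IsSolutionFamily qo) (hξ : ξ ∈ L.param) {v ψ : Loop N}
    (hv : L.Inside (qo ξ + v)) {κ : ℝ} (hψ : L.hessLoop ξ (qo ξ) ψ = κ • ψ) :
    ip N (toX (L.elGrad ξ (qo ξ + v))) (toX ψ) = κ * ip N (toX v) (toX ψ) +
      ip N (L.nem qo ξ (toX v) - mulOp (L.potHess hξ (hqo.inside hξ)) (toX v)) (toX ψ) := by
  rw [ip_comm, ip_elGrad hqo hξ hv]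
  have h1 := L.toX_hessLoop hξ (hqo.inside hξ) ψ
  rw [hψ, map_smul] at h1
  have h2 : post (L.massM ξ) (toX (dL (dL ψ))) =
      mulOp (L.potHess hξ (hqo.inside hξ)) (toX ψ) - κ • toX ψ := by rw [h1]; abel
  rw [h2, map_sub, map_sub, map_smul]
  simp only [sub_apply, smul_apply, smul_eq_mul]
  rw [ip_mulOp_potHess, ip_comm (toX v) (toX ψ), ip_comm (L.nem qo ξ (toX v)),
    ip_comm _ (toX ψ)]
  ring

/-- The sign of the bifurcation function near the trivial solutions. -/
theorem IsBranch.exists_bifFun_pos (hu : L.IsBranch qo e ξ₀ φ C δ η u)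
    (hqo : L.IsSolutionFamily qo) (hG : L.IsSymmetryGroup ρ qo) (hξ₀ : ξ₀ ∈ L.param)
    (he : IsOrthoBasis (L.hessKer hξ₀ (hqo.inside hξ₀)) e)
    (hφ : L.IsCriticalMode ρ ξ₀ (qo ξ₀) φ) {κ : ℝ → ℝ} {ψ : ℝ → Loop N}
    (hκ : Tendsto κ (𝓝 ξ₀) (𝓝 0)) (hψ : ∀ ξ ∈ L.param, ψ ξ ∈ L.eigenfunctions ξ (qo ξ) (κ ξ))
    (hinv : ∀ ξ ∈ L.param, groupProj ρ (ψ ξ) = ψ ξ) (hne : ∀ ξ ∈ L.param, ψ ξ ≠ 0) :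
    ∃ η' > 0, ∀ ξ, |ξ - ξ₀| < η' → κ ξ ≠ 0 →
      ∃ r₀ > 0, ∀ r, r ≠ 0 → |r| < r₀ → 0 < κ ξ * L.bifFun qo φ u ξ r * r := by
  set B := ip N (toX φ) (toX φ) with hB
  have hB0 : 0 < B := ip_self_pos hφ.ne_zero
  obtain ⟨ε, hε, hε1, hnear⟩ := exists_abs_ip_sub_le (φ := toX φ) hB0
  obtain ⟨η₁, hη₁, h₁⟩ := exists_box (ξ₀ := ξ₀)
    (isLittleO_iff.1 (hu.isLittleO_elGrad hqo hG hξ₀ he hφ) hε)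
  obtain ⟨η₂, hη₂, h₂⟩ := Metric.eventually_nhds_iff.1
    (isLittleO_iff.1 (isLittleO_eigenfunction hqo hG hξ₀ he hφ hκ hψ hinv) hε)
  have hM : 0 < ‖toX φ‖ := by
    rw [norm_pos_iff]
    intro h0
    rw [hB, h0, map_zero] at hB0
    exact lt_irrefl _ hB0
  -- Solves ε' = ε (‖φ‖ - ε'), so that an error ε' |r| is at most ε ‖v‖ by the lower bound ‖v‖ ≥
  -- (‖φ‖ - ε') |r|.
  set ε' := ε * ‖toX φ‖ / (1 + ε) with hε'
  have hε'0 : 0 < ε' := by positivity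
  have hε'1 : ε' + ε * ε' = ε * ‖toX φ‖ := by
    rw [hε']; field_simp
  obtain ⟨η₃, hη₃, h₃⟩ := hu.direction ε' hε'0
  have hη := hu.η_pos
  have hC := hu.C_pos
  refine ⟨min (min η₁ η₂) (min η₃ η), by positivity, fun ξ hξ hκ0 => ?_⟩
  simp only [lt_min_iff] at hξ
  have hp := hu.mem_param hξ.2.2
  set b := ip N (toX φ) (toX (ψ ξ)) / B with hb
  have hyb := h₂ (y := ξ) (by rw [Real.dist_eq]; exact hξ.1.2)
  have hψ1 := (mem_eigenfunctions_iff hp (hqo.inside hp)).1 (hψ ξ hp)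
  have hb0 : b ≠ 0 := by
    intro h0
    have h4 := norm_le_of_near hε1 hyb
    rw [← hB, ← hb, h0, abs_zero, zero_mul, mul_zero] at h4
    exact hne ξ hp (toX_injective (by rw [norm_le_zero_iff.1 h4, map_zero]))
  -- The nonlinear remainder has to be small against κ(ξ) r, so the admissible range of r depends on
  -- ξ.
  set ε₄ := |κ ξ| * |b| * B / (4 * (C * ‖toX (ψ ξ)‖ + 1)) with hε₄
  have hκb : 0 < |κ ξ| * |b| := mul_pos (abs_pos.2 hκ0) (abs_pos.2 hb0)
  have hε₄0 : 0 < ε₄ := by positivity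
  have hε₄1 : ε₄ * (C * ‖toX (ψ ξ)‖) ≤ |κ ξ| * |b| * B / 4 := by
    have h4 : ε₄ * (C * ‖toX (ψ ξ)‖ + 1) = |κ ξ| * |b| * B / 4 := by
      rw [hε₄]; field_simp
    nlinarith
  obtain ⟨d, hd, hdn⟩ := exists_nem_approx hqo hp hε₄0
  refine ⟨min (min η₁ η) (min η₃ (d / C)), by positivity, fun r hr0 hr => ?_⟩
  simp only [lt_min_iff] at hr
  have hs := hu.sol hξ.2.2 hr.1.2
  have hv := (hu.norm_le hqo hξ₀ hξ.2.2 hr.1.2).1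
  set v := u ξ r with hvdef
  set γ := L.elGrad ξ (qo ξ + v) with hγ
  set a := L.bifFun qo φ u ξ r / B with ha
  have hxa : ‖toX γ - a • toX φ‖ ≤ ε * ‖toX γ‖ := h₁ ξ r hξ.1.1 hr.1.1
  have h4 := hnear (toX γ) (toX (ψ ξ)) a b hxa hyb
  have hvr : ‖toX v - r • toX φ‖ ≤ ε * ‖toX v‖ := by
    have h5 := ((c1Le_iff (by positivity)).1 (h₃ ξ r hξ.2.1 hr.2.1)).1
    rw [map_sub, map_smul] at h5
    refine h5.trans ?_
    have h6 := norm_le_insert (toX v) (r • toX φ)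
    rw [norm_smul, Real.norm_eq_abs] at h6
    have h7 : |r| * ‖toX φ‖ - ε' * |r| ≤ ‖toX v‖ := by linarith
    have h8 : ε' * |r| = ε * (|r| * ‖toX φ‖ - ε' * |r|) := by
      linear_combination |r| * hε'1
    rw [h8]
    exact mul_le_mul_of_nonneg_left h7 hε.le
  have h5 := hnear (toX v) (toX (ψ ξ)) r b hvr hyb
  rw [← hB] at h4 h5
  set X := ip N (toX γ) (toX (ψ ξ)) with hX
  set Y := ip N (toX v) (toX (ψ ξ)) with hY
  have h6 : |X - κ ξ * Y| ≤ |κ ξ| * |b| * B / 4 * |r| := by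
    rw [hX, hγ, ip_elGrad_eigenfunction hqo hp hs.inside hψ1.1, add_sub_cancel_left]
    have hvd : ‖toX v‖ < d := by
      refine hv.trans_lt ?_
      rw [mul_comm]
      exact (lt_div_iff₀ hC).1 hr.2.2
    have h7 := (hdn ξ (by simpa using hd)).2.2 (toX v) 0 hvd (by simpa using hd)
    rw [nem_zero hqo hp, sub_zero, sub_zero] at h7
    refine (abs_ip_le _ _).trans ?_
    calc _ ≤ (ε₄ * (C * |r|)) * ‖toX (ψ ξ)‖ := mul_le_mul_of_nonneg_right
          (h7.trans (mul_le_mul_of_nonneg_left hv hε₄0.le)) (norm_nonneg _)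
      _ = ε₄ * (C * ‖toX (ψ ξ)‖) * |r| := by ring
      _ ≤ _ := mul_le_mul_of_nonneg_right hε₄1 (abs_nonneg r)
  -- The factor 3/4 adds 1/4 from the nonlinear remainder and 1/2 from the pairing of nearly
  -- parallel functions.
  have h7 : |X - κ ξ * r * b * B| ≤ 3 / 4 * (|κ ξ * r * b| * B) := by
    have h8 : |κ ξ * (Y - r * b * B)| ≤ |κ ξ| * (|r * b| * B / 2) := by
      rw [abs_mul]
      exact mul_le_mul_of_nonneg_left h5 (abs_nonneg _)
    have h9 : X - κ ξ * r * b * B = (X - κ ξ * Y) + κ ξ * (Y - r * b * B) := by ring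
    rw [h9]
    refine (abs_add_le _ _).trans ((add_le_add h6 h8).trans_eq ?_)
    rw [abs_mul, abs_mul, abs_mul]
    ring
  have key : 0 < κ ξ * r * a := by
    have h8 := mul_pos_of_abs_sub_le hB0 (mul_ne_zero (mul_ne_zero hκ0 hr0) hb0) h7 h4
    have h9 : κ ξ * r * b * (a * b) = b ^ 2 * (κ ξ * r * a) := by ring
    rw [h9] at h8
    exact pos_of_mul_pos_right h8 (sq_nonneg b)
  have h12 : κ ξ * L.bifFun qo φ u ξ r * r = κ ξ * r * a * B := by
    rw [ha]; field_simp
  rw [h12]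
  exact mul_pos key hB0

/-- Separate continuity is enough, because the intermediate value theorem is used in one variable at
a time. With the second derivative moved to φ (`ip_elGrad`), C⁰ continuity of the branch suffices.
-/
theorem IsBranch.exists_continuousAt_bifFun (hu : L.IsBranch qo e ξ₀ φ C δ η u)
    (hqo : L.IsSolutionFamily qo) (hξ₀ : ξ₀ ∈ L.param) :
    ∃ η' > 0, ∀ ξ r, |ξ - ξ₀| < η' → |r| < η' →
      ContinuousAt (fun ξ => L.bifFun qo φ u ξ r) ξ ∧ ContinuousAt (fun r => L.bifFun qo φ u ξ r) r := by
  obtain ⟨d, hd, h⟩ := exists_nem_approx hqo hξ₀ one_pos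
  have hη := hu.η_pos
  have hC := hu.C_pos
  set V := mulOp (L.potHess hξ₀ (hqo.inside hξ₀)) with hV
  have hlip : ∀ ξ, |ξ - ξ₀| < d → ∀ v v' : PerFun N, ‖v‖ < d → ‖v'‖ < d →
      ‖L.nem qo ξ v - L.nem qo ξ v'‖ ≤ (‖V‖ + 1) * ‖v - v'‖ := by
    intro ξ hξ v v' hv hv'
    have h4 := (h ξ hξ).2.2 v v' hv hv'
    have h5 := norm_le_insert' (L.nem qo ξ v - L.nem qo ξ v') (V (v - v'))
    have h6 := V.le_opNorm (v - v')
    linarith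
  refine ⟨min η (min d (d / C)), by positivity, fun ξ₁ r₁ hξ₁ hr₁ => ?_⟩
  have hevξ : ∀ᶠ ξ in 𝓝 ξ₁, |ξ - ξ₀| < min η (min d (d / C)) :=
    (isOpen_lt (by fun_prop) continuous_const).mem_nhds hξ₁
  have hevr : ∀ᶠ r in 𝓝 r₁, |r| < min η (min d (d / C)) :=
    (isOpen_lt (by fun_prop) continuous_const).mem_nhds hr₁
  simp only [lt_min_iff] at hξ₁ hr₁ hevξ hevr
  have hsm : ∀ ξ r, |ξ - ξ₀| < η → |r| < η → |r| < d / C → ‖toX (u ξ r)‖ < d := by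
    intro ξ r hξ hr hr'
    refine (hu.norm_le hqo hξ₀ hξ hr).1.trans_lt ?_
    rw [mul_comm]
    exact (lt_div_iff₀ hC).1 hr'
  have hp := hu.mem_param hξ₁.1
  have hv₁ := hsm ξ₁ r₁ hξ₁.1 hr₁.1 hr₁.2.2
  constructor
  · have hc := hu.continuousAt hξ₁.1 hr₁.1
    have hcM : ContinuousAt (fun ξ => post (L.massM ξ) (toX (dL (dL φ)))) ξ₁ :=
      (continuous_post.continuousAt.comp (L.continuousOn_massM.continuousAt
        (L.isOpen_param.mem_nhds hp))).clm_apply continuousAt_const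
    have hn0 := continuousAt_nem hqo hp (u := toX (u ξ₁ r₁)) ((h ξ₁ hξ₁.2.1).2.1 _ hv₁)
    have hdiff : Tendsto (fun ξ => L.nem qo ξ (toX (u ξ r₁)) - L.nem qo ξ (toX (u ξ₁ r₁)))
        (𝓝 ξ₁) (𝓝 0) := by
      have h5 := (tendsto_iff_norm_sub_tendsto_zero.1 hc).const_mul (‖V‖ + 1)
      rw [mul_zero] at h5
      refine squeeze_zero_norm' ?_ h5
      filter_upwards [hevξ] with ξ hξ
      exact hlip ξ hξ.2.1 _ _ (hsm ξ r₁ hξ.1 hr₁.1 hr₁.2.2) hv₁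
    have hn : ContinuousAt (fun ξ => L.nem qo ξ (toX (u ξ r₁))) ξ₁ := by
      have h6 := hdiff.add hn0
      rw [zero_add] at h6
      exact h6.congr fun ξ => by abel
    have htot : ContinuousAt (fun ξ => - ip N (post (L.massM ξ) (toX (dL (dL φ)))) (toX (u ξ r₁)) +
        ip N (toX φ) (L.nem qo ξ (toX (u ξ r₁)))) ξ₁ :=
      (((ip N).continuous.continuousAt.comp hcM).clm_apply hc).neg.add
        ((ip N (toX φ)).continuous.continuousAt.comp hn)
    refine htot.congr ?_
    filter_upwards [hevξ] with ξ hξ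
    exact (ip_elGrad hqo (hu.mem_param hξ.1) (hu.sol hξ.1 hr₁.1).inside φ).symm
  · have hc : Tendsto (fun r => toX (u ξ₁ r)) (𝓝 r₁) (𝓝 (toX (u ξ₁ r₁))) := by
      rw [tendsto_iff_norm_sub_tendsto_zero]
      have h5 : Tendsto (fun r => C * |r - r₁|) (𝓝 r₁) (𝓝 0) := by
        have : ContinuousAt (fun r => C * |r - r₁|) r₁ := by fun_prop
        simpa [ContinuousAt] using this
      refine squeeze_zero' (Eventually.of_forall fun _ => norm_nonneg _) ?_ h5
      filter_upwards [hevr] with r hr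
      rw [← map_sub]
      exact hu.norm_sub_le hξ₁.1 hr.1 hr₁.1
    have hn : Tendsto (fun r => L.nem qo ξ₁ (toX (u ξ₁ r))) (𝓝 r₁)
        (𝓝 (L.nem qo ξ₁ (toX (u ξ₁ r₁)))) := by
      rw [tendsto_iff_norm_sub_tendsto_zero]
      have h5 := (tendsto_iff_norm_sub_tendsto_zero.1 hc).const_mul (‖V‖ + 1)
      rw [mul_zero] at h5
      refine squeeze_zero' (Eventually.of_forall fun _ => norm_nonneg _) ?_ h5
      filter_upwards [hevr] with r hr
      exact hlip ξ₁ hξ₁.2.1 _ _ (hsm ξ₁ r hξ₁.1 hr.1 hr.2.2) hv₁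
    have htot : ContinuousAt (fun r => - ip N (post (L.massM ξ₁) (toX (dL (dL φ)))) (toX (u ξ₁ r)) +
        ip N (toX φ) (L.nem qo ξ₁ (toX (u ξ₁ r)))) r₁ :=
      (((ip N _).continuous.tendsto _).comp hc).neg.add
        (((ip N (toX φ)).continuous.tendsto _).comp hn)
    refine htot.congr ?_
    filter_upwards [hevr] with r hr
    exact (ip_elGrad hqo hp (hu.sol hξ₁.1 hr.1).inside φ).symm

/-- The gradient lies in the kernel, so only the kernel component r φ of the branch enters the first
variation: ⟨γ, u(r') - u(r)⟩ = (r' - r)⟨γ, φ⟩. Thus u need not be differentiable in r; its C¹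
Lipschitz bound controls the remainder. -/
theorem IsBranch.hasDerivAt_action (hu : L.IsBranch qo e ξ₀ φ C δ η u)
    (hqo : L.IsSolutionFamily qo) (hξ₀ : ξ₀ ∈ L.param)
    (he : IsOrthoBasis (L.hessKer hξ₀ (hqo.inside hξ₀)) e) {r : ℝ} (hξ : |ξ - ξ₀| < η)
    (hr : |r| < η) :
    HasDerivAt (fun r => L.action ξ (qo ξ + u ξ r)) (L.period ξ * L.bifFun qo φ u ξ r) r := by
  have hp := hu.mem_param hξ
  have hs := hu.sol hξ hr
  have hC := hu.C_pos
  rw [hasDerivAt_iff_isLittleO, isLittleO_iff]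
  intro c hc
  obtain ⟨d, hd, h⟩ := L.exists_action_approx hp hs.inside (ε := c / C) (by positivity)
  have hevr : ∀ᶠ r' in 𝓝 r, |r'| < η := (isOpen_lt (by fun_prop) continuous_const).mem_nhds hr
  filter_upwards [hevr, Metric.ball_mem_nhds r (show 0 < d / C by positivity)] with r' hr' hd'
  rw [mem_ball_iff_norm, Real.norm_eq_abs, lt_div_iff₀ hC, mul_comm] at hd'
  have h1 := (h (u ξ r' - u ξ r) (C * |r' - r|) (hu.norm_sub_le hξ hr' hr)
    (hu.norm_deriv_sub_le hξ hr' hr) hd'.le).2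
  have h2 : ip N (toX (L.elGrad ξ (qo ξ + u ξ r))) (toX (u ξ r' - u ξ r)) =
      (r' - r) * L.bifFun qo φ u ξ r := by
    rw [ip_comm, ← he.ip_projX_mem hs.grad_mem, map_sub toX, map_sub, (hu.sol hξ hr').proj, hs.proj,
      map_sub, map_smul, map_smul, bifFun]
    simp only [sub_apply, smul_apply, smul_eq_mul]
    ring
  have h3 : qo ξ + u ξ r + (u ξ r' - u ξ r) = qo ξ + u ξ r' := by abel
  rw [h2, h3] at h1
  rw [Real.norm_eq_abs, Real.norm_eq_abs, smul_eq_mul]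
  refine le_of_eq_of_le (congrArg _ (by ring)) (h1.trans_eq ?_)
  field_simp

end LagrangianFamily

/-! ### Selection, intermediate values and sign changes on the line -/

/-- Choice of nearly optimal parameters. -/
theorem exists_tendsto_of_eventually_exists {α β : Type*} {l : Filter α} {Q : α → β → Prop} {m : β → ℝ}
    [Nonempty β] (hm : ∀ b, 0 ≤ m b) {h : α → ℝ} (hh : Tendsto h l (𝓝 0)) (hpos : ∀ᶠ a in l, 0 < h a)
    (hQ : ∀ ε > 0, ∀ᶠ a in l, ∃ b, m b < ε ∧ Q a b) :
    ∃ f : α → β, Tendsto (fun a => m (f a)) l (𝓝 0) ∧ ∀ᶠ a in l, Q a (f a) := by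
  classical
  -- Choosing b within h(a) of the infimum of m gives one selection that serves every ε.
  have hex : ∀ a, ∃ b, (∃ b', Q a b') → 0 < h a →
      Q a b ∧ m b < sInf (m '' {b' | Q a b'}) + h a := by
    intro a
    by_cases h1 : (∃ b', Q a b') ∧ 0 < h a
    · obtain ⟨⟨b', hb'⟩, h2⟩ := h1
      obtain ⟨_, ⟨b, hb, rfl⟩, hlt⟩ := exists_lt_of_csInf_lt (s := m '' {b' | Q a b'})
        ⟨_, b', hb', rfl⟩ (lt_add_of_pos_right _ h2)
      exact ⟨b, fun _ _ => ⟨hb, hlt⟩⟩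
    · exact ⟨Classical.arbitrary β, fun h2 h3 => absurd ⟨h2, h3⟩ h1⟩
  choose f hf using hex
  refine ⟨f, ?_, ?_⟩
  · rw [Metric.tendsto_nhds]
    intro ε hε
    filter_upwards [hQ (ε / 2) (half_pos hε), hpos, hh.eventually (gt_mem_nhds (half_pos hε))] with a hex ha hlt
    obtain ⟨b, hb, hb'⟩ := hex
    have h1 := (hf a ⟨b, hb'⟩ ha).2
    have h2 : sInf (m '' {b' | Q a b'}) ≤ m b :=
      csInf_le ⟨0, by rintro _ ⟨b', -, rfl⟩; exact hm b'⟩ ⟨b, hb', rfl⟩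
    rw [Real.dist_eq, sub_zero, abs_of_nonneg (hm _)]
    linarith
  · filter_upwards [hQ 1 one_pos, hpos] with a hex ha
    obtain ⟨b, -, hb'⟩ := hex
    exact (hf a ⟨b, hb'⟩ ha).1

/-- The intermediate value theorem between two points of opposite sign. -/
theorem exists_eq_zero_of_mul_neg {f : ℝ → ℝ} {a b : ℝ} (hf : ContinuousOn f (Set.uIcc a b))
    (h : f a * f b < 0) : ∃ x ∈ Set.uIcc a b, f x = 0 := by
  refine intermediate_value_uIcc hf ?_
  rcases mul_neg_iff.1 h with ⟨h1, h2⟩ | ⟨h1, h2⟩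
  · exact Set.mem_uIcc.2 (Or.inr ⟨h2.le, h1.le⟩)
  · exact Set.mem_uIcc.2 (Or.inl ⟨h1.le, h2.le⟩)

theorem CrossesZero.exists_mul_neg {κ : ℝ → ℝ} {ξ₀ : ℝ} (h : CrossesZero κ ξ₀) {ε : ℝ} (hε : 0 < ε) :
    ∃ a b, |a - ξ₀| < ε ∧ |b - ξ₀| < ε ∧ κ a * κ b < 0 := by
  have hl : ∀ᶠ ξ in 𝓝[<] ξ₀, |ξ - ξ₀| < ε :=
    eventually_nhdsWithin_of_eventually_nhds (Metric.ball_mem_nhds ξ₀ hε)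
  have hr : ∀ᶠ ξ in 𝓝[>] ξ₀, |ξ - ξ₀| < ε :=
    eventually_nhdsWithin_of_eventually_nhds (Metric.ball_mem_nhds ξ₀ hε)
  rcases h.2.2 with ⟨h1, h2⟩ | ⟨h1, h2⟩
  · obtain ⟨a, ha, ha'⟩ := (h1.and hl).exists
    obtain ⟨b, hb, hb'⟩ := (h2.and hr).exists
    exact ⟨a, b, ha', hb', mul_neg_of_neg_of_pos ha hb⟩
  · obtain ⟨a, ha, ha'⟩ := (h1.and hl).exists
    obtain ⟨b, hb, hb'⟩ := (h2.and hr).exists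
    exact ⟨a, b, ha', hb', mul_neg_of_pos_of_neg ha hb⟩

/-- A function with leading term `a rⁿ` at `0` has, arbitrarily near to `0` on either side, a derivative
of the corresponding sign. -/
theorem exists_deriv_pos_of_isLittleO {g g' : ℝ → ℝ} {η : ℝ} (hη : 0 < η)
    (hg : ∀ r, |r| < η → HasDerivAt g (g' r) r) (hg0 : g 0 = 0) {n : ℕ} {a : ℝ} (ha : a ≠ 0)
    (hasy : (fun r : ℝ => g r - a * r ^ n) =o[𝓝 0] fun r : ℝ => r ^ n) {σ : ℝ}
    (hσ : σ = 1 ∨ σ = -1) {ε : ℝ} (hε : 0 < ε) :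
    ∃ t, 0 < t ∧ t < ε ∧ 0 < g' (σ * t) * σ * (a * σ ^ n) := by
  have hσ2 : σ * σ = 1 := by rcases hσ with rfl | rfl <;> norm_num
  have hσn : (σ ^ n) * (σ ^ n) = 1 := by rw [← mul_pow, hσ2, one_pow]
  have hσa : |σ| = 1 := by rcases hσ with rfl | rfl <;> norm_num
  obtain ⟨d, hd, h⟩ := Metric.eventually_nhds_iff.1 (isLittleO_iff.1 hasy (c := |a| / 2)
    (half_pos (abs_pos.2 ha)))
  set T := min (min d ε) η / 2 with hT
  have hmin : 0 < min (min d ε) η := by positivity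
  have hT0 : 0 < T := half_pos hmin
  have hTlt : T < min (min d ε) η := half_lt_self hmin
  simp only [lt_min_iff] at hTlt
  have h1 := h (y := σ * T) (by
    rw [Real.dist_eq, sub_zero, abs_mul, hσa, one_mul, abs_of_pos hT0]; exact hTlt.1.1)
  rw [Real.norm_eq_abs, Real.norm_eq_abs, mul_pow, abs_mul, abs_pow, abs_pow, hσa, one_pow, one_mul,
    abs_of_pos hT0] at h1
  have hTn : 0 < T ^ n := pow_pos hT0 n
  have h2 : 0 < g (σ * T) * (a * σ ^ n) := by
    have h3 : |g (σ * T) * (a * σ ^ n) - a ^ 2 * T ^ n| ≤ a ^ 2 * T ^ n / 2 := by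
      have h4 : g (σ * T) * (a * σ ^ n) - a ^ 2 * T ^ n =
          (g (σ * T) - a * (σ ^ n * T ^ n)) * (a * σ ^ n) := by
        linear_combination (a ^ 2 * T ^ n) * hσn
      rw [h4, abs_mul, abs_mul, abs_pow, hσa, one_pow, mul_one]
      refine (mul_le_mul_of_nonneg_right h1 (abs_nonneg a)).trans_eq ?_
      rw [← sq_abs a]
      ring
    have h5 : 0 < a ^ 2 * T ^ n := mul_pos (by positivity) hTn
    linarith [(abs_le.1 h3).1]
  -- The asymptotics concern g, not its derivative, so the sign passes to the slope over [0, T] and,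
  -- by the mean value theorem, to the derivative at one intermediate point.
  obtain ⟨t, ⟨ht0, htT⟩, ht⟩ := exists_hasDerivAt_eq_slope (fun t => g (σ * t))
    (fun t => g' (σ * t) * σ) hT0
    (fun t ht => by
      have h3 : |σ * t| < η := by
        rw [abs_mul, hσa, one_mul, abs_of_nonneg ht.1]
        exact ht.2.trans_lt hTlt.2
      exact ((hg _ h3).continuousAt.comp (f := fun t => σ * t)
        (continuous_const.mul continuous_id).continuousAt).continuousWithinAt)
    (fun t ht => by
      have h3 : |σ * t| < η := by
        rw [abs_mul, hσa, one_mul, abs_of_pos ht.1]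
        exact ht.2.trans hTlt.2
      exact (hg _ h3).comp t (by simpa using (hasDerivAt_id t).const_mul σ))
  refine ⟨t, ht0, htT.trans hTlt.1.2, ?_⟩
  simp only [mul_zero, hg0, sub_zero] at ht
  rw [ht, div_mul_eq_mul_div]
  exact div_pos h2 hT0

/-! ### From zeros of the bifurcation function to the theorem -/

namespace LagrangianFamily

open PerFun Loop

variable {N : ℕ} {L : LagrangianFamily N} {qo : ℝ → Loop N} {n : ℕ} {e : Fin n → Loop N} {ξ ξ₀ : ℝ}
  {G : Type*} [Group G] [Fintype G] {ρ : Representation ℝ G (Loop N)} {φ : Loop N} {C δ η : ℝ}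
  {u : ℝ → ℝ → Loop N}

/-- Zeros of the bifurcation function give a bifurcating branch. -/
theorem IsBranch.isBifurcatingBranch (hu : L.IsBranch qo e ξ₀ φ C δ η u)
    (hqo : L.IsSolutionFamily qo) (hG : L.IsSymmetryGroup ρ qo) (hξ₀ : ξ₀ ∈ L.param)
    (he : IsOrthoBasis (L.hessKer hξ₀ (hqo.inside hξ₀)) e)
    (hφ : L.IsCriticalMode ρ ξ₀ (qo ξ₀) φ) {ι : Type*} {l : Filter ι} {x r : ι → ℝ}
    (hx : Tendsto x l (𝓝 ξ₀)) (hr : Tendsto r l (𝓝[≠] 0))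
    (hz : ∀ᶠ a in l, L.bifFun qo φ u (x a) (r a) = 0) :
    L.IsBifurcatingBranch qo (groupProj ρ) ξ₀ φ l x r
      (fun a => qo (x a) + u (x a) (r a)) := by
  have hbox : ∀ d > 0, ∀ᶠ a in l, |x a - ξ₀| < d ∧ |r a| < d := fun d hd =>
    (hx.prodMk_nhds (hr.mono_right nhdsWithin_le_nhds)).eventually (eventually_abs_lt ξ₀ hd)
  have hr0 : ∀ᶠ a in l, r a ≠ 0 := hr.eventually self_mem_nhdsWithin
  obtain ⟨η₁, hη₁, h₁⟩ := hu.exists_elGrad_eq_zero hqo hG hξ₀ he hφ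
  obtain ⟨η₂, hη₂, h₂⟩ := hu.exists_rho_eq hqo hG hξ₀ he ((groupProj_eq_iff ρ).1 hφ.inv)
  refine ⟨hx, hr, ?_, ?_, ?_, ?_, fun ε hε => ?_⟩
  · filter_upwards [hbox η hu.η_pos] with a ha using hu.mem_param ha.1
  · filter_upwards [hbox η hu.η_pos, hbox η₁ hη₁, hz] with a ha ha' haz
    exact (L.isStationary_iff (hu.mem_param ha.1)).2
      ⟨(hu.sol ha.1 ha.2).inside, h₁ _ _ ha'.1 ha'.2 haz⟩
  · filter_upwards [hbox η hu.η_pos, hr0] with a ha ha' heq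
    -- The kernel component of the branch is r φ, which is not 0.
    have h3 := (hu.sol ha.1 ha.2).proj
    rw [add_eq_left.1 heq, map_zero, map_zero] at h3
    refine hφ.ne_zero (toX_injective ?_)
    rw [map_zero]
    exact (smul_eq_zero.1 h3.symm).resolve_left ha'
  · filter_upwards [hbox η hu.η_pos, hbox η₂ hη₂] with a ha ha'
    refine (groupProj_eq_iff ρ).2 fun g => ?_
    rw [map_add, hG.fixed _ (hu.mem_param ha.1), h₂ _ _ ha'.1 ha'.2]
  · obtain ⟨η₃, hη₃, h₃⟩ := hu.direction ε hε
    filter_upwards [hbox η₃ hη₃] with a ha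
    rw [add_sub_cancel_left]
    exact h₃ _ _ ha.1 ha.2

/-- At ξ₀ the correction u - r φ is orthogonal to the whole kernel, in particular to φ and the
Noether modes. The gradient is an invariant element of the kernel, hence exactly a multiple of φ
plus an element of the symmetrized Noether span, and the admissible variations are orthogonal to
both. -/
theorem IsBranch.isReduction (hu : L.IsBranch qo e ξ₀ φ C δ η u)
    (hqo : L.IsSolutionFamily qo) (hG : L.IsSymmetryGroup ρ qo) (hξ₀ : ξ₀ ∈ L.param)
    (he : IsOrthoBasis (L.hessKer hξ₀ (hqo.inside hξ₀)) e)
    (hφ : L.IsCriticalMode ρ ξ₀ (qo ξ₀) φ) :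
    L.IsReduction ξ₀ (qo ξ₀) (groupProj ρ) φ (fun r => u ξ₀ r - r • φ) := by
  have hξ₀' : ∀ {d : ℝ}, 0 < d → |ξ₀ - ξ₀| < d := fun hd => by simpa using hd
  have hbox : ∀ d > 0, ∀ᶠ r : ℝ in 𝓝 0, |r| < d := fun d hd => by
    filter_upwards [Metric.ball_mem_nhds (0 : ℝ) hd] with r hr
    rwa [mem_ball_zero_iff, Real.norm_eq_abs] at hr
  obtain ⟨η₂, hη₂, h₂⟩ := hu.exists_rho_eq hqo hG hξ₀ he ((groupProj_eq_iff ρ).1 hφ.inv)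
  have hK : ∀ r, |r| < η → ∀ k, L.hessLoop ξ₀ (qo ξ₀) k = 0 →
      ip N (toX k) (toX (u ξ₀ r - r • φ)) = 0 := by
    intro r hr k hk
    have h3 := (hu.sol (hξ₀' hu.η_pos) hr).proj
    rw [ip_comm, ← he.ip_projX_mem hk, map_sub, map_sub, h3, map_smul, map_smul,
      he.projX_toX hφ.hess, sub_self, map_zero, zero_apply]
  refine ⟨?_, ?_, ?_⟩
  · obtain ⟨K, d, hd, h⟩ := hu.quadratic
    exact ⟨K, (hbox d hd).mono h⟩
  · filter_upwards [hbox η hu.η_pos, hbox η₂ hη₂] with r hr hr'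
    refine ⟨?_, hK r hr φ hφ.hess, fun I hI => ?_⟩
    · rw [map_sub, map_smul, hφ.inv, (groupProj_eq_iff ρ).2 (h₂ ξ₀ r (hξ₀' hη₂) hr')]
    · rw [hI.loopInner_noetherMode hξ₀ (hqo.inside hξ₀)]
      exact hK r hr _ (hI.hessLoop_noetherLoop hqo hξ₀)
  · have hle := hG.noetherSpan_le hqo hξ₀
    have := L.finiteDimensional_hessKer hξ₀ (hqo.inside hξ₀)
    have : FiniteDimensional ℝ (L.noetherSpan ρ ξ₀ (qo ξ₀)) := Submodule.finiteDimensional_of_le hle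
    obtain ⟨m, f, hf⟩ := exists_isOrthoBasis (L.noetherSpan ρ ξ₀ (qo ξ₀))
    filter_upwards [hbox η hu.η_pos, hbox η₂ hη₂] with r hr hr' v hv hφv hzv
    have hs := hu.sol (hξ₀' hu.η_pos) hr
    have h3 : qo ξ₀ + r • φ + (u ξ₀ r - r • φ) = qo ξ₀ + u ξ₀ r := by abel
    rw [h3, L.hasDerivAt_action_zero_iff hξ₀ hs.inside]
    set γ := L.elGrad ξ₀ (qo ξ₀ + u ξ₀ r) with hγ
    have hγP : groupProj ρ γ = γ := (groupProj_eq_iff ρ).2 fun g => by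
      have h4 : ρ g (qo ξ₀ + u ξ₀ r) = qo ξ₀ + u ξ₀ r := by
        rw [map_add, hG.fixed _ hξ₀, h₂ _ _ (hξ₀' hη₂) hr']
      rw [hγ, ← hG.elGrad_rho hξ₀ g hs.inside, h4]
    have h5 := hφ.sub_projL_eq hG hqo hξ₀ hf hs.grad_mem hγP
    rw [sub_eq_iff_eq_add] at h5
    refine (congrArg (fun y => ip N (toX y) (toX v)) h5).trans ?_
    simp only [map_add, map_smul, add_apply, smul_apply]
    rw [← loopInner_eq φ v, hφv, smul_zero, zero_add]
    exact hG.ip_eq_zero_of_mem_noetherSpan (hf.projL_mem γ) hv fun I hI => by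
      rw [← hI.loopInner_noetherMode hξ₀ (hqo.inside hξ₀)]
      exact hzv I hI

end LagrangianFamily

end

theorem corollary1 {N : ℕ} (L : LagrangianFamily N) {G : Type*} [Group G] [Fintype G]
    (ρ : Representation ℝ G (Loop N)) (qo : ℝ → Loop N) (ξ₀ : ℝ) (κ : ℝ → ℝ) (φ : ℝ → Loop N)
    (hξ₀ : ξ₀ ∈ L.param)
    (hqo : L.IsSolutionFamily qo)
    (hG : L.IsSymmetryGroup ρ qo)
    (hκ : CrossesZero κ ξ₀)
    (hφ : ∀ ξ ∈ L.param, φ ξ ≠ 0)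
    (hdim : ∀ ξ ∈ L.param, ∀ u : Loop N,
      (u ∈ L.eigenfunctions ξ (qo ξ) (κ ξ) ∧ groupProj ρ u = u) ↔ ∃ c : ℝ, u = c • φ ξ) :
    (∃ (ξ : ℝ → ℝ) (qb : ℝ → Loop N),
      L.IsBifurcatingBranch qo (groupProj ρ) ξ₀ (φ ξ₀) (𝓝[≠] (0 : ℝ)) ξ (fun r => r) qb) ∧
    ∃ w : ℝ → Loop N, L.IsReduction ξ₀ (qo ξ₀) (groupProj ρ) (φ ξ₀) w ∧
      ∀ (n : ℕ) (A : ℝ), 3 ≤ n → A ≠ 0 →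
        (fun r : ℝ => L.reducedAction ξ₀ (qo ξ₀) (φ ξ₀) w r - A / (n.factorial : ℝ) * r ^ n)
          =o[𝓝 0] (fun r : ℝ => r ^ n) →
        ∀ σ : ℝ, (σ = 1 ∨ σ = -1) →
          ∃ (r : ℝ → ℝ) (qb : ℝ → Loop N),
            L.IsBifurcatingBranch qo (groupProj ρ) ξ₀ (φ ξ₀)
              (𝓝[{ξ | κ ξ * A * σ ^ n < 0}] ξ₀) (fun ξ => ξ) r qb ∧
            ∀ᶠ ξ in 𝓝[{ξ | κ ξ * A * σ ^ n < 0}] ξ₀, 0 < σ * r ξ := by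
  have hψ : ∀ ξ ∈ L.param, φ ξ ∈ L.eigenfunctions ξ (qo ξ) (κ ξ) ∧ groupProj ρ (φ ξ) = φ ξ :=
    fun ξ hξ => (hdim ξ hξ (φ ξ)).2 ⟨1, (one_smul ℝ _).symm⟩
  have hκ0 : κ ξ₀ = 0 := hκ.2.1
  have hκt : Tendsto κ (𝓝 ξ₀) (𝓝 0) := by
    have h := hκ.1
    rwa [ContinuousAt, hκ0] at h
  have hcrit : L.IsCriticalMode ρ ξ₀ (qo ξ₀) (φ ξ₀) := by
    have h1 := (LagrangianFamily.mem_eigenfunctions_iff hξ₀ (hqo.inside hξ₀)).1 (hψ ξ₀ hξ₀).1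
    refine ⟨hφ ξ₀ hξ₀, by rw [h1.1, hκ0, zero_smul], h1.2, (hψ ξ₀ hξ₀).2, fun u hu hz hP => ?_⟩
    exact (hdim ξ₀ hξ₀ u).1 ⟨(LagrangianFamily.mem_eigenfunctions_iff hξ₀ (hqo.inside hξ₀)).2
      ⟨by rw [hu, hκ0, zero_smul], hz⟩, hP⟩
  have := L.finiteDimensional_hessKer hξ₀ (hqo.inside hξ₀)
  obtain ⟨m, e, he⟩ := Loop.exists_isOrthoBasis (L.hessKer hξ₀ (hqo.inside hξ₀))
  obtain ⟨C, δ, η, u, hu⟩ := LagrangianFamily.exists_isBranch hqo hξ₀ he hcrit.hess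
  obtain ⟨η₁, hη₁, hpos⟩ := hu.exists_bifFun_pos hqo hG hξ₀ he hcrit hκt (fun ξ hξ => (hψ ξ hξ).1)
    (fun ξ hξ => (hψ ξ hξ).2) hφ
  obtain ⟨η₂, hη₂, hcont⟩ := hu.exists_continuousAt_bifFun hqo hξ₀
  set F := L.bifFun qo (φ ξ₀) u with hF
  have hη := hu.η_pos
  refine ⟨?_, _, hu.isReduction hqo hG hξ₀ he hcrit, ?_⟩
  -- The two parameters where κ has opposite signs are fixed before r, since the range of r with a
  -- known sign of F depends on them.
  · have hzero : ∀ ε > 0, ∀ᶠ r : ℝ in 𝓝[≠] 0, ∃ ξ, |ξ - ξ₀| < ε ∧ F ξ r = 0 := by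
      intro ε hε
      obtain ⟨a, b, ha, hb, hab⟩ := hκ.exists_mul_neg (ε := min ε (min η₁ η₂)) (by positivity)
      simp only [lt_min_iff] at ha hb
      obtain ⟨ra, hra, hFa⟩ := hpos a ha.2.1 (left_ne_zero_of_mul hab.ne)
      obtain ⟨rb, hrb, hFb⟩ := hpos b hb.2.1 (right_ne_zero_of_mul hab.ne)
      have hball := eventually_nhdsWithin_of_eventually_nhds (s := {0}ᶜ)
        (Metric.ball_mem_nhds (0 : ℝ) (show 0 < min η₂ (min ra rb) by positivity))
      filter_upwards [hball, self_mem_nhdsWithin] with r hr hr0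
      rw [Real.dist_eq, sub_zero, lt_min_iff, lt_min_iff] at hr
      have h1 := hFa r hr0 hr.2.1
      have h2 := hFb r hr0 hr.2.2
      have hconv : ∀ ζ ∈ Set.uIcc a b, |ζ - ξ₀| < ε ∧ |ζ - ξ₀| < η₂ := by
        intro ζ hζ
        have hconvex : ∀ {d : ℝ}, |a - ξ₀| < d → |b - ξ₀| < d → |ζ - ξ₀| < d := by
          intro d h3 h4
          rw [abs_lt] at *
          rcases Set.mem_uIcc.1 hζ with ⟨h5, h6⟩ | ⟨h5, h6⟩ <;> constructor <;> linarith
        exact ⟨hconvex ha.1 hb.1, hconvex ha.2.2 hb.2.2⟩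
      have h3 : F a r * F b r < 0 := by
        have h4 := mul_pos h1 h2
        have h5 : κ a * F a r * r * (κ b * F b r * r) = (κ a * κ b) * r ^ 2 * (F a r * F b r) := by
          ring
        rw [h5] at h4
        exact neg_of_mul_pos_right h4 (mul_nonpos_of_nonpos_of_nonneg hab.le (sq_nonneg r))
      obtain ⟨ζ, hζ, h0⟩ := exists_eq_zero_of_mul_neg (f := fun ζ => F ζ r)
        (fun ζ hζ => (hcont ζ r (hconv ζ hζ).2 hr.1).1.continuousWithinAt) h3
      exact ⟨ζ, (hconv ζ hζ).1, h0⟩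
    obtain ⟨x, hx, hx0⟩ := exists_tendsto_of_eventually_exists (m := fun ξ => |ξ - ξ₀|)
      (h := fun r : ℝ => |r|) (fun ξ => abs_nonneg _)
      (by
        have : ContinuousAt (fun r : ℝ => |r|) 0 := continuous_abs.continuousAt
        rw [ContinuousAt, abs_zero] at this
        exact this.mono_left nhdsWithin_le_nhds)
      (by filter_upwards [self_mem_nhdsWithin] with r hr using abs_pos.2 hr) hzero
    refine ⟨x, _, hu.isBifurcatingBranch hqo hG hξ₀ he hcrit ?_ tendsto_id hx0⟩
    rwa [tendsto_iff_norm_sub_tendsto_zero]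
  · intro n A _ hA hasy σ hσ
    have hσ2 : σ * σ = 1 := by rcases hσ with rfl | rfl <;> norm_num
    have hσa : |σ| = 1 := by rcases hσ with rfl | rfl <;> norm_num
    have hT := L.period_pos ξ₀ hξ₀
    have hξ₀' : ∀ {d : ℝ}, 0 < d → |ξ₀ - ξ₀| < d := fun hd => by simpa using hd
    have hfac : (0 : ℝ) < (n.factorial : ℝ) := by exact_mod_cast n.factorial_pos
    have hred : ∀ r, L.reducedAction ξ₀ (qo ξ₀) (φ ξ₀) (fun r => u ξ₀ r - r • φ ξ₀) r =
        L.action ξ₀ (qo ξ₀ + u ξ₀ r) - L.action ξ₀ (qo ξ₀) := fun r => by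
      have h3 : qo ξ₀ + r • φ ξ₀ + (u ξ₀ r - r • φ ξ₀) = qo ξ₀ + u ξ₀ r := by abel
      rw [LagrangianFamily.reducedAction, h3]
    simp only [hred] at hasy
    -- The derivative of the reduced action is the period times F, so its leading term fixes the
    -- sign of F at points σ t arbitrarily close to 0.
    have hsign : ∀ ε > 0, ∃ t, 0 < t ∧ t < ε ∧ 0 < F ξ₀ (σ * t) * σ * (A * σ ^ n) := by
      intro ε hε
      obtain ⟨t, ht0, htε, ht⟩ := exists_deriv_pos_of_isLittleO hη
        (fun r hr => (hu.hasDerivAt_action hqo hξ₀ he (hξ₀' hη) hr).sub_const (L.action ξ₀ (qo ξ₀)))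
        (by rw [hu.apply_zero hqo hξ₀ (hξ₀' hη), add_zero, sub_self])
        (div_ne_zero hA hfac.ne') hasy hσ hε
      refine ⟨t, ht0, htε, ?_⟩
      have h4 : L.period ξ₀ * L.bifFun qo (φ ξ₀) u ξ₀ (σ * t) * σ * (A / n.factorial * σ ^ n) =
          L.period ξ₀ / n.factorial * (F ξ₀ (σ * t) * σ * (A * σ ^ n)) := by
        rw [hF]; ring
      rw [h4] at ht
      exact pos_of_mul_pos_right ht (div_pos hT hfac).le
    have hzero : ∀ ε > 0, ∀ᶠ ξ in 𝓝[{ξ | κ ξ * A * σ ^ n < 0}] ξ₀,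
        ∃ r, |r| < ε ∧ (0 < σ * r ∧ F ξ r = 0) := by
      intro ε hε
      obtain ⟨t, ht0, htε, ht⟩ := hsign (min ε η₂) (by positivity)
      rw [lt_min_iff] at htε
      have habs : ∀ {s : ℝ}, 0 < s → |σ * s| = s := fun hs => by
        rw [abs_mul, hσa, one_mul, abs_of_pos hs]
      have hc : ContinuousAt (fun ξ => F ξ (σ * t) * σ * (A * σ ^ n)) ξ₀ :=
        -- With t fixed, continuity in ξ carries the sign found at ξ₀ to nearby parameters.
        (((hcont ξ₀ (σ * t) (hξ₀' hη₂) (by rw [habs ht0]; exact htε.2)).1.mul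
          continuousAt_const).mul continuousAt_const)
      have hev := eventually_nhdsWithin_of_eventually_nhds (s := {ξ | κ ξ * A * σ ^ n < 0})
        ((hc.eventually (lt_mem_nhds ht)).and
          (Metric.ball_mem_nhds ξ₀ (show 0 < min η₁ η₂ by positivity)))
      filter_upwards [hev, self_mem_nhdsWithin] with ξ hξ hξS
      obtain ⟨h1, h2⟩ := hξ
      rw [Real.dist_eq, lt_min_iff] at h2
      have hξS : κ ξ * A * σ ^ n < 0 := hξS
      have hκξ : κ ξ ≠ 0 := left_ne_zero_of_mul (left_ne_zero_of_mul hξS.ne)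
      obtain ⟨r₀, hr₀, hr⟩ := hpos ξ h2.1 hκξ
      -- The inner endpoint depends on ξ and lies where κ(ξ) decides the sign; the outer endpoint t
      -- does not depend on ξ.
      set s := min (r₀ / 2) t with hs
      have hs0 : 0 < s := by positivity
      have hst : s ≤ t := min_le_right _ _
      have h3 := hr (σ * s) (right_ne_zero_of_mul (a := σ) (by
          rw [← mul_assoc, hσ2, one_mul]; exact hs0.ne')) (by
        rw [habs hs0]
        exact (min_le_left _ _).trans_lt (half_lt_self hr₀))
      have h4 : F ξ (σ * s) * F ξ (σ * t) < 0 := by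
        have h5 := mul_pos h3 h1
        have h6 : κ ξ * F ξ (σ * s) * (σ * s) * (F ξ (σ * t) * σ * (A * σ ^ n)) =
            (κ ξ * A * σ ^ n) * s * (F ξ (σ * s) * F ξ (σ * t)) := by
          linear_combination (κ ξ * F ξ (σ * s) * s * F ξ (σ * t) * A * σ ^ n) * hσ2
        rw [h6] at h5
        exact neg_of_mul_pos_right h5 (mul_nonpos_of_nonpos_of_nonneg hξS.le hs0.le)
      obtain ⟨y, hy, h0⟩ := exists_eq_zero_of_mul_neg (f := fun y => F ξ (σ * y)) (a := s) (b := t)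
        (fun y hy => by
          rw [Set.uIcc_of_le hst] at hy
          exact ((hcont ξ (σ * y) h2.2 (by
            rw [habs (hs0.trans_le hy.1)]; exact hy.2.trans_lt htε.2)).2.comp
            (f := fun y => σ * y) (continuous_const.mul continuous_id).continuousAt).continuousWithinAt)
        h4
      rw [Set.uIcc_of_le hst] at hy
      have hy0 := hs0.trans_le hy.1
      refine ⟨σ * y, by rw [habs hy0]; exact hy.2.trans_lt htε.1, ?_, h0⟩
      rw [← mul_assoc, hσ2, one_mul]
      exact hy0
    obtain ⟨r, hr, hr0⟩ := exists_tendsto_of_eventually_exists (m := fun r : ℝ => |r|)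
      (h := fun ξ : ℝ => |ξ - ξ₀|) (fun r => abs_nonneg _)
      (by
        have : ContinuousAt (fun ξ : ℝ => |ξ - ξ₀|) ξ₀ := by fun_prop
        rw [ContinuousAt, sub_self, abs_zero] at this
        exact this.mono_left nhdsWithin_le_nhds)
      (by
        filter_upwards [self_mem_nhdsWithin] with ξ hξ
        -- The set of admissible parameters excludes ξ₀ because κ vanishes there.
        refine abs_pos.2 (sub_ne_zero.2 ?_)
        rintro rfl
        have hξ : κ ξ * A * σ ^ n < 0 := hξ
        rw [hκ0, zero_mul, zero_mul] at hξ
        exact lt_irrefl _ hξ) hzero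
    refine ⟨r, _, hu.isBifurcatingBranch hqo hG hξ₀ he hcrit
      (tendsto_id.mono_right nhdsWithin_le_nhds) ?_ (hr0.mono fun ξ h => h.2), hr0.mono fun ξ h => h.1⟩
    refine tendsto_nhdsWithin_iff.2 ⟨(tendsto_zero_iff_abs_tendsto_zero _).2 hr, hr0.mono fun ξ h => ?_⟩
    exact right_ne_zero_of_mul h.1.ne'
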